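/- Let $k\ge 1$, $r=\lfloor\frac{k+1}{2}\rfloor$, and let $q=(q_1,\dots,q_r)$ be positive real numbers. Let $\mathcal W_k$ be the set of $x\in\mathbb N^{r}$ with $x_1\ge\dots\ge x_r\ge 0$. Let $GT_k$ be the set of symplectic Gelfand–Tsetlin patterns, i.e. of families $x=(x^1,\dots,x^k)$ with $x^i\in\mathbb N^{\lfloor (i+1)/2\rfloor}$ and $x^{i+1}_{j+1}\le x^i_j\le x^{i+1}_j$ whenever these entries exist. With $|x^i|=\sum_j x^i_j$ and $|x^0|=0$, put $$w^k_x(q)=\prod_{2m-1\le k} q_m^{|x^{2m-1}|-|x^{2m-2}|}\prod_{2m\le k} q_m^{|x^{2m-1}|-|x^{2m}|},\qquad s^k_\lambda(q)=\sum_{x\in GT_k,\;x^k=\lambda} w^k_x(q)\quad(\lambda\in\mathcal W_k)$$ (the symplectic Schur functions). Consider the following process $(Y(t))_{t\ge 0}$ on $GT_k$ (one particle for each label $(i,j)$, $1\le i\le k$, $1\le j\le\lfloor\frac{i+1}{2}\rfloor$, located at $Y^i_j(t)$). At time $0$ all particles are at $0$. The particle $(2m-1,j)$ tries to jump by one to the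 right at rate $q_m$ and to the left at rate $q_m^{-1}$; the particle $(2m,j)$ tries to jump by one to the right at rate $q_m^{-1}$ and to the left at rate $q_m$; that is, each particle has, for each direction, a clock whose successive waiting times are exponentially distributed with that rate, and all waiting times are independent. Nothing moves between these attempts. If the particle $(i,j)$ tries to jump at time $t$, the jump is made as follows. * To the right: if $j\ge 2$ and $Y^i_j(t^-)=Y^{i-1}_{j-1}(t^-)$, nothing moves. Otherwise the particles $(i,j),(i+1,j),\dots,(i+l,j)$ all move to the right by one, where $l$ is the largest integer with $i+l\le k$ and $Y^{i+l}_j(t^-)=Y^i_j(t^-)$. * To the left: if $i$ is odd and $j=\frac{i+1}{2}$, the particle $(i,j)$ alone moves to the left by one if $Y^i_j(t^-)\ge 1$, and nothing moves if $Y^i_j(t^-)=0$. In all other cases, nothing moves if $Y^i_j(t^-)=Y^{i-1}_j(t^-)$, and if $Y^i_j(t^-)>Y^{i-1}_j(t^-)$ the particles $(i,j),(i+1,j+1),\dots,(i+l,j+l)$ all move to the left by one, where $l$ is the largest integer such that $(i+l,j+l)$ is a label and $Y^{i+l}_{j+l}(t^-)=Y^i_j(t^-)$. Then the $k$-th row $(Y^k(t))_{t\ge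 0}$ is a time-homogeneous Markov process on $\mathcal W_k$ with infinitesimal generator $A$ given, for $x\in\mathcal W_k$ and $y\in\{x\pm e_1,\dots,x\pm e_r\}$, by $$A(x,y)=\frac{s^k_y(q)}{s^k_x(q)}\,1_{y\in\mathcal W_k},$$ with $A(x,y)=0$ for all other $y\ne x$ and $A(x,x)=-\sum_{y\ne x}A(x,y)$. That is, the finite-dimensional distributions of $Y^k$ are given by a transition function $(P_t)_{t\ge0}$ on $\mathcal W_k$ with $\frac{d}{dt}P_t(x,y)\big|_{t=0}=A(x,y)$ for all $x,y\in\mathcal W_k$. -/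

import Mathlib

open MeasureTheory ProbabilityTheory Filter Topology
open scoped NNReal

namespace WallModel

/-! ### Symplectic Gelfand-Tsetlin patterns and symplectic Schur functions -/

/-- `(i, j)` with `1 ≤ i ≤ k` and `1 ≤ j ≤ ⌊(i+1)/2⌋`: the label of a particle. -/
def IsLabel (k i j : ℕ) : Prop :=
  1 ≤ i ∧ i ≤ k ∧ 1 ≤ j ∧ j ≤ (i + 1) / 2

/-- The set `GT_k` of symplectic Gelfand-Tsetlin patterns: `entry i j` is `x^i_j`.  The row `x^i`
has `⌊(i+1)/2⌋` entries in `ℕ` and consecutive rows interlace,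
`x^{i+1}_{j+1} ≤ x^i_j ≤ x^{i+1}_j`.
Entries at indices that are not labels are `0` by convention. -/
@[ext]
structure GT (k : ℕ) where
  entry : ℕ → ℕ → ℕ
  entry_eq_zero : ∀ i j, ¬ IsLabel k i j → entry i j = 0
  entry_le : ∀ i j, IsLabel k i j → IsLabel k (i + 1) j → entry i j ≤ entry (i + 1) j
  le_entry : ∀ i j, IsLabel k i j → IsLabel k (i + 1) (j + 1) → entry (i + 1) (j + 1) ≤ entry i j

/-- The set `W_k` of nonincreasing vectors of `⌊(k+1)/2⌋` nonnegative integers. -/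
abbrev W (k : ℕ) : Type :=
  {v : Fin ((k + 1) / 2) → ℕ // Antitone v}

variable {k : ℕ}

/-- Rows are nonincreasing, because of the interlacing with the row before. -/
theorem GT.entry_succ_le (x : GT k) (i j : ℕ) (hj : 1 ≤ j) : x.entry i (j + 1) ≤ x.entry i j := by
  by_cases h : IsLabel k i (j + 1)
  · obtain ⟨h1, h2, h3, h4⟩ := h
    obtain ⟨i, rfl⟩ : ∃ m, i = m + 1 := ⟨i - 1, by omega⟩
    have ha : IsLabel k i j := ⟨by omega, by omega, by omega, by omega⟩
    exact (x.le_entry i j ha ⟨h1, h2, h3, h4⟩).trans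
      (x.entry_le i j ha ⟨h1, h2, hj, by omega⟩)
  · rw [x.entry_eq_zero _ _ h]
    exact Nat.zero_le _

/-- The columns of a pattern are nondecreasing. -/
theorem GT.entry_le_col (x : GT k) {i j m : ℕ} (h : IsLabel k i j) (him : i ≤ m) (hm : m ≤ k) :
    x.entry i j ≤ x.entry m j := by
  obtain ⟨h1, h2, h3, h4⟩ := h
  induction m, him using Nat.le_induction with
  | base => exact le_rfl
  | succ d hd ih =>
    exact (ih (by omega)).trans (x.entry_le d j ⟨by omega, by omega, h3, by omega⟩
      ⟨by omega, hm, h3, by omega⟩)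

/-- The diagonals of a pattern are nonincreasing. -/
theorem GT.le_entry_diag (x : GT k) {i j : ℕ} (h : IsLabel k i j) (l : ℕ)
    (hl : IsLabel k (i + l) (j + l)) : x.entry (i + l) (j + l) ≤ x.entry i j := by
  obtain ⟨h1, h2, h3, h4⟩ := h
  induction l with
  | zero => exact le_rfl
  | succ l ih =>
    obtain ⟨f1, f2, f3, f4⟩ := hl
    have hl' : IsLabel k (i + l) (j + l) := ⟨by omega, by omega, by omega, by omega⟩
    exact (x.le_entry (i + l) (j + l) hl' ⟨f1, f2, f3, f4⟩).trans (ih hl')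

/-- The `k`-th row of a pattern of `GT_k`, as an element of `W_k`. -/
def GT.lastRow (x : GT k) : W k :=
  ⟨fun j => x.entry k (j + 1), by
    intro a b hab
    have key : ∀ d m : ℕ, 1 ≤ m → x.entry k (m + d) ≤ x.entry k m := by
      intro d
      induction d with
      | zero => intro m _; exact le_rfl
      | succ d ih => intro m hm; exact (x.entry_succ_le k (m + d) (by omega)).trans (ih m hm)
    have h2 : (a : ℕ) ≤ b := hab
    have h := key ((b : ℕ) - a) (a + 1) (by omega)
    rwa [show (a : ℕ) + 1 + (b - a) = b + 1 by omega] at h⟩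

/-- `|x^i|`, the sum of the entries of row `i`. -/
def GT.rowSum (x : GT k) (i : ℕ) : ℤ :=
  ∑ j ∈ Finset.Icc 1 ((i + 1) / 2), (x.entry i j : ℤ)

/-- The weight `w^n_x(q)`, by recursion on the number `n` of rows: the row `n + 1` contributes
`q_m ^ (|x^{n+1}| - |x^n|)` if `n + 1 = 2m - 1` and `q_m ^ (|x^n| - |x^{n+1}|)` if `n + 1 = 2m`
(with `|x^0| = 0`, so that `w^1_x(q) = q_1 ^ |x^1|`). -/
noncomputable def GT.weight (q : ℕ → ℝ) (x : GT k) : ℕ → ℝ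
  | 0 => 1
  | n + 1 => x.weight q n * q ((n + 2) / 2) ^
      (if Odd (n + 1) then x.rowSum (n + 1) - x.rowSum n else x.rowSum n - x.rowSum (n + 1))

/-- There are finitely many patterns with a given last row, so the sum in `schur` is a finite sum. -/
theorem GT.finite_lastRow_eq (v : W k) : {x : GT k | x.lastRow = v}.Finite := by
  classical
  have bound : ∀ (x : GT k) (d i j : ℕ), i + d = k → x.entry i j ≤ x.entry k 1 := by
    intro x d
    induction d with
    | zero =>
      intro i j hi
      have hik : i = k := by omega
      subst hik
      by_cases hl : IsLabel i i j
      · have key : ∀ m : ℕ, x.entry i (1 + m) ≤ x.entry i 1 := by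
          intro m
          induction m with
          | zero => exact le_rfl
          | succ m ih => exact (x.entry_succ_le i (1 + m) (by omega)).trans ih
        have h := key (j - 1)
        rwa [show 1 + (j - 1) = j from by have := hl.2.2.1; omega] at h
      · rw [x.entry_eq_zero _ _ hl]; exact Nat.zero_le _
    | succ d ih =>
      intro i j hi
      by_cases hl : IsLabel k i j
      · obtain ⟨h1, h2, h3, h4⟩ := hl
        exact (x.entry_le i j ⟨h1, h2, h3, h4⟩ ⟨by omega, by omega, h3, by omega⟩).trans
          (ih (i + 1) j (by omega))
      · rw [x.entry_eq_zero _ _ hl]; exact Nat.zero_le _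
  rcases Nat.eq_zero_or_pos k with hk | hk
  · refine Set.Subsingleton.finite ?_
    intro x _ y _
    ext i j
    rw [x.entry_eq_zero i j (fun h => by have := h.1; have := h.2.1; omega),
      y.entry_eq_zero i j (fun h => by have := h.1; have := h.2.1; omega)]
  · set B : ℕ := v.1 ⟨0, by omega⟩ with hB
    have hle : ∀ x : GT k, x.lastRow = v → ∀ i j, x.entry i j ≤ B := by
      intro x hx i j
      have h1 : x.entry k 1 = B := by rw [hB, ← hx]; rfl
      by_cases hl : IsLabel k i j
      · rw [← h1]; exact bound x (k - i) i j (by have := hl.2.1; omega)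
      · rw [x.entry_eq_zero _ _ hl]; exact Nat.zero_le _
    let f : GT k → (Fin (k + 1) → Fin (k + 1) → Fin (B + 1)) :=
      fun x i j => Fin.ofNat (B + 1) (x.entry i j)
    refine Set.Finite.of_finite_image (f := f) (Set.toFinite _) ?_
    intro x hx y hy hxy
    ext i j
    by_cases hl : IsLabel k i j
    · have hi : i < k + 1 := by have := hl.2.1; omega
      have hj : j < k + 1 := by have := hl.2.2.2; have := hl.1; omega
      have h := congrArg Fin.val (congrFun (congrFun hxy ⟨i, hi⟩) ⟨j, hj⟩)
      have hx' := hle x hx i j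
      have hy' := hle y hy i j
      simp only [f, Fin.ofNat] at h
      rwa [Nat.mod_eq_of_lt (by omega), Nat.mod_eq_of_lt (by omega)] at h
    · rw [x.entry_eq_zero _ _ hl, y.entry_eq_zero _ _ hl]

/-- The symplectic Schur function `s^k_v(q)`: the sum of `w^k_x(q)` over the patterns `x` of `GT_k`
whose last row is `v`. -/
noncomputable def schur (q : ℕ → ℝ) (v : W k) : ℝ :=
  ∑ x ∈ (GT.finite_lastRow_eq v).toFinset, x.weight q k

/-! ### The particle model -/

/-- The labels of the particles of a pattern of `GT_k`. -/
abbrev Label (k : ℕ) : Type :=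
  {p : ℕ × ℕ // IsLabel k p.1 p.2}

/-- The two directions of a jump. -/
inductive Dir
  | left
  | right

open Classical in
/-- The configuration after the particle `(i, j)` has tried to jump to the right.  The particle is
blocked if `j ≥ 2` and `x^i_j = x^{i-1}_{j-1}`.  Otherwise it moves by one together with the
particles `(i+1, j), …, (i+l, j)`, where `l` is largest with `x^{i+l}_j = x^i_j`; as `x^m_j` is
nondecreasing in `m`, these are all the particles `(m, j)`, `m ≥ i`, with `x^m_j = x^i_j`. -/
noncomputable def GT.tryRight (x : GT k) (p : Label k) : GT k where
  entry := fun m n =>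
    if ¬ (2 ≤ p.1.2 ∧ x.entry p.1.1 p.1.2 = x.entry (p.1.1 - 1) (p.1.2 - 1)) ∧
        IsLabel k m n ∧ p.1.1 ≤ m ∧ n = p.1.2 ∧ x.entry m n = x.entry p.1.1 p.1.2
    then x.entry m n + 1 else x.entry m n
  entry_eq_zero := by
    intro m n h
    rw [if_neg (fun hc => h hc.2.1), x.entry_eq_zero m n h]
  entry_le := by
    intro m n h1 h2
    have hle := x.entry_le m n h1 h2
    split_ifs with c1 c2 c2
    · omega
    · exact Nat.lt_of_le_of_ne hle fun he =>
        c2 ⟨c1.1, h2, by have := c1.2.2.1; omega, c1.2.2.2.1, by rw [← he]; exact c1.2.2.2.2⟩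
    · omega
    · exact hle
  le_entry := by
    intro m n h1 h2
    have hle := x.le_entry m n h1 h2
    split_ifs with c1 c2 c2
    · omega
    · obtain ⟨hb, -, hm, hn, he⟩ := c1
      refine Nat.lt_of_le_of_ne hle fun hmn => hb ?_
      obtain ⟨⟨i, j⟩, hl⟩ := p
      obtain ⟨g1, g2, g3, g4⟩ := hl
      obtain ⟨f1, f2, f3, f4⟩ := h1
      simp only at g1 g2 g3 g4 hm hn he ⊢
      subst hn
      obtain ⟨i, rfl⟩ : ∃ d, i = d + 1 := ⟨i - 1, by omega⟩
      have hl' : IsLabel k i n := ⟨by omega, by omega, f3, by omega⟩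
      have e1 := x.entry_le_col (m := m) hl' (by omega) f2
      have e2 := x.le_entry i n hl' ⟨g1, g2, g3, g4⟩
      refine ⟨by omega, ?_⟩
      simp only [Nat.add_sub_cancel]
      omega
    · omega
    · exact hle

open Classical in
/-- The configuration after the particle `(i, j)` has tried to jump to the left.  The particle is
blocked if `x^i_j = x^{i-1}_j`; for the particle next to the wall (`i` odd and `j = (i+1)/2`) the
label `(i-1, j)` does not exist, `x^{i-1}_j` is `0` by convention, and the particle is blocked if
and only if it is at `0`.  Otherwise it moves by one together with the particles
`(i+1, j+1), …, (i+l, j+l)`, where `l` is largest with `x^{i+l}_{j+l} = x^i_j`; as `x^{i+m}_{j+m}`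
is nonincreasing in `m`, these are all the particles `(i+m, j+m)` with `x^{i+m}_{j+m} = x^i_j`.
(The particle next to the wall pushes nobody, as `(i+1, j+1)` is then not a label.) -/
noncomputable def GT.tryLeft (x : GT k) (p : Label k) : GT k where
  entry := fun m n =>
    if x.entry p.1.1 p.1.2 ≠ x.entry (p.1.1 - 1) p.1.2 ∧
        IsLabel k m n ∧ (∃ l, m = p.1.1 + l ∧ n = p.1.2 + l) ∧ x.entry m n = x.entry p.1.1 p.1.2
    then x.entry m n - 1 else x.entry m n
  entry_eq_zero := by
    intro m n h
    rw [if_neg (fun hc => h hc.2.1), x.entry_eq_zero m n h]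
  entry_le := by
    intro m n h1 h2
    have hle := x.entry_le m n h1 h2
    split_ifs with c1 c2 c2
    · omega
    · omega
    · obtain ⟨hb, -, ⟨l, hm, hn⟩, he⟩ := c2
      refine Nat.le_sub_one_of_lt (Nat.lt_of_le_of_ne hle fun hmn => hb ?_)
      obtain ⟨⟨i, j⟩, hl⟩ := p
      obtain ⟨g1, g2, g3, g4⟩ := hl
      simp only at g1 g2 g3 g4 hm hn he ⊢
      obtain ⟨i, rfl⟩ : ∃ d, i = d + 1 := ⟨i - 1, by omega⟩
      obtain rfl : m = i + l := by omega
      subst hn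
      obtain ⟨f1, f2, f3, f4⟩ := h1
      have hl' : IsLabel k i j := ⟨by omega, by omega, g3, by omega⟩
      have e1 := x.le_entry_diag hl' l ⟨f1, f2, f3, f4⟩
      have e2 := x.entry_le i j hl' ⟨g1, g2, g3, g4⟩
      simp only [Nat.add_sub_cancel]
      omega
    · exact hle
  le_entry := by
    intro m n h1 h2
    have hle := x.le_entry m n h1 h2
    split_ifs with c1 c2 c2
    · omega
    · omega
    · obtain ⟨hb, -, ⟨l, hm, hn⟩, he⟩ := c2
      refine Nat.le_sub_one_of_lt (Nat.lt_of_le_of_ne hle fun hmn => c1 ?_)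
      exact ⟨hb, h2, ⟨l + 1, by omega, by omega⟩, by omega⟩
    · exact hle

/-- The clocks: one for each particle and each direction. -/
abbrev Clock (k : ℕ) : Type :=
  Label k × Dir

/-- The configuration after the clock `c` has rung. -/
noncomputable def GT.ring (x : GT k) (c : Clock k) : GT k :=
  match c.2 with
  | Dir.left => x.tryLeft c.1
  | Dir.right => x.tryRight c.1

/-- The rates: the particle `(2m-1, j)` tries to jump to the right at rate `q_m` and to the left at
rate `q_m⁻¹`; the particle `(2m, j)` to the right at rate `q_m⁻¹` and to the left at rate `q_m`. -/
noncomputable def rate (q : ℕ → ℝ) (c : Clock k) : ℝ :=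
  match c.2 with
  | Dir.left =>
    if Odd c.1.1.1 then (q ((c.1.1.1 + 1) / 2))⁻¹ else q ((c.1.1.1 + 1) / 2)
  | Dir.right =>
    if Odd c.1.1.1 then q ((c.1.1.1 + 1) / 2) else (q ((c.1.1.1 + 1) / 2))⁻¹

/-- The pattern with all particles at `0`. -/
def GT.zero (k : ℕ) : GT k where
  entry := fun _ _ => 0
  entry_eq_zero := fun _ _ _ => rfl
  entry_le := fun _ _ _ _ => le_rfl
  le_entry := fun _ _ _ _ => le_rfl

instance : MeasurableSpace (GT k) := ⊤

/-- The `n`-th time (from `n = 0`) at which a clock with successive waiting times `w` rings. -/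
noncomputable def ringTime (w : ℕ → ℝ) (n : ℕ) : ℝ :=
  ∑ m ∈ Finset.range (n + 1), w m

/-- A path `y` in `GT_k` follows the rules of the model if it starts with all particles at `0`,
stays constant as long as no clock rings, and `y(t)` is obtained from `y(t-)` by the attempted jump
of the clock that rings at time `t`.  Here `w c` are the successive waiting times of clock `c`. -/
structure FollowsRules (w : Clock k → ℕ → ℝ) (y : ℝ≥0 → GT k) : Prop where
  start : y 0 = GT.zero k
  stay : ∀ s t : ℝ≥0, s ≤ t →
    (∀ c n, ¬ ((s : ℝ) < ringTime (w c) n ∧ ringTime (w c) n ≤ t)) → y t = y s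
  jump : ∀ (t : ℝ≥0) c n, ringTime (w c) n = t → ∀ᶠ u in 𝓝[<] t, y t = (y u).ring c

/-- `Y` is the particle model with a wall with parameters `q`, driven by the waiting times `τ`:
the waiting times are independent and exponentially distributed with the rates of their clocks,
and almost every path of `Y` follows the rules. -/
structure IsWallModel {Ω : Type*} [MeasurableSpace Ω] (μ : Measure Ω) (q : ℕ → ℝ)
    (τ : Clock k → ℕ → Ω → ℝ) (Y : ℝ≥0 → Ω → GT k) : Prop where
  waiting_measurable : ∀ c n, Measurable (τ c n)
  waiting_law : ∀ c n, μ.map (τ c n) = expMeasure (rate q c)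
  waiting_indep : iIndepFun (fun p : Clock k × ℕ => τ p.1 p.2) μ
  measurable : ∀ t, Measurable (Y t)
  follows : ∀ᵐ ω ∂μ, FollowsRules (fun c n => τ c n ω) (fun t => Y t ω)

/-! ### Markov processes on a discrete state space -/

/-- A transition function (Markov semigroup) on a discrete space `E`. -/
structure IsTransitionFunction {E : Type*} (P : ℝ≥0 → E → E → ℝ) : Prop where
  nonneg : ∀ t x y, 0 ≤ P t x y
  sum_one : ∀ t x, HasSum (P t x) 1
  zero_self : ∀ x, P 0 x x = 1
  chapman_kolmogorov : ∀ s t x y, HasSum (fun z => P s x z * P t z y) (P (s + t) x y)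

/-- `Z` is a (time-homogeneous) Markov process on the discrete space `E` with infinitesimal
generator `A`: its finite-dimensional distributions are given by a transition function `P` with
`d/dt P_t(x, y) = A(x, y)` at `t = 0` for all `x, y`. -/
def IsMarkovWithGenerator {Ω E : Type*} [MeasurableSpace Ω] [MeasurableSpace E] (μ : Measure Ω)
    (Z : ℝ≥0 → Ω → E) (A : E → E → ℝ) : Prop :=
  (∀ t, Measurable (Z t)) ∧
  ∃ P : ℝ≥0 → E → E → ℝ, IsTransitionFunction P ∧
    (∀ x y, HasDerivWithinAt (fun t : ℝ => P t.toNNReal x y) (A x y) (Set.Ici 0) 0) ∧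
    ∀ (n : ℕ) (t : Fin (n + 1) → ℝ≥0) (x : Fin (n + 1) → E), Monotone t →
      μ.real {ω | ∀ i, Z (t i) ω = x i} =
        μ.real {ω | Z (t 0) ω = x 0} *
          ∏ i : Fin n, P (t i.succ - t i.castSucc) (x i.castSucc) (x i.succ)

/-- `y = x + e_i` or `y = x - e_i` for some `i`. -/
def IsNeighbour (x y : W k) : Prop :=
  ∃ i, y.1 = x.1 + Pi.single i 1 ∨ x.1 = y.1 + Pi.single i 1

open Classical in
/-- The jump rates of the `k`-th row: `s^k_y(q) / s^k_x(q)` for `y ∈ W_k`, `y = x ± e_i`, and `0`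
for all other `y ≠ x`. -/
noncomputable def jumpRate (q : ℕ → ℝ) (x y : W k) : ℝ :=
  if IsNeighbour x y then schur q y / schur q x else 0

open Classical in
/-- The generator with these jump rates; the diagonal makes its rows sum to `0` (the sum has finitely
many nonzero terms, and `jumpRate q x x = 0`). -/
noncomputable def generator (q : ℕ → ℝ) (x y : W k) : ℝ :=
  if x = y then -∑' z, jumpRate q x z else jumpRate q x y

end WallModel

open scoped ENNReal

namespace WallModel

variable {k : ℕ}

/-! ### Finiteness of the set of clocks -/

/-! The proof is an intertwining argument. Give a pattern with last row `v` the probability `link q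
v x`, proportional to its weight. The claim is that the model, started from this law, keeps it:
`link` composed with the rates `flow` of the model equals the rates `rowFlow` of the last row
composed with `link` (`tsum_link_mul_flow`). Hence, conditionally on the path of the last row, the
pattern always has the law `link`, and the last row is Markov. The only pattern with last row zero
is the zero pattern, so the prescribed start is of this form (`link_zero`).

The algebra is `tsum_wt_mul_flow`, by induction on the number of rows. A move of the first `k` rows
acts on row `k + 1` only through the change of row `k` (`push`), so for a fixed target the last row
can be summed out, leaving the same statement for `k` rows with another test function `φ`. What
remains concerns two interlacing rows: every admissible predecessor of `v` arises either from a push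
or from a jump within the last row, never from both, and the moves that leave the last row unchanged
have a total rate that depends only on `v` (`inflow_succ`). The wall fits in because the left rate
of row `2m - 1` equals the right rate of row `2m`.

Blocked attempts count as jumps from a state to itself. So the total rate is the same constant in
all states, and the semigroups are explicit series in powers of the rate matrix (uniformization).

The probabilistic part needs neither a strong Markov property nor uniqueness of a martingale
problem. For a subdivision of time, the event that in each interval a prescribed clock rings once,
or no clock rings, has an explicit probability (`measure_ringEvent`). Summing over the prescriptions
bounds the finite-dimensional distributions of the model from below
(`IsWallModel.prod_shortStep_le`); refining the subdivision turns this into a lower bound by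
products of the semigroup, and the intertwining into one for the last row. Both sides of that bound
have the same total mass, so equality holds (`measure_eq_prod_of_le`). -/

instance : Finite (Label k) := by
  refine Finite.of_injective (β := Fin (k + 1) × Fin (k + 1))
    (fun p => (⟨p.1.1, by have := p.2.2.1; omega⟩,
      ⟨p.1.2, by have := p.2.2.1; have := p.2.2.2.2; have := p.2.1; omega⟩)) ?_
  intro p p' h
  simp only [Prod.mk.injEq, Fin.mk.injEq] at h
  exact Subtype.ext (Prod.ext h.1 h.2)

noncomputable instance : Fintype (Label k) := Fintype.ofFinite _

instance : Fintype Dir where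
  elems := ⟨[Dir.left, Dir.right], by simp⟩
  complete := by rintro (_ | _) <;> simp

theorem sum_dir {M : Type*} [AddCommMonoid M] (f : Dir → M) :
    ∑ d, f d = f Dir.left + f Dir.right := by
  change (Multiset.map f [Dir.left, Dir.right]).sum = _
  simp

/-! ### Removing and adding the last row of a pattern -/

/-- The rate of the right jumps of the particles in row `i`; the left jumps have the inverse rate. -/
noncomputable def rightRate (q : ℕ → ℝ) (i : ℕ) : ℝ :=
  if Odd i then q ((i + 1) / 2) else (q ((i + 1) / 2))⁻¹

theorem rate_left (q : ℕ → ℝ) (p : Label k) : rate q (p, Dir.left) = (rightRate q p.1.1)⁻¹ := by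
  unfold rate rightRate
  split_ifs <;> simp

theorem rate_right (q : ℕ → ℝ) (p : Label k) : rate q (p, Dir.right) = rightRate q p.1.1 := rfl

/-- The label `p`, seen in a model with one more row. -/
def Label.lift (p : Label k) : Label (k + 1) :=
  ⟨p.1, p.2.1, p.2.2.1.trans (Nat.le_succ k), p.2.2.2⟩

/-- The label of the `j`-th particle of the last row. -/
def Label.last (j : {j // j ∈ Finset.Icc 1 ((k + 2) / 2)}) : Label (k + 1) :=
  ⟨(k + 1, j.1), by omega, le_rfl, (Finset.mem_Icc.1 j.2).1, (Finset.mem_Icc.1 j.2).2⟩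

theorem sum_label_succ {M : Type*} [AddCommMonoid M] (f : Label (k + 1) → M) :
    ∑ p, f p = ∑ p : Label k, f p.lift +
      ∑ j : {j // j ∈ Finset.Icc 1 ((k + 2) / 2)}, f (Label.last j) := by
  have hb : Function.Bijective (Sum.elim (Label.lift (k := k)) Label.last) := by
    constructor
    · rintro (p | p) (p' | p') h
      · exact congrArg _ (Subtype.ext (congrArg (fun u : Label (k + 1) => u.1) h))
      · have h1 : p.1.1 = k + 1 := congrArg (fun u : Label (k + 1) => u.1.1) h
        have := p.2.2.1
        omega
      · have h1 : k + 1 = p'.1.1 := congrArg (fun u : Label (k + 1) => u.1.1) h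
        have := p'.2.2.1
        omega
      · exact congrArg _ (Subtype.ext (congrArg (fun u : Label (k + 1) => u.1.2) h))
    · rintro ⟨⟨i, j⟩, h1, h2, h3, h4⟩
      simp only at h1 h2 h3 h4
      by_cases h : i ≤ k
      · exact ⟨Sum.inl ⟨(i, j), h1, h, h3, h4⟩, rfl⟩
      · obtain rfl : i = k + 1 := by omega
        exact ⟨Sum.inr ⟨j, Finset.mem_Icc.2 ⟨h3, h4⟩⟩, rfl⟩
  rw [← Fintype.sum_equiv (Equiv.ofBijective _ hb) (fun s => f (Sum.elim Label.lift Label.last s)) f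
    (fun _ => rfl), Fintype.sum_sum_type]
  rfl

/-- The last row of a pattern, as a function on `ℕ`. -/
def GT.row (x : GT k) : ℕ → ℕ := x.entry k

/-- The pattern without its last row. -/
def GT.restrict (x : GT (k + 1)) : GT k where
  entry := fun i j => if i ≤ k then x.entry i j else 0
  entry_eq_zero := by
    intro i j h
    split_ifs with hi
    · exact x.entry_eq_zero i j fun hl => h ⟨hl.1, hi, hl.2.2⟩
    · rfl
  entry_le := by
    intro i j h1 h2
    rw [if_pos h1.2.1, if_pos h2.2.1]
    exact x.entry_le i j ⟨h1.1, by have := h1.2.1; omega, h1.2.2⟩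
      ⟨h2.1, by have := h2.2.1; omega, h2.2.2⟩
  le_entry := by
    intro i j h1 h2
    rw [if_pos h1.2.1, if_pos h2.2.1]
    exact x.le_entry i j ⟨h1.1, by have := h1.2.1; omega, h1.2.2⟩
      ⟨h2.1, by have := h2.2.1; omega, h2.2.2⟩

theorem GT.restrict_entry (x : GT (k + 1)) {i : ℕ} (hi : i ≤ k) (j : ℕ) :
    x.restrict.entry i j = x.entry i j := if_pos hi

theorem GT.restrict_row (x : GT (k + 1)) : x.restrict.row = x.entry k :=
  funext fun j => x.restrict_entry le_rfl j

theorem GT.ext_restrict {x y : GT (k + 1)} (h : x.restrict = y.restrict) (h' : x.row = y.row) :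
    x = y := by
  ext i j
  by_cases hi : i ≤ k
  · rw [← x.restrict_entry hi, h, y.restrict_entry hi]
  · by_cases hi' : i = k + 1
    · subst hi'
      exact congrFun h' j
    · rw [x.entry_eq_zero i j fun hl => by have := hl.2.1; omega,
        y.entry_eq_zero i j fun hl => by have := hl.2.1; omega]

/-- `v` can be the row `k + 1` of a pattern whose row `k` is `u`. -/
def Interlaces (k : ℕ) (u v : ℕ → ℕ) : Prop :=
  (∀ j, ¬(1 ≤ j ∧ j ≤ (k + 2) / 2) → v j = 0) ∧
    ∀ j, 1 ≤ j → j ≤ (k + 1) / 2 → u j ≤ v j ∧ v (j + 1) ≤ u j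

/-- `u` is supported on the indices of row `k`. -/
def IsRow (k : ℕ) (u : ℕ → ℕ) : Prop :=
  ∀ j, ¬(1 ≤ j ∧ j ≤ (k + 1) / 2) → u j = 0

theorem GT.isRow (x : GT k) : IsRow k x.row :=
  fun j h => x.entry_eq_zero k j fun hl => h hl.2.2

theorem GT.interlaces (x : GT (k + 1)) : Interlaces k x.restrict.row x.row := by
  refine ⟨x.isRow, fun j h1 h2 => ?_⟩
  have hl : IsLabel (k + 1) k j := ⟨by omega, by omega, h1, h2⟩
  rw [x.restrict_row]
  refine ⟨x.entry_le k j hl ⟨by omega, by omega, h1, by omega⟩, ?_⟩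
  by_cases h : IsLabel (k + 1) (k + 1) (j + 1)
  · exact x.le_entry k j hl h
  · exact (x.entry_eq_zero _ _ h).trans_le (Nat.zero_le _)

/-- The pattern with one more row. -/
def GT.extend (x : GT k) (v : ℕ → ℕ) (h : Interlaces k x.row v) : GT (k + 1) where
  entry := fun i j => if i = k + 1 then v j else x.entry i j
  entry_eq_zero := by
    intro i j hl
    split_ifs with hi
    · exact h.1 j fun hj => hl ⟨by omega, hi.le, hj.1, by rw [hi]; exact hj.2⟩
    · exact x.entry_eq_zero i j fun hl' => hl ⟨hl'.1, by have := hl'.2.1; omega, hl'.2.2⟩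
  entry_le := by
    rintro i j ⟨a1, a2, a3, a4⟩ ⟨b1, b2, b3, b4⟩
    rw [if_neg (by omega)]
    split_ifs with hi
    · obtain rfl : i = k := by omega
      exact (h.2 j a3 a4).1
    · exact x.entry_le i j ⟨a1, by omega, a3, a4⟩ ⟨b1, by omega, b3, b4⟩
  le_entry := by
    rintro i j ⟨a1, a2, a3, a4⟩ ⟨b1, b2, b3, b4⟩
    rw [if_neg (by omega : i ≠ k + 1)]
    split_ifs with hi
    · obtain rfl : i = k := by omega
      exact (h.2 j a3 a4).2
    · exact x.le_entry i j ⟨a1, by omega, a3, a4⟩ ⟨b1, by omega, b3, b4⟩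

theorem GT.extend_row (x : GT k) (v : ℕ → ℕ) (h : Interlaces k x.row v) :
    (x.extend v h).row = v :=
  funext fun _ => if_pos rfl

theorem GT.extend_restrict (x : GT k) (v : ℕ → ℕ) (h : Interlaces k x.row v) :
    (x.extend v h).restrict = x := by
  ext i j
  by_cases hi : i ≤ k
  · rw [GT.restrict_entry _ hi]
    exact if_neg (by omega)
  · rw [GT.entry_eq_zero _ i j fun hl => hi hl.2.1, x.entry_eq_zero i j fun hl => hi hl.2.1]

open Classical in
/-- Summing over the patterns with `k + 1` rows means summing over the patterns with `k` rows and
the possible last rows. -/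
theorem GT.tsum_succ (F : GT k → (ℕ → ℕ) → ℝ≥0∞) :
    ∑' x : GT (k + 1), F x.restrict x.row =
      ∑' x : GT k, ∑' v : ℕ → ℕ, if Interlaces k x.row v then F x v else 0 := by
  rw [← ENNReal.tsum_prod (f := fun x v => if Interlaces k (GT.row x) v then F x v else 0)]
  have hinj : Function.Injective fun x : GT (k + 1) => (x.restrict, x.row) := fun x y h =>
    GT.ext_restrict (congrArg Prod.fst h) (congrArg Prod.snd h)
  have hsupp : Function.support (fun p : GT k × (ℕ → ℕ) =>
      if Interlaces k p.1.row p.2 then F p.1 p.2 else 0) ⊆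
      Set.range fun x : GT (k + 1) => (x.restrict, x.row) := by
    rintro ⟨x, v⟩ hp
    by_cases h : Interlaces k x.row v
    · exact ⟨x.extend v h, Prod.ext (x.extend_restrict v h) (x.extend_row v h)⟩
    · simp [h] at hp
  rw [← hinj.tsum_eq hsupp]
  exact tsum_congr fun x => (if_pos x.interlaces).symm

/-! ### The jumps and the last row -/

/-- The last row after a move of the other rows by which row `k` changes from `u` to `v`. -/
def push (u v w : ℕ → ℕ) : ℕ → ℕ := fun n =>
  if u n < v n ∧ w n = u n then w n + 1
  else if v (n - 1) < u (n - 1) ∧ w n = u (n - 1) then w n - 1 else w n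

/-- Increasing the `j`-th entry. -/
def up (u : ℕ → ℕ) (j : ℕ) : ℕ → ℕ := fun n => if n = j then u n + 1 else u n

/-- Decreasing the `j`-th entry. -/
def down (u : ℕ → ℕ) (j : ℕ) : ℕ → ℕ := fun n => if n = j then u n - 1 else u n

open Classical in
theorem GT.tryRight_entry (x : GT k) (p : Label k) {i j : ℕ} (hi : p.1.1 = i) (hj : p.1.2 = j)
    (m n : ℕ) : (x.tryRight p).entry m n =
      if ¬ (2 ≤ j ∧ x.entry i j = x.entry (i - 1) (j - 1)) ∧
        IsLabel k m n ∧ i ≤ m ∧ n = j ∧ x.entry m n = x.entry i j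
      then x.entry m n + 1 else x.entry m n := by
  subst hi hj
  rfl

open Classical in
theorem GT.tryLeft_entry (x : GT k) (p : Label k) {i j : ℕ} (hi : p.1.1 = i) (hj : p.1.2 = j)
    (m n : ℕ) : (x.tryLeft p).entry m n =
      if x.entry i j ≠ x.entry (i - 1) j ∧
        IsLabel k m n ∧ (∃ l, m = i + l ∧ n = j + l) ∧ x.entry m n = x.entry i j
      then x.entry m n - 1 else x.entry m n := by
  subst hi hj
  rfl

theorem GT.restrict_tryRight_lift (x : GT (k + 1)) (p : Label k) :
    (x.tryRight p.lift).restrict = x.restrict.tryRight p := by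
  obtain ⟨⟨i, j⟩, hp⟩ := p
  have h1 : 1 ≤ i := hp.1
  have h2 : i ≤ k := hp.2.1
  have h3 : 1 ≤ j := hp.2.2.1
  have h4 : j ≤ (i + 1) / 2 := hp.2.2.2
  ext m n
  by_cases hm : m ≤ k
  · rw [GT.restrict_entry _ hm]
    rw [x.tryRight_entry _ (i := i) (j := j) rfl rfl, GT.tryRight_entry _ _ (i := i) (j := j) rfl rfl]
    simp only [GT.restrict_entry x hm]
    congr 1
    simp only [GT.restrict_entry x hm, GT.restrict_entry x h2,
      GT.restrict_entry x ((Nat.sub_le i 1).trans h2), IsLabel, eq_iff_iff]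
    grind
  · rw [GT.entry_eq_zero _ _ _ (fun hl => hm hl.2.1), GT.entry_eq_zero _ _ _ (fun hl => hm hl.2.1)]

theorem GT.restrict_tryLeft_lift (x : GT (k + 1)) (p : Label k) :
    (x.tryLeft p.lift).restrict = x.restrict.tryLeft p := by
  obtain ⟨⟨i, j⟩, hp⟩ := p
  have h1 : 1 ≤ i := hp.1
  have h2 : i ≤ k := hp.2.1
  have h3 : 1 ≤ j := hp.2.2.1
  have h4 : j ≤ (i + 1) / 2 := hp.2.2.2
  ext m n
  by_cases hm : m ≤ k
  · rw [GT.restrict_entry _ hm]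
    rw [x.tryLeft_entry _ (i := i) (j := j) rfl rfl, GT.tryLeft_entry _ _ (i := i) (j := j) rfl rfl]
    simp only [GT.restrict_entry x hm]
    congr 1
    simp only [GT.restrict_entry x hm, GT.restrict_entry x h2,
      GT.restrict_entry x ((Nat.sub_le i 1).trans h2), IsLabel, eq_iff_iff]
    grind
  · rw [GT.entry_eq_zero _ _ _ (fun hl => hm hl.2.1), GT.entry_eq_zero _ _ _ (fun hl => hm hl.2.1)]

/-- A chain of pushed particles in column `j` reaches row `k + 1` only through row `k`. Monotonicity
along the column shows that `x^{k+1}_j = x^k_j` together with a move of `(k, j)` is the same as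
membership in the chain. So the last row sees the lower rows only through the change of row `k`,
which is what makes induction on `k` possible. -/
theorem GT.row_tryRight_lift (x : GT (k + 1)) (p : Label k) :
    (x.tryRight p.lift).row = push x.restrict.row (x.restrict.tryRight p).row x.row := by
  rw [← GT.restrict_tryRight_lift, GT.restrict_row, GT.restrict_row]
  obtain ⟨⟨i, j⟩, hp⟩ := p
  have h1 : 1 ≤ i := hp.1
  have h2 : i ≤ k := hp.2.1
  have h3 : 1 ≤ j := hp.2.2.1
  have h4 : j ≤ (i + 1) / 2 := hp.2.2.2
  funext n
  simp only [GT.row, push, x.tryRight_entry (Label.lift ⟨(i, j), hp⟩) (i := i) (j := j) rfl rfl]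
  by_cases hn : n = j
  · subst hn
    have hl : IsLabel (k + 1) i n := ⟨h1, by omega, h3, h4⟩
    have hl1 : IsLabel (k + 1) k n := ⟨by omega, by omega, h3, by omega⟩
    have hl2 : IsLabel (k + 1) (k + 1) n := ⟨by omega, by omega, h3, by omega⟩
    have e1 := x.entry_le_col hl h2 (by omega)
    have e2 := x.entry_le k n hl1 hl2
    have e3 : n - 1 ≠ n := by omega
    simp only [hl1, hl2, e3, true_and, false_and, and_false, if_false, lt_irrefl]
    split_ifs <;> omega
  · simp only [hn, false_and, and_false, if_false, lt_irrefl]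
    rw [if_neg]
    rintro ⟨hlt, -⟩
    split_ifs at hlt <;> omega

theorem GT.row_tryLeft_lift (x : GT (k + 1)) (p : Label k) :
    (x.tryLeft p.lift).row = push x.restrict.row (x.restrict.tryLeft p).row x.row := by
  classical
  rw [← GT.restrict_tryLeft_lift, GT.restrict_row, GT.restrict_row]
  obtain ⟨⟨i, j⟩, hp⟩ := p
  have h1 : 1 ≤ i := hp.1
  have h2 : i ≤ k := hp.2.1
  have h3 : 1 ≤ j := hp.2.2.1
  have h4 : j ≤ (i + 1) / 2 := hp.2.2.2
  obtain ⟨l, rfl⟩ := Nat.exists_eq_add_of_le h2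
  funext n
  simp only [GT.row, push, x.tryLeft_entry (Label.lift ⟨(i, j), hp⟩) (i := i) (j := j) rfl rfl]
  -- An unblocked particle lies strictly above its lower bound, so the truncated subtraction in
  -- `tryLeft` is a genuine decrease.
  have hpos : x.entry i j ≠ x.entry (i - 1) j → 0 < x.entry i j := by
    intro h
    by_contra h0
    apply h
    by_cases hl : IsLabel (i + l + 1) (i - 1) j
    · have := x.entry_le (i - 1) j hl (by
        rw [show i - 1 + 1 = i by omega]; exact ⟨h1, by omega, h3, h4⟩)
      rw [show i - 1 + 1 = i by omega] at this
      omega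
    · rw [x.entry_eq_zero _ _ hl]; omega
  by_cases hn : n = j + l + 1
  · subst hn
    have hl : IsLabel (i + l + 1) i j := ⟨h1, by omega, h3, h4⟩
    have g1 : ∃ l', i + l + 1 = i + l' ∧ j + l + 1 = j + l' := ⟨l + 1, by omega, by omega⟩
    have g2 : ∃ l', i + l = i + l' ∧ j + l = j + l' := ⟨l, rfl, rfl⟩
    have g3 : ¬ ∃ l', i + l = i + l' ∧ j + l + 1 = j + l' := by rintro ⟨l', _, _⟩; omega
    rw [Nat.add_sub_cancel]
    simp only [g1, g2, g3, true_and, false_and, and_false, if_false, lt_irrefl]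
    by_cases hl1 : IsLabel (i + l + 1) (i + l) (j + l)
    · have e1 := x.le_entry_diag hl l hl1
      by_cases hl2 : IsLabel (i + l + 1) (i + l + 1) (j + l + 1)
      · have e2 := x.le_entry _ _ hl1 hl2
        simp only [hl1, hl2, true_and]
        split_ifs <;> omega
      · have e2 := x.entry_eq_zero _ _ hl2
        simp only [hl2, false_and, and_false, if_false]
        split_ifs <;> omega
    · have hl2 : ¬ IsLabel (i + l + 1) (i + l + 1) (j + l + 1) := fun h => hl1
        ⟨by omega, by omega, by omega, by have := h.2.2.2; omega⟩
      simp only [hl1, hl2, false_and, and_false, if_false, lt_irrefl]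
  · have g1 : ¬ ∃ l', i + l + 1 = i + l' ∧ n = j + l' := by rintro ⟨l', _, _⟩; omega
    have g2 : ¬ ((∃ l', i + l = i + l' ∧ n - 1 = j + l') ∧ 1 ≤ n) := by
      rintro ⟨⟨l', _, _⟩, _⟩; omega
    rw [if_neg (fun h => g1 h.2.2.1)]
    -- At `n = 0` the index `n - 1` in `push` is again `0`; all entries with index `0` vanish, so
    -- nothing happens there.
    rcases Nat.eq_zero_or_pos n with rfl | hn0
    · have z : ∀ m, x.entry m 0 = 0 := fun m => x.entry_eq_zero _ _ fun hl => by
        have := hl.2.2.1; omega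
      have z1 := z (i + l)
      have z2 := z (i + l + 1)
      split_ifs <;> omega
    · have g3 : ¬ ∃ l', i + l = i + l' ∧ n - 1 = j + l' := fun h => g2 ⟨h, hn0⟩
      simp only [g3, false_and, and_false, if_false, lt_irrefl]
      rw [if_neg]
      rintro ⟨hlt, -⟩
      split_ifs at hlt <;> omega

theorem GT.restrict_tryRight_last (x : GT (k + 1)) (j : {j // j ∈ Finset.Icc 1 ((k + 2) / 2)}) :
    (x.tryRight (Label.last j)).restrict = x.restrict := by
  ext m n
  by_cases hm : m ≤ k
  · rw [GT.restrict_entry _ hm, GT.restrict_entry _ hm]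
    exact if_neg fun h => by have : k + 1 ≤ m := h.2.2.1; omega
  · rw [GT.entry_eq_zero _ _ _ (fun hl => hm hl.2.1), GT.entry_eq_zero _ _ _ (fun hl => hm hl.2.1)]

theorem GT.restrict_tryLeft_last (x : GT (k + 1)) (j : {j // j ∈ Finset.Icc 1 ((k + 2) / 2)}) :
    (x.tryLeft (Label.last j)).restrict = x.restrict := by
  ext m n
  by_cases hm : m ≤ k
  · rw [GT.restrict_entry _ hm, GT.restrict_entry _ hm]
    exact if_neg fun h => by
      obtain ⟨l, hl, -⟩ := h.2.2.1
      have : m = k + 1 + l := hl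
      omega
  · rw [GT.entry_eq_zero _ _ _ (fun hl => hm hl.2.1), GT.entry_eq_zero _ _ _ (fun hl => hm hl.2.1)]

open Classical in
theorem GT.row_tryRight_last (x : GT (k + 1)) (j : {j // j ∈ Finset.Icc 1 ((k + 2) / 2)}) :
    (x.tryRight (Label.last j)).row =
      if 2 ≤ j.1 ∧ x.row j.1 = x.restrict.row (j.1 - 1) then x.row else up x.row j.1 := by
  obtain ⟨j, hj⟩ := j
  have hj' := Finset.mem_Icc.1 hj
  have hl : IsLabel (k + 1) (k + 1) j := ⟨by omega, le_rfl, hj'.1, hj'.2⟩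
  rw [GT.restrict_row]
  funext n
  simp only [GT.row, x.tryRight_entry (Label.last ⟨j, hj⟩) (i := k + 1) (j := j) rfl rfl,
    Nat.add_sub_cancel]
  by_cases hn : n = j
  · subst hn
    by_cases hb : 2 ≤ n ∧ x.entry (k + 1) n = x.entry k (n - 1) <;> simp [hl, hb, up]
  · by_cases hb : 2 ≤ j ∧ x.entry (k + 1) j = x.entry k (j - 1) <;> simp [hn, hb, up]

open Classical in
theorem GT.row_tryLeft_last (x : GT (k + 1)) (j : {j // j ∈ Finset.Icc 1 ((k + 2) / 2)}) :
    (x.tryLeft (Label.last j)).row =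
      if x.row j.1 = x.restrict.row j.1 then x.row else down x.row j.1 := by
  obtain ⟨j, hj⟩ := j
  have hj' := Finset.mem_Icc.1 hj
  have hl : IsLabel (k + 1) (k + 1) j := ⟨by omega, le_rfl, hj'.1, hj'.2⟩
  rw [GT.restrict_row]
  funext n
  simp only [GT.row, x.tryLeft_entry (Label.last ⟨j, hj⟩) (i := k + 1) (j := j) rfl rfl,
    Nat.add_sub_cancel]
  by_cases hn : n = j
  · subst hn
    by_cases hb : x.entry (k + 1) n = x.entry k n <;> simp [hl, hb, down]
  · have g : ¬ ∃ l, k + 1 = k + 1 + l ∧ n = j + l := by rintro ⟨l, _, _⟩; omega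
    rw [if_neg (fun h => g h.2.2.1)]
    by_cases hb : x.entry (k + 1) j = x.entry k j <;> simp [hn, hb, down]

/-! ### The flow of the weights under the dynamics -/

open Classical in
/-- The rate at which the model jumps from `x` to `y` (including jumps from `x` to itself). -/
noncomputable def flow (q : ℕ → ℝ) (x y : GT k) : ℝ≥0∞ :=
  ∑ c : Clock k, if x.ring c = y then ENNReal.ofReal (rate q c) else 0

/-- The weight of a pattern, as an extended nonnegative real. -/
noncomputable def GT.wt (q : ℕ → ℝ) (x : GT k) : ℝ≥0∞ := ENNReal.ofReal (x.weight q k)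

open Classical in
theorem flow_eq_sum_label (q : ℕ → ℝ) (x y : GT k) :
    flow q x y = ∑ p : Label k,
      ((if x.tryLeft p = y then ENNReal.ofReal (rightRate q p.1.1)⁻¹ else 0) +
        (if x.tryRight p = y then ENNReal.ofReal (rightRate q p.1.1) else 0)) := by
  unfold flow
  rw [Fintype.sum_prod_type]
  refine Finset.sum_congr rfl fun p _ => ?_
  rw [sum_dir, rate_left, rate_right]
  rfl

theorem GT.eq_iff_restrict {x y : GT (k + 1)} :
    x = y ↔ x.restrict = y.restrict ∧ x.row = y.row :=
  ⟨fun h => h ▸ ⟨rfl, rfl⟩, fun h => GT.ext_restrict h.1 h.2⟩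

open Classical in
-- A clock of the first `k` rows acts on them as in the smaller model, and the response of the last
-- row is forced by `push`. A clock of the last row leaves the other rows alone.
theorem flow_succ (q : ℕ → ℝ) (x y : GT (k + 1)) :
    flow q x y =
      (if push x.restrict.row y.restrict.row x.row = y.row then
        flow q x.restrict y.restrict else 0) +
      if x.restrict = y.restrict then ∑ j ∈ Finset.Icc 1 ((k + 2) / 2),
        ((if (if x.row j = x.restrict.row j then x.row else down x.row j) = y.row then
            ENNReal.ofReal (rightRate q (k + 1))⁻¹ else 0) +
          (if (if 2 ≤ j ∧ x.row j = x.restrict.row (j - 1) then x.row else up x.row j) = y.row then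
            ENNReal.ofReal (rightRate q (k + 1)) else 0)) else 0 := by
  rw [flow_eq_sum_label, sum_label_succ]
  congr 1
  · rw [flow_eq_sum_label]
    split_ifs with h
    · refine Finset.sum_congr rfl fun p _ => ?_
      simp only [GT.eq_iff_restrict, GT.restrict_tryLeft_lift, GT.restrict_tryRight_lift,
        GT.row_tryLeft_lift, GT.row_tryRight_lift]
      have e1 : x.restrict.tryLeft p = y.restrict ∧
          push x.restrict.row (x.restrict.tryLeft p).row x.row = y.row ↔
          x.restrict.tryLeft p = y.restrict := ⟨fun h' => h'.1, fun h' => ⟨h', by rw [h', h]⟩⟩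
      have e2 : x.restrict.tryRight p = y.restrict ∧
          push x.restrict.row (x.restrict.tryRight p).row x.row = y.row ↔
          x.restrict.tryRight p = y.restrict := ⟨fun h' => h'.1, fun h' => ⟨h', by rw [h', h]⟩⟩
      simp only [e1, e2]
      rfl
    · refine Finset.sum_eq_zero fun p _ => ?_
      rw [if_neg, if_neg, add_zero]
      · rintro rfl
        rw [GT.restrict_tryRight_lift, GT.row_tryRight_lift] at h
        exact h rfl
      · rintro rfl
        rw [GT.restrict_tryLeft_lift, GT.row_tryLeft_lift] at h
        exact h rfl
  · rw [← Finset.sum_coe_sort (Finset.Icc 1 ((k + 2) / 2))]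
    split_ifs with h
    · refine Finset.sum_congr rfl fun j _ => ?_
      simp only [GT.eq_iff_restrict, GT.restrict_tryLeft_last, GT.restrict_tryRight_last,
        GT.row_tryLeft_last, GT.row_tryRight_last, h, true_and]
      rfl
    · refine Finset.sum_eq_zero fun j _ => ?_
      rw [if_neg, if_neg, add_zero]
      · rintro rfl
        rw [GT.restrict_tryRight_last] at h
        exact h rfl
      · rintro rfl
        rw [GT.restrict_tryLeft_last] at h
        exact h rfl

/-- The sum of the entries of a row `k`. -/
def size (k : ℕ) (u : ℕ → ℕ) : ℤ := ∑ j ∈ Finset.Icc 1 ((k + 1) / 2), (u j : ℤ)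

theorem size_up {u : ℕ → ℕ} {j : ℕ} (h : j ∈ Finset.Icc 1 ((k + 1) / 2)) :
    size k (up u j) = size k u + 1 := by
  unfold size
  rw [← Finset.add_sum_erase _ _ h, ← Finset.add_sum_erase _ (fun n => (u n : ℤ)) h]
  rw [Finset.sum_congr rfl (g := fun n => (u n : ℤ))]
  · simp [up]; ring
  · intro n hn
    simp [up, (Finset.mem_erase.1 hn).1]

theorem size_down {u : ℕ → ℕ} {j : ℕ} (h : j ∈ Finset.Icc 1 ((k + 1) / 2)) (hu : 0 < u j) :
    size k (down u j) = size k u - 1 := by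
  have : up (down u j) j = u := by
    funext n
    by_cases hn : n = j
    · subst hn; simp [up, down]; omega
    · simp [up, down, hn]
  rw [eq_sub_iff_add_eq, ← size_up h, this]

theorem rightRate_pos {q : ℕ → ℝ} (hq : ∀ i, 1 ≤ i → i ≤ (k + 1) / 2 → 0 < q i) {i : ℕ}
    (h1 : 1 ≤ i) (h2 : i ≤ k) : 0 < rightRate q i := by
  have := hq ((i + 1) / 2) (by omega) (by omega)
  unfold rightRate
  split_ifs
  · exact this
  · exact inv_pos.2 this

theorem GT.weight_succ (q : ℕ → ℝ) (x : GT k) (n : ℕ) :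
    x.weight q (n + 1) = x.weight q n *
      rightRate q (n + 1) ^ (size (n + 1) (x.entry (n + 1)) - size n (x.entry n)) := by
  rw [GT.weight, rightRate]
  congr 1
  have e1 : x.rowSum (n + 1) = size (n + 1) (x.entry (n + 1)) := rfl
  have e2 : x.rowSum n = size n (x.entry n) := rfl
  rw [e1, e2]
  split_ifs
  · rfl
  · rw [inv_zpow, ← zpow_neg, neg_sub]

theorem GT.weight_pos {q : ℕ → ℝ} (hq : ∀ i, 1 ≤ i → i ≤ (k + 1) / 2 → 0 < q i) (x : GT k) {n : ℕ}
    (hn : n ≤ k) : 0 < x.weight q n := by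
  induction n with
  | zero => exact one_pos
  | succ n ih =>
    rw [GT.weight_succ]
    exact mul_pos (ih (by omega)) (zpow_pos (rightRate_pos hq (by omega) hn) _)

theorem GT.weight_restrict (q : ℕ → ℝ) (x : GT (k + 1)) {n : ℕ} (hn : n ≤ k) :
    x.restrict.weight q n = x.weight q n := by
  induction n with
  | zero => rfl
  | succ n ih =>
    have e : ∀ i, i ≤ k → x.restrict.entry i = x.entry i :=
      fun i hi => funext fun j => x.restrict_entry hi j
    rw [GT.weight_succ, GT.weight_succ, ih (by omega), e n (by omega), e (n + 1) hn]

theorem GT.wt_succ {q : ℕ → ℝ} (hq : ∀ i, 1 ≤ i → i ≤ (k + 1 + 1) / 2 → 0 < q i) (x : GT (k + 1)) :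
    x.wt q = x.restrict.wt q *
      ENNReal.ofReal (rightRate q (k + 1) ^ (size (k + 1) x.row - size k x.restrict.row)) := by
  unfold GT.wt
  rw [GT.weight_restrict q x le_rfl, GT.weight_succ,
    ENNReal.ofReal_mul (GT.weight_pos hq x (Nat.le_succ k)).le, GT.restrict_row]
  rfl

/-- The constant part of the rate of the jumps that do not change row `k`. -/
noncomputable def holdConst (q : ℕ → ℝ) : ℕ → ℝ≥0∞
  | 0 => 0
  | k + 1 => holdConst q k + ((k + 1) / 2 : ℕ) *
      (ENNReal.ofReal (rightRate q (k + 1))⁻¹ + ENNReal.ofReal (rightRate q (k + 1)))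

open Classical in
/-- The rate of the jumps that do not change row `k`. -/
noncomputable def hold (q : ℕ → ℝ) (k : ℕ) (u : ℕ → ℕ) : ℝ≥0∞ :=
  holdConst q k + if Odd k ∧ u ((k + 1) / 2) = 0 then ENNReal.ofReal (rightRate q k)⁻¹ else 0

open Classical in
/-- The sum of `φ` over the rows from which `u` can be reached. -/
noncomputable def inflow (q : ℕ → ℝ) (k : ℕ) (φ : (ℕ → ℕ) → ℝ≥0∞) (u : ℕ → ℕ) : ℝ≥0∞ :=
  φ u * hold q k u + ∑ j ∈ Finset.Icc 1 ((k + 1) / 2),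
    ((if j = 1 ∨ u j < u (j - 1) then φ (up u j) else 0) +
      (if u (j + 1) < u j then φ (down u j) else 0))

/-! ### Two consecutive rows -/

/-- For a fixed target row and a fixed kind of move there are at most two predecessors: the row
itself and one of its neighbours. All four lemmas on predecessors below are stated in the shape
required here. -/
theorem tsum_ite_or {α : Type*} {p : α → Prop} [DecidablePred p] (g : α → ℝ≥0∞) {a b : α}
    {A B : Prop} [Decidable A] [Decidable B]
    (hp : ∀ v, p v ↔ (v = a ∧ A) ∨ (v = b ∧ B)) (hab : B → b ≠ a) :
    ∑' v, (if p v then g v else 0) = (if A then g a else 0) + (if B then g b else 0) := by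
  classical
  have : ∀ v, (if p v then g v else 0) =
      (if v = a then (if A then g a else 0) else 0) +
        (if v = b then (if B then g b else 0) else 0) := by
    intro v
    rw [if_congr (hp v) rfl rfl]
    by_cases h1 : v = a
    · subst h1
      by_cases hB : B
      · have := hab hB
        simp [this.symm]
      · simp [hB]
    · by_cases h2 : v = b
      · subst h2; simp [h1]
      · simp [h1, h2]
  simp_rw [this]
  rw [ENNReal.tsum_add, tsum_ite_eq, tsum_ite_eq]

section TwoRows

variable {u v : ℕ → ℕ}

theorem push_self (u w : ℕ → ℕ) : push u u w = w := by
  funext n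
  simp [push]

theorem up_ne (v : ℕ → ℕ) (j : ℕ) : up v j ≠ v := fun h => by
  have := congrFun h j
  simp [up] at this

theorem down_ne {j : ℕ} (h : 0 < v j) : down v j ≠ v := fun h' => by
  have := congrFun h' j
  simp [down] at this
  omega

/-- The `j`-th particle of row `k` jumps left to `u j`, which can push only the particle `j + 1` of
the next row. Without a push, the old row `v` must interlace with `up u j`, that is, `u j < v j`.
With a push, the pushed particle ends at `u j`. The bound on `j + 1` excludes the particle at the
wall, which pushes nobody. -/
theorem interlaces_up_and_push_iff (huv : Interlaces k u v) {j : ℕ}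
    (hj : j ∈ Finset.Icc 1 ((k + 1) / 2)) (w : ℕ → ℕ) :
    Interlaces k (up u j) w ∧ push (up u j) u w = v ↔
      (w = v ∧ u j < v j) ∨
        (w = up v (j + 1) ∧ v (j + 1) = u j ∧ u j < v j ∧ j + 1 ≤ (k + 2) / 2) := by
  obtain ⟨hj1, hj2⟩ := Finset.mem_Icc.1 hj
  have hpush : ∀ w, push (up u j) u w =
      fun n => if n = j + 1 ∧ w n = u j + 1 then w n - 1 else w n := by
    intro w
    funext n
    have e1 : u n ≤ up u j n := by simp only [up]; split_ifs <;> omega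
    simp only [push, e1.not_gt, false_and, if_false]
    by_cases h2 : n = j + 1
    · subst h2
      simp [up]
    · by_cases h3 : n - 1 = j
      · omega
      · simp [up, h2, h3]
  rw [hpush]
  obtain ⟨h0, h⟩ := huv
  constructor
  · rintro ⟨⟨hw0, hw⟩, rfl⟩
    have hwj := hw j hj1 hj2
    simp only [up, if_true] at hwj
    simp only [Nat.left_eq_add, one_ne_zero, false_and, if_false, true_and]
    by_cases hc : w (j + 1) = u j + 1
    · right
      refine ⟨?_, by simp [hc], by omega, ?_⟩
      · funext n
        by_cases hn : n = j + 1
        · subst hn; simp [up, hc]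
        · simp [up, hn]
      · by_contra hlt
        have := hw0 (j + 1) (by omega)
        omega
    · left
      refine ⟨?_, by omega⟩
      funext n
      by_cases hn : n = j + 1
      · subst hn; simp [hc]
      · simp [hn]
  · rintro (⟨rfl, hlt⟩ | ⟨rfl, heq, hlt, hle⟩)
    · refine ⟨⟨h0, fun i hi1 hi2 => ?_⟩, ?_⟩
      · have := h i hi1 hi2
        simp only [up]
        split_ifs with hij
        · subst hij; omega
        · exact this
      · funext n
        have := (h j hj1 hj2).2
        split_ifs with hc
        · obtain ⟨rfl, hc⟩ := hc; omega
        · rfl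
    · refine ⟨⟨fun i hi => ?_, fun i hi1 hi2 => ?_⟩, ?_⟩
      · have := h0 i hi
        simp only [up]
        split_ifs <;> omega
      · have := h i hi1 hi2
        simp only [up]
        split_ifs with c1 c2 c3
        all_goals first | omega | (subst_vars; omega)
      · funext n
        by_cases hn : n = j + 1
        · subst hn; simp [up, heq]
        · simp [up, hn]

/-- The mirror image: the `j`-th particle of row `k` jumps right to `u j` and can push only the
particle `j` of the next row. Interlacing of the old rows is now the condition `v (j + 1) < u j`,
with or without a push. -/
theorem interlaces_down_and_push_iff (huv : Interlaces k u v) {j : ℕ}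
    (hj : j ∈ Finset.Icc 1 ((k + 1) / 2)) (hpos : 0 < u j) (w : ℕ → ℕ) :
    Interlaces k (down u j) w ∧ push (down u j) u w = v ↔
      (w = v ∧ v (j + 1) < u j) ∨ (w = down v j ∧ v (j + 1) < u j ∧ v j = u j) := by
  obtain ⟨hj1, hj2⟩ := Finset.mem_Icc.1 hj
  have hpush : ∀ w, push (down u j) u w =
      fun n => if n = j ∧ w n = u j - 1 then w n + 1 else w n := by
    intro w
    funext n
    have e1 : down u j (n - 1) ≤ u (n - 1) := by simp only [down]; split_ifs <;> omega
    simp only [push, e1.not_gt, false_and, if_false]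
    by_cases h1 : n = j
    · subst h1
      simp [down, hpos]
    · simp [down, h1]
  rw [hpush]
  obtain ⟨h0, h⟩ := huv
  constructor
  · rintro ⟨⟨hw0, hw⟩, rfl⟩
    have hwj := hw j hj1 hj2
    have hjj : ¬ (j + 1 = j) := by omega
    simp only [down, if_true] at hwj
    simp only [hjj, false_and, if_false, true_and]
    by_cases hc : w j = u j - 1
    · right
      refine ⟨?_, by omega, by simp [hc]; omega⟩
      funext n
      by_cases hn : n = j
      · subst hn; simp [down, hc]
      · simp [down, hn]
    · left
      refine ⟨?_, by omega⟩
      funext n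
      by_cases hn : n = j
      · subst hn; simp [hc]
      · simp [hn]
  · rintro (⟨rfl, hlt⟩ | ⟨rfl, hlt, heq⟩)
    · refine ⟨⟨h0, fun i hi1 hi2 => ?_⟩, ?_⟩
      · have := h i hi1 hi2
        simp only [down]
        split_ifs with hij
        · subst hij; omega
        · exact this
      · funext n
        have := (h j hj1 hj2).1
        split_ifs with hc
        · obtain ⟨rfl, hc⟩ := hc; omega
        · rfl
    · refine ⟨⟨fun i hi => ?_, fun i hi1 hi2 => ?_⟩, ?_⟩
      · have := h0 i hi
        simp only [down]
        split_ifs <;> omega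
      · have := h i hi1 hi2
        simp only [down]
        split_ifs with c1 c2 c3
        all_goals first | omega | (subst_vars; omega)
      · funext n
        by_cases hn : n = j
        · subst hn; simp [down, heq]; omega
        · simp [down, hn]

open Classical in
-- A left attempt within the last row that leads to `v` was either blocked, or came from `up v j`,
-- which interlaces with `u` exactly if there is room below `u (j - 1)`. At the wall `u j` is off
-- the row and hence `0`, so the same formula describes blocking by the wall.
theorem interlaces_and_left_iff (huv : Interlaces k u v) (hu : IsRow k u) {j : ℕ}
    (hj : j ∈ Finset.Icc 1 ((k + 2) / 2)) (w : ℕ → ℕ) :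
    Interlaces k u w ∧ (if w j = u j then w else down w j) = v ↔
      (w = v ∧ v j = u j) ∨ (w = up v j ∧ (j = 1 ∨ v j < u (j - 1))) := by
  obtain ⟨hj1, hj2⟩ := Finset.mem_Icc.1 hj
  have key : ∀ w, Interlaces k u w → u j ≤ w j ∧ (j = 1 ∨ w j ≤ u (j - 1)) := by
    rintro w ⟨hw0, hw⟩
    constructor
    · by_cases hjk : j ≤ (k + 1) / 2
      · exact (hw j hj1 hjk).1
      · rw [hu j (by omega)]; omega
    · by_cases h1 : j = 1
      · exact Or.inl h1
      · have := (hw (j - 1) (by omega) (by omega)).2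
        rw [show j - 1 + 1 = j by omega] at this
        exact Or.inr this
  constructor
  · rintro ⟨hw, hv⟩
    have hk := key w hw
    split_ifs at hv with hc
    · subst hv
      exact Or.inl ⟨rfl, hc⟩
    · right
      have hvj : v j = w j - 1 := by rw [← hv]; simp [down]
      refine ⟨?_, by omega⟩
      funext n
      by_cases hn : n = j
      · subst hn; simp [up, hvj]; omega
      · rw [← hv]; simp [up, down, hn]
  · rintro (⟨rfl, hc⟩ | ⟨rfl, hc⟩)
    · exact ⟨huv, if_pos hc⟩
    · have hk := key v huv
      have hne : ¬ (up v j j = u j) := by simp [up]; omega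
      rw [if_neg hne]
      refine ⟨⟨fun i hi => ?_, fun i hi1 hi2 => ?_⟩, ?_⟩
      · have := huv.1 i hi
        simp only [up]
        split_ifs <;> omega
      · have := huv.2 i hi1 hi2
        simp only [up]
        split_ifs with c1 c2 c3
        · omega
        · omega
        · subst c3
          have : i + 1 - 1 = i := rfl
          rw [this] at hc
          omega
        · omega
      · funext n
        by_cases hn : n = j
        · subst hn; simp [up, down]
        · simp [up, down, hn]

open Classical in
-- A right attempt that leads to `v` was blocked by `u (j - 1)`, or came from `down v j`, which
-- interlaces with `u` exactly if `u j < v j`.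
theorem interlaces_and_right_iff (huv : Interlaces k u v) (hu : IsRow k u) {j : ℕ}
    (hj : j ∈ Finset.Icc 1 ((k + 2) / 2)) (w : ℕ → ℕ) :
    Interlaces k u w ∧ (if 2 ≤ j ∧ w j = u (j - 1) then w else up w j) = v ↔
      (w = v ∧ 2 ≤ j ∧ v j = u (j - 1)) ∨ (w = down v j ∧ u j < v j) := by
  obtain ⟨hj1, hj2⟩ := Finset.mem_Icc.1 hj
  have key : ∀ w, Interlaces k u w → u j ≤ w j ∧ (j = 1 ∨ w j ≤ u (j - 1)) := by
    rintro w ⟨hw0, hw⟩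
    constructor
    · by_cases hjk : j ≤ (k + 1) / 2
      · exact (hw j hj1 hjk).1
      · rw [hu j (by omega)]; omega
    · by_cases h1 : j = 1
      · exact Or.inl h1
      · have := (hw (j - 1) (by omega) (by omega)).2
        rw [show j - 1 + 1 = j by omega] at this
        exact Or.inr this
  constructor
  · rintro ⟨hw, hv⟩
    have hk := key w hw
    split_ifs at hv with hc
    · subst hv
      exact Or.inl ⟨rfl, hc⟩
    · right
      have hvj : v j = w j + 1 := by rw [← hv]; simp [up]
      refine ⟨?_, by omega⟩
      funext n
      by_cases hn : n = j
      · subst hn; simp [down, hvj]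
      · rw [← hv]; simp [up, down, hn]
  · rintro (⟨rfl, hc⟩ | ⟨rfl, hc⟩)
    · exact ⟨huv, if_pos hc⟩
    · have hk := key v huv
      have hne : ¬ (2 ≤ j ∧ down v j j = u (j - 1)) := by simp [down]; omega
      rw [if_neg hne]
      refine ⟨⟨fun i hi => ?_, fun i hi1 hi2 => ?_⟩, ?_⟩
      · have := huv.1 i hi
        simp only [down]
        split_ifs <;> omega
      · have := huv.2 i hi1 hi2
        simp only [down]
        split_ifs with c1 c2 c3
        · omega
        · subst c1; omega
        · omega
        · omega
      · funext n
        by_cases hn : n = j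
        · subst hn; simp [up, down]; omega
        · simp [up, down, hn]

end TwoRows

/-! ### Cancellation of the middle row in sums over two interlacing rows -/

theorem sum_Icc_eq_sum_ite {M : Type*} [AddCommMonoid M] {r s : ℕ} (hrs : r ≤ s) (f : ℕ → M) :
    ∑ j ∈ Finset.Icc 1 r, f j = ∑ j ∈ Finset.Icc 1 s, if j ≤ r then f j else 0 := by
  rw [← Finset.sum_filter]
  refine Finset.sum_congr ?_ fun _ _ => rfl
  ext j
  simp only [Finset.mem_Icc, Finset.mem_filter]
  omega

theorem sum_Icc_shift {M : Type*} [AddCommMonoid M] {r s : ℕ} (hrs : s ≤ r + 1) (f : ℕ → M) :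
    ∑ j ∈ Finset.Icc 1 r, (if j + 1 ≤ s then f (j + 1) else 0) =
      ∑ j ∈ Finset.Icc 1 s, if 2 ≤ j then f j else 0 := by
  rw [← Finset.sum_filter, ← Finset.sum_filter]
  refine Finset.sum_nbij' (· + 1) (· - 1) ?_ ?_ ?_ ?_ ?_
  all_goals
    intro j hj
    simp only [Finset.mem_Icc, Finset.mem_filter] at hj
  · simp only [Finset.mem_Icc, Finset.mem_filter]; omega
  · simp only [Finset.mem_Icc, Finset.mem_filter]; omega
  · simp
  · omega
  · rfl

section TwoRows

variable {u v : ℕ → ℕ}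

theorem Interlaces.lower (huv : Interlaces k u v) (hu : IsRow k u) {j : ℕ} (hj1 : 1 ≤ j) :
    u j ≤ v j := by
  by_cases hj2 : j ≤ (k + 1) / 2
  · exact (huv.2 j hj1 hj2).1
  · rw [hu j (by omega)]; omega

theorem Interlaces.upper (huv : Interlaces k u v) {j : ℕ} (hj1 : 2 ≤ j) :
    v j ≤ u (j - 1) := by
  by_cases hj2 : j ≤ (k + 2) / 2
  · have := (huv.2 (j - 1) (by omega) (by omega)).2
    rwa [show j - 1 + 1 = j by omega] at this
  · rw [huv.1 j (by omega)]; omega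

open Classical in
-- The predecessor `up v j` arises from a jump of the particle itself if `v j < u (j - 1)`, and from
-- a push by its neighbour in row `k` if `v j = u (j - 1) < v (j - 1)`. As `v j ≤ u (j - 1) ≤ v (j -
-- 1)`, exactly one of these occurs when `v j < v (j - 1)` and none otherwise, so `u` disappears.
theorem sum_up_eq (huv : Interlaces k u v) (hu : IsRow k u) (f : ℕ → ℝ≥0∞) :
    ∑ j ∈ Finset.Icc 1 ((k + 1) / 2),
        (if v (j + 1) = u j ∧ u j < v j ∧ j + 1 ≤ (k + 2) / 2 then f (j + 1) else 0) +
      ∑ j ∈ Finset.Icc 1 ((k + 2) / 2), (if j = 1 ∨ v j < u (j - 1) then f j else 0) =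
    ∑ j ∈ Finset.Icc 1 ((k + 2) / 2), (if j = 1 ∨ v j < v (j - 1) then f j else 0) := by
  have h1 : ∀ j, (if v (j + 1) = u j ∧ u j < v j ∧ j + 1 ≤ (k + 2) / 2 then f (j + 1) else 0) =
      if j + 1 ≤ (k + 2) / 2 then
        (fun i => if v i = u (i - 1) ∧ u (i - 1) < v (i - 1) then f i else 0) (j + 1) else 0 := by
    intro j
    simp only [Nat.add_sub_cancel]
    split_ifs <;> first | rfl | omega
  rw [Finset.sum_congr rfl fun j _ => h1 j, sum_Icc_shift (r := (k + 1) / 2) (s := (k + 2) / 2)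
    (by omega) (fun i => if v i = u (i - 1) ∧ u (i - 1) < v (i - 1) then f i else 0),
    ← Finset.sum_add_distrib]
  refine Finset.sum_congr rfl fun j hj => ?_
  obtain ⟨hj1, hj2⟩ := Finset.mem_Icc.1 hj
  by_cases hj3 : j = 1
  · subst hj3; simp
  · have hj4 : 2 ≤ j := by omega
    have e1 := huv.upper hj4
    have e2 := huv.lower hu (j := j - 1) (by omega)
    simp only [hj3, hj4, if_true, false_or]
    split_ifs <;> first | omega | simp

open Classical in
-- Since `v (j + 1) ≤ u j ≤ v j`, the condition `v (j + 1) < v j` splits into `u j < v j` (own jump)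
-- and `v (j + 1) < u j = v j` (push).
theorem sum_down_eq (huv : Interlaces k u v) (hu : IsRow k u) (f : ℕ → ℝ≥0∞) :
    ∑ j ∈ Finset.Icc 1 ((k + 1) / 2), (if v (j + 1) < u j ∧ v j = u j then f j else 0) +
      ∑ j ∈ Finset.Icc 1 ((k + 2) / 2), (if u j < v j then f j else 0) =
    ∑ j ∈ Finset.Icc 1 ((k + 2) / 2), (if v (j + 1) < v j then f j else 0) := by
  rw [sum_Icc_eq_sum_ite (show (k + 1) / 2 ≤ (k + 2) / 2 by omega), ← Finset.sum_add_distrib]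
  refine Finset.sum_congr rfl fun j hj => ?_
  obtain ⟨hj1, hj2⟩ := Finset.mem_Icc.1 hj
  have e1 := huv.upper (j := j + 1) (by omega)
  have e2 := huv.lower hu hj1
  have e3 : ¬ j ≤ (k + 1) / 2 → u j = 0 := fun h => hu j (by omega)
  rw [Nat.add_sub_cancel] at e1
  split_ifs <;> first | omega | simp

open Classical in
-- Each `j` present in both rows contributes exactly once: `u j < v j` for a left jump in row `k`
-- without a push, `v j = u j` for a blocked attempt in the last row. If `k + 1` is odd, one
-- particle of the last row remains, blocked exactly when it is at the wall.
theorem sum_hold_left (huv : Interlaces k u v) (hu : IsRow k u) (b : ℝ≥0∞) :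
    ∑ j ∈ Finset.Icc 1 ((k + 1) / 2), (if u j < v j then b else 0) +
      ∑ j ∈ Finset.Icc 1 ((k + 2) / 2), (if v j = u j then b else 0) =
    ((k + 1) / 2 : ℕ) * b + if Odd (k + 1) ∧ v ((k + 2) / 2) = 0 then b else 0 := by
  rw [sum_Icc_eq_sum_ite (show (k + 1) / 2 ≤ (k + 2) / 2 by omega), ← Finset.sum_add_distrib]
  have : ∀ j ∈ Finset.Icc 1 ((k + 2) / 2), ((if j ≤ (k + 1) / 2 then if u j < v j then b else 0
      else 0) + if v j = u j then b else 0) =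
      (if j ≤ (k + 1) / 2 then b else 0) +
        if j = (k + 2) / 2 then
          (if Odd (k + 1) ∧ v ((k + 2) / 2) = 0 then b else 0) else 0 := by
    intro j hj
    obtain ⟨hj1, hj2⟩ := Finset.mem_Icc.1 hj
    have e2 := huv.lower hu hj1
    have e3 : ¬ j ≤ (k + 1) / 2 → u j = 0 := fun h => hu j (by omega)
    simp only [Nat.odd_iff]
    by_cases hc : j ≤ (k + 1) / 2
    · have h4 : ¬ ((k + 1) % 2 = 1 ∧ j = (k + 2) / 2) := by omega
      rcases e2.lt_or_eq with h | h
      · have h' : ¬ v j = u j := by omega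
        simp only [hc, h, h', if_true, if_false]
        split_ifs <;> first | omega | simp
      · have h' : ¬ u j < v j := by omega
        simp only [hc, h.symm, if_true, lt_irrefl, if_false]
        split_ifs <;> first | omega | simp
    · obtain rfl : j = (k + 2) / 2 := by omega
      have h5 : (k + 1) % 2 = 1 := by omega
      simp only [hc, e3 hc, h5, if_true, if_false, true_and, zero_add]
  rw [Finset.sum_congr rfl this, Finset.sum_add_distrib,
    ← sum_Icc_eq_sum_ite (show (k + 1) / 2 ≤ (k + 2) / 2 by omega), Finset.sum_ite_eq']
  simp only [Finset.sum_const, Nat.card_Icc, Nat.add_sub_cancel, nsmul_eq_mul]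
  rw [if_pos (Finset.mem_Icc.2 ⟨by omega, le_rfl⟩)]

open Classical in
-- Each pair `u j`, `v (j + 1)` contributes once, by `<` (right jump in row `k` without a push) or
-- by `=` (blocked attempt). For odd `k` the last `u j` has no partner and contributes only when
-- positive; the wall term of row `k` supplies the case `u j = 0`.
theorem sum_hold_right (huv : Interlaces k u v) (b : ℝ≥0∞) :
    (if Odd k ∧ u ((k + 1) / 2) = 0 then b else 0) +
    (∑ j ∈ Finset.Icc 1 ((k + 1) / 2), (if v (j + 1) < u j then b else 0) +
      ∑ j ∈ Finset.Icc 1 ((k + 2) / 2), (if 2 ≤ j ∧ v j = u (j - 1) then b else 0)) =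
    ((k + 1) / 2 : ℕ) * b := by
  have h1 : ∑ j ∈ Finset.Icc 1 ((k + 2) / 2), (if 2 ≤ j ∧ v j = u (j - 1) then b else 0) =
      ∑ j ∈ Finset.Icc 1 ((k + 1) / 2),
        if j + 1 ≤ (k + 2) / 2 then (if v (j + 1) = u j then b else 0) else 0 := by
    simp_rw [ite_and]
    rw [← sum_Icc_shift (r := (k + 1) / 2) (by omega)]
    simp only [Nat.add_sub_cancel]
  rw [h1, ← Finset.sum_add_distrib]
  have h2 : ∀ j ∈ Finset.Icc 1 ((k + 1) / 2), ((if v (j + 1) < u j then b else 0) +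
      if j + 1 ≤ (k + 2) / 2 then (if v (j + 1) = u j then b else 0) else 0) =
      if j = (k + 1) / 2 then (if Odd k ∧ u ((k + 1) / 2) = 0 then 0 else b) else b := by
    intro j hj
    obtain ⟨hj1, hj2⟩ := Finset.mem_Icc.1 hj
    have e1 := huv.upper (j := j + 1) (by omega)
    rw [Nat.add_sub_cancel] at e1
    have e3 : ¬ j + 1 ≤ (k + 2) / 2 → v (j + 1) = 0 := fun h => huv.1 _ (by omega)
    simp only [Nat.odd_iff]
    by_cases hc : j = (k + 1) / 2
    · subst hc
      split_ifs <;> first | omega | simp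
    · split_ifs <;> first | omega | simp
  rw [Finset.sum_congr rfl h2]
  rcases Nat.eq_zero_or_pos k with rfl | hk
  · simp
  · have hmem : (k + 1) / 2 ∈ Finset.Icc 1 ((k + 1) / 2) := Finset.mem_Icc.2 ⟨by omega, le_rfl⟩
    have h3 : ∑ j ∈ Finset.Icc 1 ((k + 1) / 2), b = ((k + 1) / 2 : ℕ) * b := by simp
    rw [← h3, ← Finset.add_sum_erase _ _ hmem, ← Finset.add_sum_erase _ (fun _ => b) hmem,
      ← add_assoc]
    congr 1
    · rw [if_pos rfl]; split_ifs <;> simp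
    · exact Finset.sum_congr rfl fun j hj => if_neg (Finset.mem_erase.1 hj).1

open Classical in
-- The four counting identities combine. The total contribution of moves of row `k` and of the last
-- row no longer involves `u`, and the neighbours of `v` enter with coefficient `1`: the jump rates
-- have been absorbed by the weights.
theorem inflow_succ {q : ℕ → ℝ} (huv : Interlaces k u v) (hu : IsRow k u)
    (φ : (ℕ → ℕ) → ℝ≥0∞) {b b' : ℝ≥0∞} (hb : b = ENNReal.ofReal (rightRate q (k + 1)))
    (hb' : b' = ENNReal.ofReal (rightRate q (k + 1))⁻¹) :
    φ v * hold q k u +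
      ∑ j ∈ Finset.Icc 1 ((k + 1) / 2),
        (((if u j < v j then φ v * b' else 0) +
          (if v (j + 1) = u j ∧ u j < v j ∧ j + 1 ≤ (k + 2) / 2 then φ (up v (j + 1)) else 0)) +
        ((if v (j + 1) < u j then φ v * b else 0) +
          (if v (j + 1) < u j ∧ v j = u j then φ (down v j) else 0))) +
      ∑ j ∈ Finset.Icc 1 ((k + 2) / 2),
        (((if v j = u j then φ v * b' else 0) +
          (if j = 1 ∨ v j < u (j - 1) then φ (up v j) else 0)) +
        ((if 2 ≤ j ∧ v j = u (j - 1) then φ v * b else 0) +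
          (if u j < v j then φ (down v j) else 0))) =
    inflow q (k + 1) φ v := by
  -- For `k = 2m - 1` the left rate of row `k` and the right rate of row `k + 1` are both `(q m)⁻¹`.
  -- This coincidence lets the wall term of row `k` complete the sum over the next row.
  have e0 : (if Odd k ∧ u ((k + 1) / 2) = 0 then ENNReal.ofReal (rightRate q k)⁻¹ else 0) =
      if Odd k ∧ u ((k + 1) / 2) = 0 then b else 0 := by
    split_ifs with h
    · have h1 : ¬ Odd (k + 1) := by rw [Nat.odd_iff]; have := Nat.odd_iff.1 h.1; omega
      have h2 : (k + 1 + 1) / 2 = (k + 1) / 2 := by have := Nat.odd_iff.1 h.1; omega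
      rw [hb, rightRate, rightRate, if_pos h.1, if_neg h1, h2]
    · rfl
  have hL := sum_hold_left huv hu (φ v * b')
  have hR := sum_hold_right huv (φ v * b)
  have hU := sum_up_eq huv hu (fun j => φ (up v j))
  have hD := sum_down_eq huv hu (fun j => φ (down v j))
  unfold inflow hold
  rw [e0, holdConst, ← hb, ← hb']
  simp only [Finset.sum_add_distrib]
  have hk2 : (k + 1 + 1) / 2 = (k + 2) / 2 := rfl
  rw [hk2, ← hU, ← hD]
  have hc : φ v * (holdConst q k + ((k + 1) / 2 : ℕ) * (b' + b) +
      if Odd (k + 1) ∧ v ((k + 2) / 2) = 0 then b' else 0) =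
      φ v * holdConst q k + (((k + 1) / 2 : ℕ) * (φ v * b') +
        if Odd (k + 1) ∧ v ((k + 2) / 2) = 0 then φ v * b' else 0) +
        ((k + 1) / 2 : ℕ) * (φ v * b) := by
    rw [← mul_ite_zero]
    ring
  rw [hc, ← hL, ← hR, mul_add, mul_ite_zero]
  ring

end TwoRows

/-! ### Predecessors weighted by the factor of the last row -/

section TwoRows

variable {u v : ℕ → ℕ} {b b' : ℝ≥0∞} {A : ℤ → ℝ≥0∞}

open Classical in
-- The contribution of the moves of the first `k` rows, after the last row has been summed out. If a
-- move of row `k` pushes, both row sums change equally and the weight factor `A` is unchanged. If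
-- it does not push, `A` acquires one factor `b` or `b'`, the rate of a jump in the last row.
theorem inflow_push (q : ℕ → ℝ) (huv : Interlaces k u v) (hu : IsRow k u) (φ : (ℕ → ℕ) → ℝ≥0∞)
    (hA : ∀ n, A (n + 1) = A n * b) (hA' : ∀ n, A (n - 1) = A n * b') :
    inflow q k (fun w => ∑' w', if Interlaces k w w' ∧ push w u w' = v then
        φ w' * A (size (k + 1) w' - size k w) else 0) u =
      A (size (k + 1) v - size k u) * (φ v * hold q k u +
        ∑ j ∈ Finset.Icc 1 ((k + 1) / 2),
          (((if u j < v j then φ v * b' else 0) +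
            (if v (j + 1) = u j ∧ u j < v j ∧ j + 1 ≤ (k + 2) / 2 then φ (up v (j + 1)) else 0)) +
          ((if v (j + 1) < u j then φ v * b else 0) +
            (if v (j + 1) < u j ∧ v j = u j then φ (down v j) else 0)))) := by
  have h0 : (∑' w', if Interlaces k u w' ∧ push u u w' = v then
        φ w' * A (size (k + 1) w' - size k u) else 0) =
      A (size (k + 1) v - size k u) * φ v := by
    rw [tsum_eq_single v]
    · rw [if_pos ⟨huv, push_self _ _⟩, mul_comm]
    · intro w hw
      rw [if_neg]
      rw [push_self]
      exact fun h => hw h.2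
  unfold inflow
  simp only [h0]
  rw [mul_add, mul_assoc, Finset.mul_sum]
  congr 1
  refine Finset.sum_congr rfl fun j hj => ?_
  obtain ⟨hj1, hj2⟩ := Finset.mem_Icc.1 hj
  have hlow := huv.lower hu hj1
  have hupp := huv.upper (j := j + 1) (by omega)
  rw [Nat.add_sub_cancel] at hupp
  rw [mul_add]
  congr 1
  · have hval : u j < v j → j = 1 ∨ u j < u (j - 1) := by
      intro h
      by_cases h1 : j = 1
      · exact Or.inl h1
      · exact Or.inr (h.trans_le (huv.upper (by omega)))
    have hsum := tsum_ite_or (p := fun w' => Interlaces k (up u j) w' ∧ push (up u j) u w' = v)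
      (fun w' => φ w' * A (size (k + 1) w' - size k (up u j)))
      (fun w' => interlaces_up_and_push_iff huv hj w') (fun _ => up_ne v (j + 1))
    have hsz : size k (up u j) = size k u + 1 := size_up hj
    have e : (∑' w', if Interlaces k (up u j) w' ∧ push (up u j) u w' = v then
        φ w' * A (size (k + 1) w' - size k (up u j)) else 0) =
        A (size (k + 1) v - size k u) * ((if u j < v j then φ v * b' else 0) +
            (if v (j + 1) = u j ∧ u j < v j ∧ j + 1 ≤ (k + 2) / 2 then φ (up v (j + 1)) else 0)) := by
      rw [hsum, mul_add]
      congr 1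
      · split_ifs
        · rw [hsz, show size (k + 1) v - (size k u + 1) = size (k + 1) v - size k u - 1 by ring, hA']
          ring
        · simp
      · split_ifs with h
        · rw [hsz, size_up (Finset.mem_Icc.2 ⟨by omega, h.2.2⟩),
            show size (k + 1) v + 1 - (size k u + 1) = size (k + 1) v - size k u by ring]
          ring
        · simp
    rw [e]
    by_cases h : u j < v j
    · rw [if_pos (hval h)]
    · simp [h]
  · by_cases h : v (j + 1) < u j
    · have hval : u (j + 1) < u j := lt_of_le_of_lt (huv.lower hu (by omega)) h
      have hsum := tsum_ite_or
        (p := fun w' => Interlaces k (down u j) w' ∧ push (down u j) u w' = v)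
        (fun w' => φ w' * A (size (k + 1) w' - size k (down u j)))
        (fun w' => interlaces_down_and_push_iff huv hj (by omega) w')
        (fun h' => down_ne (by omega))
      have hsz : size k (down u j) = size k u - 1 := size_down hj (by omega)
      rw [if_pos hval, hsum, mul_add, if_pos h, if_pos h]
      congr 1
      · rw [hsz, show size (k + 1) v - (size k u - 1) = size (k + 1) v - size k u + 1 by ring, hA]
        ring
      · split_ifs with h'
        · rw [hsz, size_down (Finset.mem_Icc.2 ⟨hj1, by omega⟩) (by omega),
            show size (k + 1) v - 1 - (size k u - 1) = size (k + 1) v - size k u by ring]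
          ring
        · simp
    · have hzero : u (j + 1) < u j →
          ∀ w', ¬ (Interlaces k (down u j) w' ∧ push (down u j) u w' = v) := by
        intro hlt w' h'
        have := (interlaces_down_and_push_iff huv hj (by omega) w').1 h'
        omega
      by_cases hlt : u (j + 1) < u j
      · simp [hzero hlt, h]
      · simp [hlt, h]

open Classical in
-- The contribution of the clocks of the last row. A successful jump changes the exponent of `A` by
-- one, which cancels its rate; a blocked attempt keeps its rate.
theorem tsum_own (huv : Interlaces k u v) (hu : IsRow k u) (φ : (ℕ → ℕ) → ℝ≥0∞)
    (hA : ∀ n, A (n - 1) * b = A n) (hA' : ∀ n, A (n + 1) * b' = A n) :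
    (∑' w, if Interlaces k u w then φ w * A (size (k + 1) w - size k u) *
        ∑ j ∈ Finset.Icc 1 ((k + 2) / 2),
          ((if (if w j = u j then w else down w j) = v then b' else 0) +
            (if (if 2 ≤ j ∧ w j = u (j - 1) then w else up w j) = v then b else 0)) else 0) =
      A (size (k + 1) v - size k u) * ∑ j ∈ Finset.Icc 1 ((k + 2) / 2),
        (((if v j = u j then φ v * b' else 0) +
          (if j = 1 ∨ v j < u (j - 1) then φ (up v j) else 0)) +
        ((if 2 ≤ j ∧ v j = u (j - 1) then φ v * b else 0) +
          (if u j < v j then φ (down v j) else 0))) := by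
  have h1 : ∀ w, (if Interlaces k u w then φ w * A (size (k + 1) w - size k u) *
        ∑ j ∈ Finset.Icc 1 ((k + 2) / 2),
          ((if (if w j = u j then w else down w j) = v then b' else 0) +
            (if (if 2 ≤ j ∧ w j = u (j - 1) then w else up w j) = v then b else 0)) else 0) =
      ∑ j ∈ Finset.Icc 1 ((k + 2) / 2),
        ((if Interlaces k u w ∧ (if w j = u j then w else down w j) = v then
          φ w * A (size (k + 1) w - size k u) * b' else 0) +
        (if Interlaces k u w ∧ (if 2 ≤ j ∧ w j = u (j - 1) then w else up w j) = v then
          φ w * A (size (k + 1) w - size k u) * b else 0)) := by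
    intro w
    by_cases h : Interlaces k u w
    · simp only [h, if_true, true_and, Finset.mul_sum, mul_add, mul_ite_zero]
    · simp [h]
  simp only [h1]
  rw [Summable.tsum_finsetSum fun _ _ => ENNReal.summable, Finset.mul_sum]
  refine Finset.sum_congr rfl fun j hj => ?_
  have hj' : j ∈ Finset.Icc 1 ((k + 1 + 1) / 2) := hj
  rw [ENNReal.tsum_add, mul_add]
  congr 1
  · rw [tsum_ite_or _ (fun w => interlaces_and_left_iff huv hu hj w) (fun _ => up_ne v j), mul_add]
    congr 1
    · rw [← mul_ite_zero]
      split_ifs <;> ring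
    · rw [size_up hj', show size (k + 1) v + 1 - size k u = size (k + 1) v - size k u + 1 by ring,
        mul_assoc, hA', ← mul_ite_zero]
      split_ifs <;> ring
  · rw [tsum_ite_or _ (fun w => interlaces_and_right_iff huv hu hj w)
      (fun h => down_ne (by omega)), mul_add]
    congr 1
    · rw [← mul_ite_zero]
      split_ifs <;> ring
    · rw [← mul_ite_zero]
      split_ifs with h
      · rw [size_down hj' (by omega),
          show size (k + 1) v - 1 - size k u = size (k + 1) v - size k u - 1 by ring, mul_assoc, hA]
        ring
      · simp

end TwoRows

open Classical in
/-- The weights are invariant in the following sense: the rate at which the weights flow into `y` is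
the weight of `y` times a quantity that depends only on the last row of `y`. -/
theorem tsum_wt_mul_flow {q : ℕ → ℝ} (hq : ∀ i, 1 ≤ i → i ≤ (k + 1) / 2 → 0 < q i)
    (φ : (ℕ → ℕ) → ℝ≥0∞) (y : GT k) :
    ∑' x : GT k, φ x.row * x.wt q * flow q x y = y.wt q * inflow q k φ y.row := by
  induction k generalizing φ with
  | zero =>
    have : IsEmpty (Label 0) := ⟨fun p => by have := p.2.1; have := p.2.2.1; omega⟩
    have h : ∀ x, flow q x y = 0 := fun x => by rw [flow_eq_sum_label]; simp
    simp [h, inflow, hold, holdConst]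
  | succ k ih =>
    have hq' : ∀ i, 1 ≤ i → i ≤ (k + 1) / 2 → 0 < q i := fun i h1 h2 => hq i h1 (by omega)
    have ha : 0 < rightRate q (k + 1) := rightRate_pos hq (by omega) le_rfl
    set b := ENNReal.ofReal (rightRate q (k + 1)) with hb
    set b' := ENNReal.ofReal (rightRate q (k + 1))⁻¹ with hb'
    let A : ℤ → ℝ≥0∞ := fun n => ENNReal.ofReal (rightRate q (k + 1) ^ n)
    have hA1 : ∀ n, A (n + 1) = A n * b := fun n => by
      simp only [A, hb]
      rw [zpow_add_one₀ ha.ne', ENNReal.ofReal_mul (zpow_pos ha n).le]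
    have hA2 : ∀ n, A (n - 1) = A n * b' := fun n => by
      simp only [A, hb']
      rw [zpow_sub_one₀ ha.ne', ENNReal.ofReal_mul (zpow_pos ha n).le]
    have hA3 : ∀ n, A (n - 1) * b = A n := fun n => by rw [← hA1, sub_add_cancel]
    have hA4 : ∀ n, A (n + 1) * b' = A n := fun n => by rw [← hA2, add_sub_cancel_right]
    have huv := y.interlaces
    have hu := y.restrict.isRow
    let F : GT k → (ℕ → ℕ) → ℝ≥0∞ := fun x w =>
      φ w * (x.wt q * A (size (k + 1) w - size k x.row)) *
        ((if push x.row y.restrict.row w = y.row then flow q x y.restrict else 0) +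
          if x = y.restrict then ∑ j ∈ Finset.Icc 1 ((k + 2) / 2),
            ((if (if w j = x.row j then w else down w j) = y.row then b' else 0) +
              (if (if 2 ≤ j ∧ w j = x.row (j - 1) then w else up w j) = y.row then b else 0))
          else 0)
    have h1 : ∀ x : GT (k + 1), φ x.row * x.wt q * flow q x y = F x.restrict x.row := by
      intro x
      rw [GT.wt_succ hq, flow_succ]
    refine (tsum_congr h1).trans ((GT.tsum_succ F).trans ?_)
    have h2 : ∀ x : GT k, (∑' w, if Interlaces k x.row w then
        φ w * (x.wt q * A (size (k + 1) w - size k x.row)) *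
          ((if push x.row y.restrict.row w = y.row then flow q x y.restrict else 0) +
            if x = y.restrict then ∑ j ∈ Finset.Icc 1 ((k + 2) / 2),
              ((if (if w j = x.row j then w else down w j) = y.row then b' else 0) +
                (if (if 2 ≤ j ∧ w j = x.row (j - 1) then w else up w j) = y.row then b else 0))
            else 0) else 0) =
        (∑' w, if Interlaces k x.row w ∧ push x.row y.restrict.row w = y.row then
          φ w * A (size (k + 1) w - size k x.row) else 0) * x.wt q * flow q x y.restrict +
        if x = y.restrict then y.restrict.wt q * ∑' w, (if Interlaces k y.restrict.row w then
          φ w * A (size (k + 1) w - size k y.restrict.row) * ∑ j ∈ Finset.Icc 1 ((k + 2) / 2),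
          ((if (if w j = y.restrict.row j then w else down w j) = y.row then b' else 0) +
            (if (if 2 ≤ j ∧ w j = y.restrict.row (j - 1) then w else up w j) = y.row then b else 0))
          else 0) else 0 := by
      intro x
      rw [← ENNReal.tsum_mul_right, ← ENNReal.tsum_mul_right]
      by_cases hx : x = y.restrict
      · subst hx
        rw [if_pos rfl, ← ENNReal.tsum_mul_left, ← ENNReal.tsum_add]
        refine tsum_congr fun w => ?_
        by_cases hw : Interlaces k y.restrict.row w
        · simp only [hw, if_true, true_and]
          split_ifs <;> ring
        · simp [hw]
      · simp only [hx, if_false, add_zero]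
        refine tsum_congr fun w => ?_
        by_cases hw : Interlaces k x.row w
        · simp only [hw, if_true, true_and]
          split_ifs
          · ring
          · simp
        · simp [hw]
    refine (tsum_congr h2).trans ?_
    -- With `y` fixed, the inner sum over last rows depends on the lower pattern only through its
    -- row `k`, so it is an admissible test function for the induction hypothesis. This is why `φ`
    -- must be arbitrary.
    rw [ENNReal.tsum_add, tsum_ite_eq,
      ih hq' (fun u => ∑' w, if Interlaces k u w ∧ push u y.restrict.row w = y.row then
          φ w * A (size (k + 1) w - size k u) else 0) y.restrict]
    rw [inflow_push q huv hu φ hA1 hA2, tsum_own huv hu φ hA3 hA4, GT.wt_succ hq,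
      ← inflow_succ huv hu φ hb hb']
    change _ = _ * A _ * _
    ring

/-! ### The kernel of the last row -/

/-- An element of `W k` as a function on `ℕ`, with the indexing of the rows of a pattern. -/
def W.toRow (v : W k) : ℕ → ℕ := fun n =>
  if h : 1 ≤ n ∧ n ≤ (k + 1) / 2 then v.1 ⟨n - 1, by omega⟩ else 0

theorem W.toRow_succ (v : W k) (i : Fin ((k + 1) / 2)) : W.toRow v (i + 1) = v.1 i := by
  unfold W.toRow
  rw [dif_pos ⟨by omega, by omega⟩]
  rfl

theorem W.toRow_eq_zero (v : W k) {n : ℕ} (h : ¬(1 ≤ n ∧ n ≤ (k + 1) / 2)) : W.toRow v n = 0 :=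
  dif_neg h

theorem W.toRow_injective : Function.Injective (W.toRow (k := k)) := fun v w h =>
  Subtype.ext (funext fun i => by rw [← W.toRow_succ, ← W.toRow_succ, h])

theorem W.toRow_succ_le (v : W k) {n : ℕ} (hn : 1 ≤ n) : W.toRow v (n + 1) ≤ W.toRow v n := by
  by_cases h : n + 1 ≤ (k + 1) / 2
  · have h1 := W.toRow_succ v ⟨n, by omega⟩
    have h2 := W.toRow_succ v ⟨n - 1, by omega⟩
    simp only at h1 h2
    rw [show n - 1 + 1 = n by omega] at h2
    rw [h1, h2]
    exact v.2 (by simp [Fin.le_def])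
  · rw [W.toRow_eq_zero v (by omega)]
    exact Nat.zero_le _

theorem GT.toRow_lastRow (x : GT k) : W.toRow x.lastRow = x.row := by
  funext n
  by_cases h : 1 ≤ n ∧ n ≤ (k + 1) / 2
  · unfold W.toRow
    rw [dif_pos h]
    change x.entry k (n - 1 + 1) = x.entry k n
    rw [show n - 1 + 1 = n by omega]
  · rw [W.toRow_eq_zero _ h, x.isRow n h]

theorem toRow_eq_up_iff {v w : W k} {i : Fin ((k + 1) / 2)} :
    up (W.toRow w) (i + 1) = W.toRow v ↔ v.1 = w.1 + Pi.single i 1 := by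
  constructor
  · intro h
    funext m
    rw [← W.toRow_succ, ← h]
    by_cases hm : m = i
    · subst hm; simp [up, W.toRow_succ]
    · have : (m : ℕ) ≠ i := fun h' => hm (Fin.ext h')
      simp [up, W.toRow_succ, hm, this]
  · intro h
    funext n
    by_cases hn : 1 ≤ n ∧ n ≤ (k + 1) / 2
    · obtain ⟨m, rfl⟩ : ∃ m : Fin ((k + 1) / 2), n = m + 1 := ⟨⟨n - 1, by omega⟩, by simp; omega⟩
      rw [W.toRow_succ, h]
      by_cases hm : m = i
      · subst hm; simp [up, W.toRow_succ]
      · have : (m : ℕ) ≠ i := fun h' => hm (Fin.ext h')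
        simp [up, W.toRow_succ, hm, this]
    · have : n ≠ i + 1 := by omega
      simp [up, W.toRow_eq_zero _ hn, this]

theorem down_eq_iff {u v : ℕ → ℕ} {j : ℕ} (h : 0 < u j) : down u j = v ↔ up v j = u := by
  constructor
  · rintro rfl
    funext n
    by_cases hn : n = j
    · subst hn; simp [up, down]; omega
    · simp [up, down, hn]
  · rintro rfl
    funext n
    by_cases hn : n = j
    · subst hn; simp [up, down]
    · simp [up, down, hn]

open Classical in
-- A neighbour differs from `w` in a single entry and by a single unit, so at most one term is
-- nonzero. The inequalities in `inflow` hold automatically because both rows are nonincreasing.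
theorem sum_neighbours (v w : W k) :
    ∑ j ∈ Finset.Icc 1 ((k + 1) / 2),
      ((if j = 1 ∨ W.toRow w j < W.toRow w (j - 1) then
          (if up (W.toRow w) j = W.toRow v then 1 else 0) else 0) +
        (if W.toRow w (j + 1) < W.toRow w j then
          (if down (W.toRow w) j = W.toRow v then 1 else 0) else 0)) =
      (if IsNeighbour v w then 1 else 0 : ℝ≥0∞) := by
  have hup : ∀ i : Fin ((k + 1) / 2), up (W.toRow w) (i + 1) = W.toRow v →
      ((i : ℕ) + 1 = 1 ∨ W.toRow w (i + 1) < W.toRow w (i + 1 - 1)) := by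
    intro i h
    by_cases hi : (i : ℕ) = 0
    · left; omega
    · right
      have h1 := W.toRow_succ_le v (n := i) (by omega)
      rw [← h] at h1
      simpa [up, Nat.succ_le_iff] using h1
  have hdown : ∀ i : Fin ((k + 1) / 2), up (W.toRow v) (i + 1) = W.toRow w →
      W.toRow w (i + 1 + 1) < W.toRow w (i + 1) := by
    intro i h
    have h1 := W.toRow_succ_le v (n := i + 1) (by omega)
    rw [← h]
    simp [up]
    omega
  by_cases hN : IsNeighbour v w
  · rw [if_pos hN]
    obtain ⟨i, hi⟩ := hN
    have hmem : (i : ℕ) + 1 ∈ Finset.Icc 1 ((k + 1) / 2) := Finset.mem_Icc.2 ⟨by omega, by omega⟩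
    rw [Finset.sum_eq_single_of_mem _ hmem]
    · rcases hi with hi | hi
      · have h := toRow_eq_up_iff.2 hi
        have hpos : 0 < W.toRow w (i + 1) := by rw [← h]; simp [up]
        have hne : ¬ up (W.toRow w) (i + 1) = W.toRow v := by
          intro h'
          rw [← h'] at h
          have := congrFun h (i + 1)
          simp [up] at this
          omega
        rw [if_pos (hdown i h), if_pos ((down_eq_iff hpos).2 h), if_neg hne]
        simp
      · have h := toRow_eq_up_iff.2 hi
        have hne : ¬ down (W.toRow w) (i + 1) = W.toRow v := by
          intro h'
          rw [← h'] at h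
          have := congrFun h (i + 1)
          simp [up, down] at this
          omega
        rw [if_pos (hup i h), if_pos h, if_neg hne]
        simp
    · intro j hj hne
      have e1 : ¬ up (W.toRow w) j = W.toRow v := by
        intro h
        rcases hi with hi | hi
        · have h' := toRow_eq_up_iff.2 hi
          rw [← h] at h'
          have := congrFun h' (i + 1)
          simp only [up, if_true] at this
          split_ifs at this <;> omega
        · have h' := toRow_eq_up_iff.2 hi
          rw [← h] at h'
          have := congrFun h' j
          simp [up, hne] at this
      have e2 : ¬ (W.toRow w (j + 1) < W.toRow w j ∧ down (W.toRow w) j = W.toRow v) := by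
        rintro ⟨h1, h⟩
        rw [down_eq_iff (by omega)] at h
        rcases hi with hi | hi
        · have h' := toRow_eq_up_iff.2 hi
          rw [← h] at h'
          have := congrFun h' j
          simp [up, hne] at this
        · have h' := toRow_eq_up_iff.2 hi
          rw [← h] at h'
          have := congrFun h' j
          simp only [up, if_true] at this
          split_ifs at this <;> omega
      rw [← ite_and, ← ite_and, if_neg e2, if_neg fun h => e1 h.2]
      simp
  · rw [if_neg hN]
    refine Finset.sum_eq_zero fun j hj => ?_
    obtain ⟨hj1, hj2⟩ := Finset.mem_Icc.1 hj
    obtain ⟨i, rfl⟩ : ∃ i : Fin ((k + 1) / 2), j = i + 1 := ⟨⟨j - 1, by omega⟩, by simp; omega⟩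
    have e1 : ¬ up (W.toRow w) (i + 1) = W.toRow v := fun h =>
      hN ⟨i, Or.inr (toRow_eq_up_iff.1 h)⟩
    have e2 : ¬ (W.toRow w (i + 1 + 1) < W.toRow w (i + 1) ∧
        down (W.toRow w) (i + 1) = W.toRow v) := fun h =>
      hN ⟨i, Or.inl (toRow_eq_up_iff.1 ((down_eq_iff (by omega)).1 h.2))⟩
    rw [← ite_and, ← ite_and, if_neg e2, if_neg fun h => e1 h.2]
    simp

open Classical in
-- The case of `tsum_wt_mul_flow` in which `φ` is the indicator of the row `v`.
theorem tsum_lastRow_flow {q : ℕ → ℝ} (hq : ∀ i, 1 ≤ i → i ≤ (k + 1) / 2 → 0 < q i)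
    (v : W k) (y : GT k) :
    ∑' x : GT k, (if x.lastRow = v then x.wt q else 0) * flow q x y =
      y.wt q * ((if v = y.lastRow then hold q k (W.toRow v) else 0) +
        if IsNeighbour v y.lastRow then 1 else 0) := by
  have h := tsum_wt_mul_flow hq (fun u => if u = W.toRow v then 1 else 0) y
  have h1 : ∀ x : GT k, x.row = W.toRow v ↔ x.lastRow = v := fun x => by
    rw [← x.toRow_lastRow, W.toRow_injective.eq_iff]
  simp only [h1, ite_mul, one_mul, zero_mul] at h
  simp only [ite_mul, zero_mul]
  rw [h]
  congr 1
  unfold inflow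
  congr 1
  · change (if y.row = W.toRow v then 1 else 0) * _ = _
    simp only [h1]
    by_cases h2 : y.lastRow = v
    · subst h2; simp [y.toRow_lastRow]
    · rw [if_neg h2, if_neg (Ne.symm h2), zero_mul]
  · rw [← sum_neighbours]
    simp only [y.toRow_lastRow]

/-! ### Positivity of the symplectic Schur functions -/

open Classical in
/-- A pattern with a given last row. -/
noncomputable def W.toGT (v : W k) : GT k where
  entry := fun i j => if IsLabel k i j then W.toRow v j else 0
  entry_eq_zero := fun i j h => if_neg h
  entry_le := by
    intro i j h1 h2
    rw [if_pos h1, if_pos h2]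
  le_entry := by
    intro i j h1 h2
    rw [if_pos h1, if_pos h2]
    exact W.toRow_succ_le v h1.2.2.1

open Classical in
theorem W.lastRow_toGT (v : W k) : v.toGT.lastRow = v := by
  apply W.toRow_injective
  rw [GT.toRow_lastRow]
  funext n
  change (if IsLabel k k n then W.toRow v n else 0) = _
  split_ifs with h
  · rfl
  · rw [W.toRow_eq_zero]
    intro h'
    exact h ⟨by omega, le_rfl, h'.1, h'.2⟩

theorem schur_pos {q : ℕ → ℝ} (hq : ∀ i, 1 ≤ i → i ≤ (k + 1) / 2 → 0 < q i) (v : W k) :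
    0 < schur q v := by
  unfold schur
  refine Finset.sum_pos (fun x _ => GT.weight_pos hq x le_rfl) ⟨v.toGT, ?_⟩
  rw [Set.Finite.mem_toFinset]
  exact v.lastRow_toGT

open Classical in
theorem tsum_lastRow_wt {q : ℕ → ℝ} (hq : ∀ i, 1 ≤ i → i ≤ (k + 1) / 2 → 0 < q i) (v : W k) :
    ∑' x : GT k, (if x.lastRow = v then x.wt q else 0) = ENNReal.ofReal (schur q v) := by
  unfold schur
  rw [ENNReal.ofReal_sum_of_nonneg fun x _ => (GT.weight_pos hq x le_rfl).le,
    tsum_eq_sum (s := (GT.finite_lastRow_eq v).toFinset)]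
  · refine Finset.sum_congr rfl fun x hx => ?_
    rw [Set.Finite.mem_toFinset] at hx
    exact if_pos hx
  · intro x hx
    rw [Set.Finite.mem_toFinset] at hx
    exact if_neg hx

/-- The total rate of all clocks. -/
noncomputable def totalRate (k : ℕ) (q : ℕ → ℝ) : ℝ := ∑ c : Clock k, rate q c

theorem rate_pos {q : ℕ → ℝ} (hq : ∀ i, 1 ≤ i → i ≤ (k + 1) / 2 → 0 < q i) (c : Clock k) :
    0 < rate q c := by
  have h : 0 < rightRate q c.1.1.1 := rightRate_pos hq c.1.2.1 c.1.2.2.1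
  obtain ⟨p, _ | _⟩ := c
  · rw [rate_left]; exact inv_pos.2 h
  · exact h

theorem totalRate_nonneg {q : ℕ → ℝ} (hq : ∀ i, 1 ≤ i → i ≤ (k + 1) / 2 → 0 < q i) :
    0 ≤ totalRate k q :=
  Finset.sum_nonneg fun c _ => (rate_pos hq c).le

/-- Every clock leads to exactly one state, possibly `x` itself, so the row sums are constant and
uniformization applies. -/
theorem tsum_flow {q : ℕ → ℝ} (hq : ∀ i, 1 ≤ i → i ≤ (k + 1) / 2 → 0 < q i) (x : GT k) :
    ∑' y, flow q x y = ENNReal.ofReal (totalRate k q) := by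
  unfold flow totalRate
  rw [Summable.tsum_finsetSum fun _ _ => ENNReal.summable,
    ENNReal.ofReal_sum_of_nonneg fun c _ => (rate_pos hq c).le]
  exact Finset.sum_congr rfl fun c _ =>
    (tsum_eq_single (x.ring c) fun y hy => if_neg hy.symm).trans (if_pos rfl)

open Classical in
/-- The conditional law of the pattern, given its last row. -/
noncomputable def link (q : ℕ → ℝ) (v : W k) (x : GT k) : ℝ≥0∞ :=
  if x.lastRow = v then x.wt q / ENNReal.ofReal (schur q v) else 0

open Classical in
/-- The rates of the last row, including jumps from a state to itself. -/
noncomputable def rowFlow (q : ℕ → ℝ) (v w : W k) : ℝ≥0∞ :=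
  ENNReal.ofReal (schur q w) / ENNReal.ofReal (schur q v) *
    ((if v = w then hold q k (W.toRow v) else 0) + if IsNeighbour v w then 1 else 0)

theorem tsum_link {q : ℕ → ℝ} (hq : ∀ i, 1 ≤ i → i ≤ (k + 1) / 2 → 0 < q i) (v : W k) :
    ∑' x, link q v x = 1 := by
  classical
  have h : ∀ x : GT k, link q v x =
      (if x.lastRow = v then x.wt q else 0) * (ENNReal.ofReal (schur q v))⁻¹ := fun x => by
    unfold link
    rw [ite_mul, zero_mul, div_eq_mul_inv]
  simp_rw [h]
  rw [ENNReal.tsum_mul_right, tsum_lastRow_wt hq]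
  exact ENNReal.mul_inv_cancel (ENNReal.ofReal_pos.2 (schur_pos hq v)).ne' ENNReal.ofReal_ne_top

/-- The intertwining. Normalizing the weights by the Schur functions turns the unit coefficients of
the neighbours into the ratios `s_w / s_v`. -/
theorem tsum_link_mul_flow {q : ℕ → ℝ} (hq : ∀ i, 1 ≤ i → i ≤ (k + 1) / 2 → 0 < q i)
    (v : W k) (y : GT k) :
    ∑' x, link q v x * flow q x y = rowFlow q v y.lastRow * link q y.lastRow y := by
  classical
  have h : ∀ x : GT k, link q v x * flow q x y =
      (if x.lastRow = v then x.wt q else 0) * flow q x y * (ENNReal.ofReal (schur q v))⁻¹ :=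
    fun x => by
      unfold link
      rw [ite_mul, ite_mul, ite_mul, zero_mul, zero_mul, div_eq_mul_inv]
      split_ifs <;> ring
  simp_rw [h]
  rw [ENNReal.tsum_mul_right, tsum_lastRow_flow hq, rowFlow, link, if_pos rfl, div_eq_mul_inv,
    div_eq_mul_inv]
  have hc := ENNReal.mul_inv_cancel (ENNReal.ofReal_pos.2 (schur_pos hq y.lastRow)).ne'
    ENNReal.ofReal_ne_top
  set X : ℝ≥0∞ := (if v = y.lastRow then hold q k (W.toRow v) else 0) +
    if IsNeighbour v y.lastRow then 1 else 0
  calc y.wt q * X * (ENNReal.ofReal (schur q v))⁻¹ =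
        (ENNReal.ofReal (schur q y.lastRow) * (ENNReal.ofReal (schur q y.lastRow))⁻¹) *
          (y.wt q * X * (ENNReal.ofReal (schur q v))⁻¹) := by rw [hc, one_mul]
    _ = _ := by ring

theorem link_of_ne {q : ℕ → ℝ} {v : W k} {x : GT k} (h : x.lastRow ≠ v) : link q v x = 0 :=
  if_neg h

theorem tsum_rowFlow_mul_link {q : ℕ → ℝ} (v : W k) (y : GT k) :
    ∑' w, rowFlow q v w * link q w y = rowFlow q v y.lastRow * link q y.lastRow y :=
  tsum_eq_single _ fun w hw => by rw [link_of_ne hw.symm, mul_zero]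

/-- Both sides of the intertwining are summed over `y`: `link` has mass one and `flow` has constant
row sums. So no separate identity for the sum of the Schur functions of the neighbours is needed. -/
theorem tsum_rowFlow {q : ℕ → ℝ} (hq : ∀ i, 1 ≤ i → i ≤ (k + 1) / 2 → 0 < q i) (v : W k) :
    ∑' w, rowFlow q v w = ENNReal.ofReal (totalRate k q) := by
  have h1 : ∑' y, ∑' x, link q v x * flow q x y = ENNReal.ofReal (totalRate k q) := by
    rw [ENNReal.tsum_comm]
    simp_rw [ENNReal.tsum_mul_left, tsum_flow hq, ENNReal.tsum_mul_right, tsum_link hq, one_mul]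
  simp_rw [tsum_link_mul_flow hq, ← tsum_rowFlow_mul_link] at h1
  rw [ENNReal.tsum_comm] at h1
  simpa only [ENNReal.tsum_mul_left, tsum_link hq, mul_one] using h1

theorem not_isNeighbour_self (v : W k) : ¬ IsNeighbour v v := by
  rintro ⟨i, h | h⟩ <;>
  · have := congrFun h i
    simp at this

theorem rowFlow_toReal_of_ne {q : ℕ → ℝ} (hq : ∀ i, 1 ≤ i → i ≤ (k + 1) / 2 → 0 < q i) {v w : W k}
    (h : v ≠ w) : (rowFlow q v w).toReal = jumpRate q v w := by
  unfold rowFlow jumpRate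
  rw [if_neg h, zero_add, ENNReal.toReal_mul, ENNReal.toReal_div,
    ENNReal.toReal_ofReal (schur_pos hq _).le, ENNReal.toReal_ofReal (schur_pos hq _).le]
  split_ifs <;> simp

open Classical in
/-- The generator is the matrix of the rates, minus the total rate on the diagonal. -/
theorem generator_eq {q : ℕ → ℝ} (hq : ∀ i, 1 ≤ i → i ≤ (k + 1) / 2 → 0 < q i) (v w : W k) :
    generator q v w = (rowFlow q v w).toReal - if v = w then totalRate k q else 0 := by
  unfold generator
  by_cases h : v = w
  · subst h
    rw [if_pos rfl, if_pos rfl]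
    have hs := tsum_rowFlow hq v
    have hfin : ∀ z, rowFlow q v z ≠ ⊤ :=
      ENNReal.ne_top_of_tsum_ne_top (by rw [hs]; exact ENNReal.ofReal_ne_top)
    have hsum : Summable fun z => (rowFlow q v z).toReal :=
      ENNReal.summable_toReal (by rw [hs]; exact ENNReal.ofReal_ne_top)
    have h1 : ∑' z, (rowFlow q v z).toReal = totalRate k q := by
      rw [← ENNReal.tsum_toReal_eq hfin, hs, ENNReal.toReal_ofReal (totalRate_nonneg hq)]
    -- Off the diagonal `rowFlow` is the jump rate; its diagonal term is therefore the total rate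
    -- minus the sum of the jump rates.
    have h2 : ∑' z, jumpRate q v z = ∑' z, if z = v then 0 else (rowFlow q v z).toReal := by
      refine tsum_congr fun z => ?_
      split_ifs with hz
      · subst hz; exact if_neg (not_isNeighbour_self _)
      · rw [rowFlow_toReal_of_ne hq (Ne.symm hz)]
    rw [h2, ← h1, hsum.tsum_eq_add_tsum_ite v]
    ring
  · rw [if_neg h, if_neg h, sub_zero, rowFlow_toReal_of_ne hq h]

/-! ### The semigroup of a matrix of bounded rates -/

section Semigroup

variable {E : Type*}

open Classical in
/-- The powers of a nonnegative kernel. -/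
noncomputable def kerPow (B : E → E → ℝ≥0∞) : ℕ → E → E → ℝ≥0∞
  | 0 => fun x y => if x = y then 1 else 0
  | n + 1 => fun x y => ∑' z, B x z * kerPow B n z y

theorem kerPow_add (B : E → E → ℝ≥0∞) (m n : ℕ) (x y : E) :
    kerPow B (m + n) x y = ∑' z, kerPow B m x z * kerPow B n z y := by
  classical
  induction m generalizing x with
  | zero =>
    rw [Nat.zero_add, tsum_eq_single x]
    · simp [kerPow]
    · intro z hz
      simp [kerPow, hz.symm]
  | succ m ih =>
    rw [Nat.succ_add_eq_add_succ, Nat.add_succ]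
    simp only [kerPow]
    simp_rw [ih, ← ENNReal.tsum_mul_left, ← ENNReal.tsum_mul_right]
    rw [ENNReal.tsum_comm]
    simp_rw [mul_assoc]

theorem tsum_kerPow {B : E → E → ℝ≥0∞} {r : ℝ≥0∞} (hB : ∀ x, ∑' y, B x y = r) (n : ℕ) (x : E) :
    ∑' y, kerPow B n x y = r ^ n := by
  classical
  induction n generalizing x with
  | zero =>
    rw [tsum_eq_single x]
    · simp [kerPow]
    · intro z hz
      simp [kerPow, hz.symm]
  | succ n ih =>
    simp only [kerPow]
    rw [ENNReal.tsum_comm]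
    simp_rw [ENNReal.tsum_mul_left, ih, ENNReal.tsum_mul_right, hB]
    rw [pow_succ']

theorem kerPow_one (B : E → E → ℝ≥0∞) (x y : E) : kerPow B 1 x y = B x y := by
  classical
  simp only [kerPow]
  rw [tsum_eq_single y]
  · simp
  · intro z hz
    simp [hz]

theorem kerPow_mono {B C : E → E → ℝ≥0∞} (h : ∀ x y, B x y ≤ C x y) (n : ℕ) (x y : E) :
    kerPow B n x y ≤ kerPow C n x y := by
  induction n generalizing x with
  | zero => exact le_rfl
  | succ n ih => exact ENNReal.tsum_le_tsum fun z => mul_le_mul' (h x z) (ih z)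

/-- The Poisson weights `e^{-rt} t^n / n!`. -/
noncomputable def expWeight (r t : ℝ) (n : ℕ) : ℝ := Real.exp (-(r * t)) * (t ^ n / n.factorial)

theorem expWeight_nonneg (r : ℝ) {t : ℝ} (ht : 0 ≤ t) (n : ℕ) : 0 ≤ expWeight r t n := by
  unfold expWeight
  positivity

theorem hasSum_expWeight (r t : ℝ) : HasSum (fun n => expWeight r t n * r ^ n) 1 := by
  have h := (NormedSpace.expSeries_div_hasSum_exp (r * t)).mul_left (Real.exp (-(r * t)))
  rw [← Real.exp_eq_exp_ℝ, ← Real.exp_add, neg_add_cancel, Real.exp_zero] at h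
  refine h.congr_fun fun n => ?_
  unfold expWeight
  rw [mul_pow]
  ring

theorem sum_antidiagonal_expWeight (r s t : ℝ) (n : ℕ) :
    ∑ p ∈ Finset.HasAntidiagonal.antidiagonal n, expWeight r s p.1 * expWeight r t p.2 =
      expWeight r (s + t) n := by
  unfold expWeight
  rw [(Commute.all s t).add_pow', Finset.sum_div, Finset.mul_sum]
  refine Finset.sum_congr rfl fun p hp => ?_
  have hp' := Finset.HasAntidiagonal.mem_antidiagonal.1 hp
  have h1 : (n.choose p.1 : ℝ) / n.factorial = 1 / (p.1.factorial * p.2.factorial) := by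
    rw [← hp', Nat.choose_symm_add, Nat.add_choose,
      Nat.cast_div (Nat.factorial_mul_factorial_dvd_factorial_add _ _)
      (by positivity)]
    push_cast
    field_simp
  rw [mul_add, neg_add, Real.exp_add, nsmul_eq_mul, mul_div_right_comm, h1]
  field_simp

/-- The gap at one point is at most the gap of the total masses, written without subtraction in
`ℝ≥0∞`. It turns pointwise lower bounds with nearly full mass into upper bounds. -/
theorem add_tsum_le_add_tsum {f g : E → ℝ≥0∞} (h : ∀ y, f y ≤ g y) (y : E) :
    g y + ∑' z, f z ≤ f y + ∑' z, g z := by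
  classical
  rw [ENNReal.tsum_eq_add_tsum_ite (f := f) y, ENNReal.tsum_eq_add_tsum_ite (f := g) y,
    add_left_comm]
  refine add_le_add_right (add_le_add_right (ENNReal.tsum_le_tsum fun z => ?_) _) _
  split_ifs
  · exact le_rfl
  · exact h z

/-- The semigroup of a matrix `B` of rates with row sums `r`, by uniformization. -/
noncomputable def semigroup (r : ℝ) (B : E → E → ℝ≥0∞) (t : ℝ≥0) (x y : E) : ℝ≥0∞ :=
  ∑' n, ENNReal.ofReal (expWeight r t n) * kerPow B n x y

variable {r : ℝ} {B : E → E → ℝ≥0∞}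

theorem tsum_semigroup (hr : 0 ≤ r) (hB : ∀ x, ∑' y, B x y = ENNReal.ofReal r) (t : ℝ≥0) (x : E) :
    ∑' y, semigroup r B t x y = 1 := by
  unfold semigroup
  rw [ENNReal.tsum_comm]
  have h1 : ∀ n, ∑' y, ENNReal.ofReal (expWeight r t n) * kerPow B n x y =
      ENNReal.ofReal (expWeight r t n * r ^ n) := fun n => by
    rw [ENNReal.tsum_mul_left, tsum_kerPow hB, ← ENNReal.ofReal_pow hr,
      ← ENNReal.ofReal_mul (expWeight_nonneg r t.coe_nonneg _)]
  simp_rw [h1]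
  have h := hasSum_expWeight r t
  rw [← ENNReal.ofReal_tsum_of_nonneg
    (fun n => mul_nonneg (expWeight_nonneg r t.coe_nonneg n) (pow_nonneg hr n)) h.summable, h.tsum_eq,
    ENNReal.ofReal_one]

theorem semigroup_le_one (hr : 0 ≤ r) (hB : ∀ x, ∑' y, B x y = ENNReal.ofReal r) (t : ℝ≥0)
    (x y : E) : semigroup r B t x y ≤ 1 :=
  (ENNReal.le_tsum y).trans (tsum_semigroup hr hB t x).le

theorem semigroup_zero (x y : E) : semigroup r B 0 x y = kerPow B 0 x y := by
  unfold semigroup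
  rw [tsum_eq_single 0]
  · simp [expWeight]
  · intro n hn
    simp [expWeight, hn]

/-- The double series is regrouped along antidiagonals, where the binomial theorem adds up the
Poisson weights. -/
theorem semigroup_add (s t : ℝ≥0) (x y : E) :
    semigroup r B (s + t) x y = ∑' z, semigroup r B s x z * semigroup r B t z y := by
  have h1 : ∀ z, semigroup r B s x z * semigroup r B t z y =
      ∑' m, ∑' n, ENNReal.ofReal (expWeight r s m) * ENNReal.ofReal (expWeight r t n) *
        (kerPow B m x z * kerPow B n z y) := by
    intro z
    unfold semigroup
    rw [← ENNReal.tsum_mul_right]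
    refine tsum_congr fun m => ?_
    rw [← ENNReal.tsum_mul_left]
    refine tsum_congr fun n => ?_
    ring
  simp_rw [h1]
  rw [ENNReal.tsum_comm]
  have h2 : ∀ m, ∑' z, ∑' n, ENNReal.ofReal (expWeight r s m) * ENNReal.ofReal (expWeight r t n) *
        (kerPow B m x z * kerPow B n z y) =
      ∑' n, ENNReal.ofReal (expWeight r s m) * ENNReal.ofReal (expWeight r t n) *
        kerPow B (m + n) x y := by
    intro m
    rw [ENNReal.tsum_comm]
    refine tsum_congr fun n => ?_
    rw [ENNReal.tsum_mul_left, kerPow_add]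
  simp_rw [h2]
  rw [← ENNReal.tsum_prod (f := fun m n => ENNReal.ofReal (expWeight r s m) *
      ENNReal.ofReal (expWeight r t n) * kerPow B (m + n) x y),
    ← Finset.HasAntidiagonal.sigmaAntidiagonalEquivProd.tsum_eq, ENNReal.tsum_sigma']
  refine tsum_congr fun n => ?_
  rw [tsum_fintype, NNReal.coe_add, ← sum_antidiagonal_expWeight, ENNReal.ofReal_sum_of_nonneg
    fun p _ => mul_nonneg (expWeight_nonneg r s.coe_nonneg _) (expWeight_nonneg r t.coe_nonneg _),
    Finset.sum_mul,
    ← Finset.sum_coe_sort (Finset.HasAntidiagonal.antidiagonal n)]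
  refine Finset.sum_congr rfl fun p _ => ?_
  have hp := Finset.HasAntidiagonal.mem_antidiagonal.1 p.2
  rw [ENNReal.ofReal_mul (expWeight_nonneg r s.coe_nonneg _)]
  simp [Finset.HasAntidiagonal.sigmaAntidiagonalEquivProd, hp]

theorem kerPow_semigroup (t : ℝ≥0) (n : ℕ) (x y : E) :
    kerPow (semigroup r B t) n x y = semigroup r B (n * t) x y := by
  induction n generalizing x with
  | zero => rw [Nat.cast_zero, zero_mul, semigroup_zero]; rfl
  | succ n ih =>
    have e : ((n + 1 : ℕ) : ℝ≥0) * t = t + n * t := by push_cast; ring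
    rw [e, semigroup_add]
    exact tsum_congr fun z => by rw [ih]

/-- The jump kernel of a short time interval in which there is at most one jump. -/
noncomputable def shortStep (r : ℝ) (B : E → E → ℝ≥0∞) (h : ℝ≥0) (x y : E) : ℝ≥0∞ :=
  ENNReal.ofReal (Real.exp (-(r * h))) * (kerPow B 0 x y + h * B x y)

theorem shortStep_le (h : ℝ≥0) (x y : E) : shortStep r B h x y ≤ semigroup r B h x y := by
  have e : shortStep r B h x y =
      ∑ n ∈ Finset.range 2, ENNReal.ofReal (expWeight r h n) * kerPow B n x y := by
    rw [Finset.sum_range_succ, Finset.sum_range_one, kerPow_one, shortStep]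
    unfold expWeight
    rw [ENNReal.ofReal_mul (Real.exp_pos _).le, ENNReal.ofReal_mul (Real.exp_pos _).le]
    simp only [pow_zero, Nat.factorial, Nat.cast_one, div_one, ENNReal.ofReal_one, mul_one, pow_one,
      ENNReal.ofReal_coe_nnreal]
    ring
  rw [e]
  exact ENNReal.sum_le_tsum _

theorem tsum_shortStep (hr : 0 ≤ r) (hB : ∀ x, ∑' y, B x y = ENNReal.ofReal r) (h : ℝ≥0) (x : E) :
    ∑' y, shortStep r B h x y = ENNReal.ofReal (Real.exp (-(r * h)) * (1 + r * h)) := by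
  unfold shortStep
  rw [ENNReal.tsum_mul_left, ENNReal.tsum_add, ENNReal.tsum_mul_left, hB, tsum_kerPow hB, pow_zero,
    ENNReal.ofReal_mul (Real.exp_pos _).le, ENNReal.ofReal_add zero_le_one (by positivity),
    ENNReal.ofReal_one, ENNReal.ofReal_mul hr, ENNReal.ofReal_coe_nnreal, mul_comm (h : ℝ≥0∞)]

theorem isTransitionFunction_semigroup (hr : 0 ≤ r) (hB : ∀ x, ∑' y, B x y = ENNReal.ofReal r) :
    IsTransitionFunction fun t x y => (semigroup r B t x y).toReal where
  nonneg _ _ _ := ENNReal.toReal_nonneg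
  sum_one t x := by
    have h := ENNReal.hasSum_toReal (f := semigroup r B t x)
      (by rw [tsum_semigroup hr hB]; exact ENNReal.one_ne_top)
    rwa [← ENNReal.tsum_toReal_eq fun y => ne_top_of_le_ne_top ENNReal.one_ne_top
      (semigroup_le_one hr hB t x y), tsum_semigroup hr hB, ENNReal.toReal_one] at h
  zero_self x := by simp [semigroup_zero, kerPow]
  chapman_kolmogorov s t x y := by
    have hfin := ne_top_of_le_ne_top ENNReal.one_ne_top (semigroup_le_one hr hB (s + t) x y)
    rw [semigroup_add] at hfin
    have h := ENNReal.hasSum_toReal hfin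
    rw [← ENNReal.tsum_toReal_eq (ENNReal.ne_top_of_tsum_ne_top hfin), ← semigroup_add] at h
    simpa only [ENNReal.toReal_mul] using h

/-- The semigroup lies between its first two terms `g t` and `g t` plus the missing mass `1 - exp
(-(r * t)) * (1 + r * t)`. The missing mass has derivative zero at `0`, so the derivative is that of
`g`. -/
theorem hasDerivWithinAt_semigroup (hr : 0 ≤ r) (hB : ∀ x, ∑' y, B x y = ENNReal.ofReal r)
    (x y : E) : HasDerivWithinAt (fun t : ℝ => (semigroup r B t.toNNReal x y).toReal)
      ((B x y).toReal - r * (kerPow B 0 x y).toReal) (Set.Ici 0) 0 := by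
  have hBle : B x y ≤ ENNReal.ofReal r := (ENNReal.le_tsum y).trans (hB x).le
  have hBfin : B x y ≠ ⊤ := ne_top_of_le_ne_top ENNReal.ofReal_ne_top hBle
  have h0le : kerPow B 0 x y ≤ 1 := by simp only [kerPow]; split_ifs <;> simp
  have h0fin := ne_top_of_le_ne_top ENNReal.one_ne_top h0le
  set g : ℝ → ℝ := fun t => Real.exp (-(r * t)) * ((kerPow B 0 x y).toReal + t * (B x y).toReal)
  have e : ∀ t : ℝ, 0 ≤ t → (shortStep r B t.toNNReal x y).toReal = g t := by
    intro t ht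
    unfold shortStep
    rw [ENNReal.toReal_mul, ENNReal.toReal_add h0fin (ENNReal.mul_ne_top ENNReal.coe_ne_top hBfin),
      ENNReal.toReal_mul, ENNReal.toReal_ofReal (Real.exp_pos _).le, ENNReal.coe_toReal,
      Real.coe_toNNReal t ht]
  have hlow : ∀ t : ℝ, 0 ≤ t → g t ≤ (semigroup r B t.toNNReal x y).toReal := by
    intro t ht
    have h := ENNReal.toReal_mono (ne_top_of_le_ne_top ENNReal.one_ne_top
      (semigroup_le_one hr hB t.toNNReal x y)) (shortStep_le (r := r) (B := B) t.toNNReal x y)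
    rwa [e t ht] at h
  have hup : ∀ t : ℝ, 0 ≤ t → (semigroup r B t.toNNReal x y).toReal ≤
      g t + (1 - Real.exp (-(r * t)) * (1 + r * t)) := by
    intro t ht
    have h := add_tsum_le_add_tsum (fun z => shortStep_le (r := r) (B := B) t.toNNReal x z) y
    rw [tsum_shortStep hr hB, tsum_semigroup hr hB] at h
    have h' := ENNReal.toReal_mono
      (ENNReal.add_ne_top.2 ⟨ne_top_of_le_ne_top ENNReal.one_ne_top
        ((shortStep_le _ _ _).trans (semigroup_le_one hr hB _ _ _)), ENNReal.one_ne_top⟩) h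
    rw [ENNReal.toReal_add (ne_top_of_le_ne_top ENNReal.one_ne_top (semigroup_le_one hr hB _ _ _))
      ENNReal.ofReal_ne_top, ENNReal.toReal_add (ne_top_of_le_ne_top ENNReal.one_ne_top
        ((shortStep_le _ _ _).trans (semigroup_le_one hr hB _ _ _))) ENNReal.one_ne_top, e t ht,
      Real.coe_toNNReal t ht, ENNReal.toReal_ofReal (by positivity), ENNReal.toReal_one] at h'
    linarith
  have hexp : HasDerivAt (fun t : ℝ => Real.exp (-(r * t))) (-r) 0 := by
    have h := (((hasDerivAt_id (0 : ℝ)).const_mul r).neg).exp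
    simpa using h
  have hg : HasDerivAt g ((B x y).toReal - r * (kerPow B 0 x y).toReal) 0 := by
    have h := hexp.mul (((hasDerivAt_id (0 : ℝ)).mul_const (B x y).toReal).const_add
      (kerPow B 0 x y).toReal)
    convert! h using 1
    simp
    ring
  have hd : HasDerivAt (fun t => 1 - Real.exp (-(r * t)) * (1 + r * t)) 0 0 := by
    have h := (hexp.mul (((hasDerivAt_id (0 : ℝ)).const_mul r).const_add 1)).const_sub 1
    convert! h using 1
    simp
  have hdiff : HasDerivWithinAt (fun t : ℝ => (semigroup r B t.toNNReal x y).toReal - g t) 0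
      (Set.Ici 0) 0 := by
    have hd' := hd.hasDerivWithinAt (s := Set.Ici 0)
    rw [hasDerivWithinAt_iff_isLittleO] at hd' ⊢
    refine Asymptotics.IsBigO.trans_isLittleO (Asymptotics.IsBigO.of_bound 1 ?_) hd'
    filter_upwards [self_mem_nhdsWithin] with t ht
    have h0 : (semigroup r B (0 : ℝ).toNNReal x y).toReal - g 0 = 0 := by
      simp [g, semigroup_zero]
    rw [h0]
    simp only [smul_zero, sub_zero, mul_zero, neg_zero, Real.exp_zero, add_zero, mul_one, sub_self,
      one_mul, Real.norm_eq_abs]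
    rw [abs_of_nonneg (sub_nonneg.2 (hlow t ht)), abs_of_nonneg]
    · linarith [hup t ht]
    · linarith [hup t ht, hlow t ht]
  have h := hg.hasDerivWithinAt (s := Set.Ici 0) |>.add hdiff
  rw [add_zero] at h
  refine h.congr_of_mem (fun t _ => ?_) Set.self_mem_Ici
  simp

end Semigroup

/-! ### The rings of a single clock -/

section SingleClock

/-- The sequence with first term `x`, followed by the sequence `w`. -/
def consSeq (x : ℝ) (w : ℕ → ℝ) : ℕ → ℝ
  | 0 => x
  | n + 1 => w n

theorem measurable_consSeq : Measurable fun p : ℝ × (ℕ → ℝ) => consSeq p.1 p.2 := by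
  refine measurable_pi_iff.2 fun n => ?_
  cases n with
  | zero => exact measurable_fst
  | succ n => exact (measurable_pi_apply n).comp measurable_snd

/-- Checked on boxes. It allows conditioning on the first waiting time, with the remaining ones
again independent and identically distributed. -/
theorem infinitePi_eq_map_consSeq (m : Measure ℝ) [IsProbabilityMeasure m] :
    Measure.infinitePi (fun _ : ℕ => m) =
      (m.prod (Measure.infinitePi fun _ : ℕ => m)).map fun p => consSeq p.1 p.2 := by
  classical
  refine (Measure.eq_infinitePi _ fun s t ht => ?_).symm
  obtain ⟨N, hN⟩ := s.exists_nat_subset_range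
  -- Unconstrained coordinates are filled with `Set.univ`, so that the box is indexed by an initial
  -- segment and splits off coordinate `0`.
  set t' : ℕ → Set ℝ := fun i => if i ∈ s then t i else Set.univ with ht'
  have hmt' : ∀ i, MeasurableSet (t' i) := by
    intro i
    simp only [ht']
    split_ifs
    · exact ht i
    · exact MeasurableSet.univ
  have hbox : Set.pi s t = Set.pi (Finset.range (N + 1)) t' := by
    ext w
    simp only [Set.mem_pi, Finset.mem_coe, ht']
    constructor
    · intro h i _
      split_ifs with hi
      · exact h i hi
      · exact Set.mem_univ _
    · intro h i hi
      have := h i (Finset.range_mono (Nat.le_succ N) (hN hi))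
      rwa [if_pos hi] at this
  have hprod : ∏ i ∈ s, m (t i) = ∏ i ∈ Finset.range (N + 1), m (t' i) := by
    rw [← Finset.prod_subset (hN.trans (Finset.range_mono (Nat.le_succ N)))]
    · exact Finset.prod_congr rfl fun i hi => by simp [ht', hi]
    · intro i _ hi
      simp [ht', hi]
  have hpre : (fun p : ℝ × (ℕ → ℝ) => consSeq p.1 p.2) ⁻¹' Set.pi (Finset.range (N + 1)) t' =
      t' 0 ×ˢ Set.pi (Finset.range N) fun i => t' (i + 1) := by
    ext p
    simp only [Set.mem_preimage, Set.mem_pi, Finset.mem_coe, Finset.mem_range, Set.mem_prod]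
    constructor
    · intro h
      exact ⟨h 0 (Nat.succ_pos N), fun i hi => h (i + 1) (Nat.succ_lt_succ hi)⟩
    · rintro ⟨h0, h⟩ i hi
      cases i with
      | zero => exact h0
      | succ i => exact h i (Nat.lt_of_succ_lt_succ hi)
  rw [hbox, hprod, Measure.map_apply measurable_consSeq
    (MeasurableSet.pi (Finset.countable_toSet _) fun i _ => hmt' i), hpre, Measure.prod_prod,
    Measure.infinitePi_pi _ fun i _ => hmt' _, Finset.prod_range_succ', mul_comm]

/-- The pairs `(s, w)` such that, of the times `s + w 0, s + w 0 + w 1, …`, exactly one is in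
`(u j, u (j + 1)]` if `ε j` and none if not, for all `i ≤ j < i + n` (where `s ≤ u i`). -/
def ringSet (u : ℕ → ℝ) (ε : ℕ → Prop) : ℕ → ℕ → Set (ℝ × (ℕ → ℝ))
  | 0, i => {p | u i < p.1 + p.2 0}
  | n + 1, i => {p | (ε i ∧ p.1 + p.2 0 ∈ Set.Ioc (u i) (u (i + 1)) ∧
      (p.1 + p.2 0, fun m => p.2 (m + 1)) ∈ ringSet u ε n (i + 1)) ∨
      (¬ ε i ∧ p ∈ ringSet u ε n (i + 1))}

theorem measurableSet_ringSet (u : ℕ → ℝ) (ε : ℕ → Prop) (n i : ℕ) :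
    MeasurableSet (ringSet u ε n i) := by
  have hs : Measurable fun p : ℝ × (ℕ → ℝ) => p.1 + p.2 0 :=
    measurable_fst.add ((measurable_pi_apply 0).comp measurable_snd)
  induction n generalizing i with
  | zero => exact measurableSet_lt measurable_const hs
  | succ n ih =>
    have hm : Measurable fun p : ℝ × (ℕ → ℝ) => (p.1 + p.2 0, fun m => p.2 (m + 1)) :=
      hs.prodMk (measurable_pi_iff.2 fun m => (measurable_pi_apply (m + 1)).comp measurable_snd)
    exact ((MeasurableSet.const _).inter ((hs measurableSet_Ioc).inter (hm (ih (i + 1))))).union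
      ((MeasurableSet.const _).inter (ih (i + 1)))

theorem expMeasure_Ioi {r a : ℝ} (hr : 0 < r) (ha : 0 ≤ a) :
    expMeasure r (Set.Ioi a) = ENNReal.ofReal (Real.exp (-(r * a))) := by
  have := isProbabilityMeasure_expMeasure hr
  have h : expMeasure r (Set.Iic a) = ENNReal.ofReal (1 - Real.exp (-(r * a))) := by
    have h1 := lintegral_exponentialPDF_eq_antiDeriv hr a
    rw [if_pos ha] at h1
    rw [← h1]
    exact withDensity_apply _ measurableSet_Iic
  rw [← Set.compl_Iic, prob_compl_eq_one_sub measurableSet_Iic, h, ← ENNReal.ofReal_one,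
    ← ENNReal.ofReal_sub _ (sub_nonneg.2 (Real.exp_le_one_iff.2 (by nlinarith))), sub_sub_cancel]

/-- The exponential density cancels the `x`-dependence of the integrand, so only the length of the
interval remains. -/
theorem setLIntegral_expMeasure {r a b v : ℝ} (hr : 0 < r) (ha : 0 ≤ a) :
    ∫⁻ x in Set.Ioc a b, ENNReal.ofReal (Real.exp (-(r * (v - x)))) ∂expMeasure r =
      ENNReal.ofReal (Real.exp (-(r * v))) * ENNReal.ofReal (r * (b - a)) := by
  have hm : Measurable (exponentialPDF r) := (measurable_exponentialPDFReal r).ennreal_ofReal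
  change ∫⁻ x in Set.Ioc a b, _ ∂(volume.withDensity (exponentialPDF r)) = _
  rw [setLIntegral_withDensity_eq_setLIntegral_mul _ hm (by fun_prop) measurableSet_Ioc]
  have h : ∀ x ∈ Set.Ioc a b, (exponentialPDF r * fun x =>
      ENNReal.ofReal (Real.exp (-(r * (v - x))))) x = ENNReal.ofReal (r * Real.exp (-(r * v))) := by
    intro x hx
    rw [Pi.mul_apply, exponentialPDF_of_nonneg (ha.trans hx.1.le),
      ← ENNReal.ofReal_mul (by positivity), mul_assoc, ← Real.exp_add]
    congr 3
    ring
  rw [setLIntegral_congr_fun measurableSet_Ioc h, setLIntegral_const, Real.volume_Ioc,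
    mul_comm r (Real.exp _), ENNReal.ofReal_mul (Real.exp_pos _).le, mul_assoc,
    ENNReal.ofReal_mul hr.le]

open Classical in
-- The independence of Poisson increments, by induction on the number of intervals. If a ring is
-- required in the first interval, condition on its time and restart there; the exponentials
-- telescope. If none is required, the same start `s` is kept for the next interval.
theorem measure_ringSet {r : ℝ} (hr : 0 < r) {u : ℕ → ℝ} (hu : Monotone u) (ε : ℕ → Prop)
    (n i : ℕ) (s : ℝ) (hs : s ≤ u i) :
    Measure.infinitePi (fun _ : ℕ => expMeasure r) {w | (s, w) ∈ ringSet u ε n i} =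
      ENNReal.ofReal (Real.exp (-(r * (u (i + n) - s)))) *
        ∏ j ∈ Finset.range n, if ε (i + j) then
          ENNReal.ofReal (r * (u (i + j + 1) - u (i + j))) else 1 := by
  have := isProbabilityMeasure_expMeasure hr
  have hmk : ∀ s : ℝ, Measurable fun w : ℕ → ℝ => (s, w) := fun s => measurable_prodMk_left
  induction n generalizing i s with
  | zero =>
    have h : {w : ℕ → ℝ | (s, w) ∈ ringSet u ε 0 i} = (fun w => w 0) ⁻¹' Set.Ioi (u i - s) := by
      ext w
      simp only [ringSet, Set.mem_ofPred_eq, Set.mem_preimage, Set.mem_Ioi]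
      constructor <;> intro h <;> linarith
    rw [h, ← Measure.map_apply (measurable_pi_apply 0) measurableSet_Ioi,
      Measure.infinitePi_map_eval, expMeasure_Ioi hr (sub_nonneg.2 hs)]
    simp
  | succ n ih =>
    rw [Finset.prod_range_succ']
    rw [show i + (n + 1) = i + 1 + n by ring, add_zero,
      Finset.prod_congr rfl fun j _ => by rw [show i + (j + 1) = i + 1 + j by ring]]
    set C := ∏ j ∈ Finset.range n, if ε (i + 1 + j) then
          ENNReal.ofReal (r * (u (i + 1 + j + 1) - u (i + 1 + j))) else 1
    by_cases hε : ε i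
    · have hset : MeasurableSet {w : ℕ → ℝ | (s, w) ∈ ringSet u ε (n + 1) i} :=
        hmk s (measurableSet_ringSet u ε (n + 1) i)
      rw [infinitePi_eq_map_consSeq, Measure.map_apply measurable_consSeq hset,
        Measure.prod_apply (measurable_consSeq hset)]
      have hsec : ∀ x, Measure.infinitePi (fun _ : ℕ => expMeasure r) (Prod.mk x ⁻¹'
          ((fun p : ℝ × (ℕ → ℝ) => consSeq p.1 p.2) ⁻¹'
            {w | (s, w) ∈ ringSet u ε (n + 1) i})) =
          (Set.Ioc (u i - s) (u (i + 1) - s)).indicator (fun x =>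
            ENNReal.ofReal (Real.exp (-(r * ((u (i + 1 + n) - s) - x)))) * C) x := by
        intro x
        by_cases hx : x ∈ Set.Ioc (u i - s) (u (i + 1) - s)
        · rw [Set.indicator_of_mem hx, sub_sub, ← ih (i + 1) (s + x) (by linarith [hx.2])]
          congr 1
          ext w
          have hx' : s + x ∈ Set.Ioc (u i) (u (i + 1)) := ⟨by linarith [hx.1], by linarith [hx.2]⟩
          simp only [ringSet, Set.mem_preimage, Set.mem_ofPred_eq, hε, not_true, false_and, or_false,
            true_and, consSeq, hx']
        · rw [Set.indicator_of_notMem hx, ← measure_empty (μ := Measure.infinitePi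
            (fun _ : ℕ => expMeasure r))]
          congr 1
          ext w
          have hx' : s + x ∉ Set.Ioc (u i) (u (i + 1)) := fun h =>
            hx ⟨by linarith [h.1], by linarith [h.2]⟩
          simp only [ringSet, Set.mem_preimage, Set.mem_ofPred_eq, hε, not_true, false_and, or_false,
            true_and, consSeq, hx', Set.mem_empty_iff_false]
      simp_rw [hsec]
      rw [lintegral_indicator measurableSet_Ioc, lintegral_mul_const _ (by fun_prop),
        setLIntegral_expMeasure hr (sub_nonneg.2 hs), if_pos hε, sub_sub_sub_cancel_right]
      ring
    · have h : {w : ℕ → ℝ | (s, w) ∈ ringSet u ε (n + 1) i} =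
          {w | (s, w) ∈ ringSet u ε n (i + 1)} := by
        ext w
        simp only [ringSet, Set.mem_ofPred_eq, hε, false_and, false_or, not_false_eq_true, true_and]
      rw [h, ih (i + 1) s (hs.trans (hu (Nat.le_succ i))), if_neg hε, mul_one]

theorem lt_of_mem_ringSet {u : ℕ → ℝ} (hu : Monotone u) {ε : ℕ → Prop} {n i : ℕ} {s : ℝ}
    {w : ℕ → ℝ} (h : (s, w) ∈ ringSet u ε n i) : u i < s + w 0 := by
  induction n generalizing i with
  | zero => exact h
  | succ n ih =>
    rcases h with ⟨-, h, -⟩ | ⟨-, h⟩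
    · exact h.1
    · exact (hu (Nat.le_succ i)).trans_lt (ih h)

theorem le_ringTime {w : ℕ → ℝ} (hw : ∀ m, 0 ≤ w m) (m : ℕ) : w 0 ≤ ringTime w m := by
  unfold ringTime
  exact Finset.single_le_sum (f := w) (fun i _ => hw i) (Finset.mem_range.2 (Nat.succ_pos m))

theorem ringTime_succ (w : ℕ → ℝ) (m : ℕ) :
    ringTime w (m + 1) = w 0 + ringTime (fun i => w (i + 1)) m := by
  unfold ringTime
  rw [Finset.sum_range_succ', add_comm]

theorem ringTime_zero (w : ℕ → ℝ) : ringTime w 0 = w 0 := by simp [ringTime]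

theorem not_ring_of_mem_ringSet {u : ℕ → ℝ} (hu : Monotone u) {ε : ℕ → Prop} {n i : ℕ} {s : ℝ}
    {w : ℕ → ℝ} (hw : ∀ m, 0 ≤ w m) (h : (s, w) ∈ ringSet u ε n i) {j : ℕ} (hij : i ≤ j)
    (hj : j < i + n) (hε : ¬ ε j) (m : ℕ) : s + ringTime w m ∉ Set.Ioc (u j) (u (j + 1)) := by
  induction n generalizing i s w m with
  | zero => omega
  | succ n ih =>
    rcases h with ⟨hi, h1, h2⟩ | ⟨hi, h⟩
    · have hlt : i + 1 ≤ j := by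
        rcases hij.eq_or_lt with rfl | h
        · exact absurd hi hε
        · exact h
      cases m with
      | zero =>
        intro h
        have := hu hlt
        rw [ringTime_zero] at h
        exact absurd h.1 (not_lt.2 (h1.2.trans this))
      | succ m =>
        rw [ringTime_succ, ← add_assoc]
        exact ih (fun m => hw _) h2 hlt (by omega) m
    · rcases hij.eq_or_lt with rfl | hlt
      · intro h'
        have h1 := lt_of_mem_ringSet hu h
        have h2 := le_ringTime hw m
        linarith [h'.2]
      · exact ih hw h hlt (by omega) m

theorem ring_of_mem_ringSet {u : ℕ → ℝ} (hu : Monotone u) {ε : ℕ → Prop} {n i : ℕ} {s : ℝ}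
    {w : ℕ → ℝ} (hw : ∀ m, 0 ≤ w m) (h : (s, w) ∈ ringSet u ε n i) {j : ℕ} (hij : i ≤ j)
    (hj : j < i + n) (hε : ε j) :
    ∃ m, s + ringTime w m ∈ Set.Ioc (u j) (u (j + 1)) ∧
      ∀ m', s + ringTime w m' ∈ Set.Ioc (u j) (u (j + 1)) → m' = m := by
  induction n generalizing i s w with
  | zero => omega
  | succ n ih =>
    rcases h with ⟨hi, h1, h2⟩ | ⟨hi, h⟩
    · rcases hij.eq_or_lt with rfl | hlt
      · refine ⟨0, by rwa [ringTime_zero], fun m' hm' => ?_⟩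
        cases m' with
        | zero => rfl
        | succ m' =>
          exfalso
          have h3 := lt_of_mem_ringSet hu h2
          have h4 := le_ringTime (w := fun i => w (i + 1)) (fun m => hw _) m'
          rw [ringTime_succ] at hm'
          simp only at h3 h4
          linarith [hm'.2]
      · obtain ⟨m, hm, huniq⟩ := ih (fun m => hw _) h2 hlt (by omega)
        refine ⟨m + 1, by rwa [ringTime_succ, ← add_assoc], fun m' hm' => ?_⟩
        cases m' with
        | zero =>
          exfalso
          have := hu (show i + 1 ≤ j from hlt)
          rw [ringTime_zero] at hm'
          linarith [hm'.1, h1.2]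
        | succ m' =>
          rw [ringTime_succ, ← add_assoc] at hm'
          rw [huniq m' hm']
    · rcases hij.eq_or_lt with rfl | hlt
      · exact absurd hε hi
      · exact ih hw h hlt (by omega)

end SingleClock

/-! ### Lower bounds for the finite-dimensional distributions of the particle model -/

/-- Gives disjointness of the events of different ring patterns, so that their probabilities may be
added. -/
theorem iff_of_mem_ringSet {u : ℕ → ℝ} (hu : Monotone u) {ε ε' : ℕ → Prop} {n i : ℕ} {s : ℝ}
    {w : ℕ → ℝ} (h : (s, w) ∈ ringSet u ε n i) (h' : (s, w) ∈ ringSet u ε' n i) {j : ℕ}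
    (hij : i ≤ j) (hj : j < i + n) : ε j ↔ ε' j := by
  induction n generalizing i s w with
  | zero => omega
  | succ n ih =>
    rcases h with ⟨hi, h1, h2⟩ | ⟨hi, h⟩ <;> rcases h' with ⟨hi', h1', h2'⟩ | ⟨hi', h'⟩
    · rcases hij.eq_or_lt with rfl | hlt
      · exact iff_of_true hi hi'
      · exact ih h2 h2' hlt (by omega)
    · exact absurd h1.2 (not_le.2 (lt_of_mem_ringSet hu h'))
    · exact absurd h1'.2 (not_le.2 (lt_of_mem_ringSet hu h))
    · rcases hij.eq_or_lt with rfl | hlt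
      · exact iff_of_false hi hi'
      · exact ih h h' hlt (by omega)

/-- The configuration after the clock `c` has rung, or no clock at all. -/
noncomputable def GT.ringOption (x : GT k) : Option (Clock k) → GT k
  | none => x
  | some c => x.ring c

/-- The probability that in a time interval of length `h` a given clock rings once and no other
clock rings, or that no clock rings. -/
noncomputable def ringProb (q : ℕ → ℝ) (h : ℝ≥0) (o : Option (Clock k)) : ℝ≥0∞ :=
  ENNReal.ofReal (Real.exp (-(totalRate k q * h))) *
    o.elim 1 fun c => ENNReal.ofReal (rate q c * h)

open Classical in
-- Splits the short step according to the single clock that rings, or to none, which identifies it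
-- with ring probabilities.
theorem shortStep_flow {q : ℕ → ℝ} (h : ℝ≥0) (x y : GT k)
    (hq : ∀ i, 1 ≤ i → i ≤ (k + 1) / 2 → 0 < q i) :
    shortStep (totalRate k q) (flow q) h x y =
      ∑ o ∈ Finset.univ.filter fun o => x.ringOption o = y, ringProb q h o := by
  rw [Finset.sum_filter, Fintype.sum_option]
  unfold shortStep flow ringProb
  have hr : ∀ c, x.ringOption (some c) = x.ring c := fun _ => rfl
  have hn : x.ringOption none = x := rfl
  simp only [hr, hn, Option.elim, kerPow]
  rw [mul_add, Finset.mul_sum, Finset.mul_sum]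
  congr 1
  · by_cases h' : x = y <;> simp [h']
  · refine Finset.sum_congr rfl fun c _ => ?_
    by_cases h' : x.ring c = y
    · rw [if_pos h', if_pos h', ENNReal.ofReal_mul (rate_pos hq c).le, ENNReal.ofReal_coe_nnreal,
        mul_comm (h : ℝ≥0∞)]
    · rw [if_neg h', if_neg h', mul_zero, mul_zero]

/-- With a single ring at `T`, the path is constant from `s` to times just before `T`, makes the
attempted jump at `T`, and is constant from `T` to `t`. -/
theorem FollowsRules.eq_ring {w : Clock k → ℕ → ℝ} {y : ℝ≥0 → GT k} (hf : FollowsRules w y)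
    {s t : ℝ≥0} {c : Clock k} {n : ℕ} (hmem : ringTime (w c) n ∈ Set.Ioc (s : ℝ) t)
    (huniq : ∀ c' n', ringTime (w c') n' ∈ Set.Ioc (s : ℝ) t → c' = c ∧ n' = n) :
    y t = (y s).ring c := by
  obtain ⟨T, hT⟩ : ∃ T : ℝ≥0, ringTime (w c) n = T :=
    ⟨⟨_, s.coe_nonneg.trans hmem.1.le⟩, rfl⟩
  rw [hT] at hmem
  have hsT : s < T := NNReal.coe_lt_coe.1 hmem.1
  have hTt : T ≤ t := NNReal.coe_le_coe.1 hmem.2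
  have hjump := hf.jump T c n hT
  have : (𝓝[<] T).NeBot := nhdsLT_neBot_of_exists_lt ⟨s, hsT⟩
  obtain ⟨v, hv, hvs⟩ := (hjump.and (Ico_mem_nhdsLT hsT)).exists
  have h1 : y v = y s := hf.stay s v hvs.1 fun c' n' h => by
    have hvT : (v : ℝ) < T := NNReal.coe_lt_coe.2 hvs.2
    obtain ⟨rfl, rfl⟩ := huniq c' n' ⟨h.1, h.2.trans (hvT.le.trans hmem.2)⟩
    linarith [h.2]
  have h2 : y t = y T := hf.stay T t hTt fun c' n' h => by
    obtain ⟨rfl, rfl⟩ := huniq c' n' ⟨hmem.1.trans h.1, h.2⟩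
    linarith [h.1]
  rw [h2, hv, h1]

/-- The waiting times for which, for all `j < n`, the clock `a j` (if any) rings once in
`(u j, u (j + 1)]` and the other clocks do not ring. -/
def ringEvent (u : ℕ → ℝ≥0) (a : ℕ → Option (Clock k)) (n : ℕ) : Set (Clock k → ℕ → ℝ) :=
  Set.pi (Finset.univ : Finset (Clock k))
    fun c => {w | ((0 : ℝ), w) ∈ ringSet (fun j => (u j : ℝ)) (fun j => a j = some c) n 0}

theorem measurableSet_ringEvent (u : ℕ → ℝ≥0) (a : ℕ → Option (Clock k)) (n : ℕ) :
    MeasurableSet (ringEvent u a n) :=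
  MeasurableSet.pi (Finset.countable_toSet _) fun _ _ =>
    measurable_prodMk_left (measurableSet_ringSet _ _ _ _)

theorem eq_of_mem_ringEvent {u : ℕ → ℝ≥0} (hu : Monotone u) {a b : ℕ → Option (Clock k)} {n : ℕ}
    {w : Clock k → ℕ → ℝ} (ha : w ∈ ringEvent u a n) (hb : w ∈ ringEvent u b n) {j : ℕ}
    (hj : j < n) : a j = b j := by
  have h : ∀ c, a j = some c ↔ b j = some c := fun c =>
    iff_of_mem_ringSet (fun _ _ hij => NNReal.coe_le_coe.2 (hu hij))
      (ha c (Finset.mem_coe.2 (Finset.mem_univ c))) (hb c (Finset.mem_coe.2 (Finset.mem_univ c)))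
      (Nat.zero_le j) (by omega)
  exact Option.ext h

theorem FollowsRules.eq_of_mem_ringEvent {w : Clock k → ℕ → ℝ} {y : ℝ≥0 → GT k}
    (hf : FollowsRules w y) (hw : ∀ c m, 0 ≤ w c m) {u : ℕ → ℝ≥0} (hu : Monotone u)
    {a : ℕ → Option (Clock k)} {n : ℕ} (ha : w ∈ ringEvent u a n) {j : ℕ} (hj : j < n) :
    y (u (j + 1)) = (y (u j)).ringOption (a j) := by
  have hu' : Monotone fun j => (u j : ℝ) := fun _ _ hij => NNReal.coe_le_coe.2 (hu hij)
  have hmem := fun c => ha c (Finset.mem_coe.2 (Finset.mem_univ c))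
  have hno : ∀ c m, a j ≠ some c → ringTime (w c) m ∉ Set.Ioc (u j : ℝ) (u (j + 1)) := by
    intro c m hc
    have h := not_ring_of_mem_ringSet hu' (hw c) (hmem c) (Nat.zero_le j) (by omega) hc m
    rwa [zero_add] at h
  cases haj : a j with
  | none => exact hf.stay _ _ (hu (Nat.le_succ j)) fun c m h => hno c m (by simp [haj]) h
  | some c =>
    obtain ⟨m, hm, huniq⟩ := ring_of_mem_ringSet hu' (hw c) (hmem c) (Nat.zero_le j) (by omega) haj
    simp only [zero_add] at hm huniq
    refine hf.eq_ring hm fun c' m' h' => ?_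
    have hc : c' = c := by
      by_contra hne
      exact hno c' m' (by rw [haj]; exact fun h => hne (Option.some.inj h).symm) h'
    subst hc
    exact ⟨rfl, huniq m' h'⟩

/-- Independence of the clocks gives a product over clocks of products over intervals. After
exchanging them, the exponents add up to the total rate in each interval, and only the prescribed
clock leaves a further factor. -/
theorem measure_ringEvent {q : ℕ → ℝ} (hq : ∀ i, 1 ≤ i → i ≤ (k + 1) / 2 → 0 < q i)
    {u : ℕ → ℝ≥0} (hu : Monotone u) (h0 : u 0 = 0) (a : ℕ → Option (Clock k)) (n : ℕ) :
    Measure.infinitePi (fun c : Clock k => Measure.infinitePi fun _ : ℕ => expMeasure (rate q c))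
      (ringEvent u a n) = ∏ j ∈ Finset.range n, ringProb q (u (j + 1) - u j) (a j) := by
  classical
  have := fun c : Clock k => isProbabilityMeasure_expMeasure (rate_pos hq c)
  have hu' : Monotone fun j => (u j : ℝ) := fun _ _ hij => NNReal.coe_le_coe.2 (hu hij)
  have hcoe : ∀ j, ((u (j + 1) - u j : ℝ≥0) : ℝ) = u (j + 1) - u j := fun j =>
    NNReal.coe_sub (hu (Nat.le_succ j))
  have hexp : ∀ r : ℝ, Real.exp (-(r * u n)) =
      ∏ j ∈ Finset.range n, Real.exp (-(r * (u (j + 1) - u j : ℝ≥0))) := by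
    intro r
    rw [← Real.exp_sum, Finset.sum_neg_distrib, ← Finset.mul_sum]
    simp_rw [hcoe]
    rw [Finset.sum_range_sub (fun j => (u j : ℝ)), h0, NNReal.coe_zero, sub_zero]
  unfold ringEvent
  rw [Measure.infinitePi_pi _ fun c _ => show MeasurableSet {w : ℕ → ℝ | _} from
    measurable_prodMk_left (measurableSet_ringSet _ _ _ _)]
  have h1 : ∀ c : Clock k, Measure.infinitePi (fun _ : ℕ => expMeasure (rate q c))
      {w | ((0 : ℝ), w) ∈ ringSet (fun j => (u j : ℝ)) (fun j => a j = some c) n 0} =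
      ENNReal.ofReal (Real.exp (-(rate q c * u n))) * ∏ j ∈ Finset.range n,
        if a j = some c then ENNReal.ofReal (rate q c * (u (j + 1) - u j : ℝ≥0)) else 1 := by
    intro c
    rw [measure_ringSet (rate_pos hq c) hu' _ n 0 0 (by simp)]
    simp only [zero_add, sub_zero, hcoe]
  rw [Finset.prod_congr rfl fun c _ => h1 c, Finset.prod_mul_distrib, Finset.prod_comm,
    ← ENNReal.ofReal_prod_of_nonneg fun c _ => (Real.exp_pos _).le, ← Real.exp_sum,
    Finset.sum_neg_distrib, ← Finset.sum_mul]
  change ENNReal.ofReal (Real.exp (-(totalRate k q * u n))) * _ = _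
  rw [hexp, ENNReal.ofReal_prod_of_nonneg fun c _ => (Real.exp_pos _).le,
    ← Finset.prod_mul_distrib]
  refine Finset.prod_congr rfl fun j _ => ?_
  unfold ringProb
  congr 1
  cases a j with
  | none => simp
  | some c => simp [Finset.prod_ite_eq]

variable {Ω : Type*} [MeasurableSpace Ω] {μ : Measure Ω}

theorem IsWallModel.map_waiting [IsProbabilityMeasure μ] {q : ℕ → ℝ}
    (hq : ∀ i, 1 ≤ i → i ≤ (k + 1) / 2 → 0 < q i)
    {τ : Clock k → ℕ → Ω → ℝ} {Y : ℝ≥0 → Ω → GT k} (hY : IsWallModel μ q τ Y) :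
    μ.map (fun ω c n => τ c n ω) =
      Measure.infinitePi fun c : Clock k => Measure.infinitePi fun _ : ℕ =>
        expMeasure (rate q c) := by
  have := fun c : Clock k => isProbabilityMeasure_expMeasure (rate_pos hq c)
  have h1 := hY.waiting_indep.map_fun_eq_infinitePi_map
    fun p : Clock k × ℕ => hY.waiting_measurable p.1 p.2
  have h2 := Measure.infinitePi_map_curry fun (c : Clock k) (_ : ℕ) => expMeasure (rate q c)
  rw [← h2, ← (show _ = Measure.infinitePi fun p : Clock k × ℕ => expMeasure (rate q p.1) from
    h1.trans (by simp_rw [hY.waiting_law])), Measure.map_map (by fun_prop)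
    (measurable_pi_iff.2 fun p : Clock k × ℕ => hY.waiting_measurable p.1 p.2)]
  rfl

theorem IsWallModel.ae_nonneg {q : ℕ → ℝ} {τ : Clock k → ℕ → Ω → ℝ} {Y : ℝ≥0 → Ω → GT k}
    (hY : IsWallModel μ q τ Y) : ∀ᵐ ω ∂μ, ∀ c m, 0 ≤ τ c m ω := by
  refine ae_all_iff.2 fun c => ae_all_iff.2 fun m => ?_
  refine ae_of_ae_map (p := fun x => 0 ≤ x) (hY.waiting_measurable c m).aemeasurable ?_
  rw [hY.waiting_law, ae_iff]
  have h : {x : ℝ | ¬ 0 ≤ x} = Set.Iio 0 := by ext x; simp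
  rw [h]
  change volume.withDensity (exponentialPDF (rate q c)) (Set.Iio 0) = 0
  rw [withDensity_apply _ measurableSet_Iio, lintegral_exponentialPDF_of_nonpos le_rfl]

/-- Expanding the product gives a sum over the choices, for each interval, of a clock or none
leading from `x j` to `x (j + 1)`. These ring events are disjoint and each forces the path through
the `x j`. Only a lower bound results, as intervals with several rings are ignored. -/
theorem IsWallModel.prod_shortStep_le [IsProbabilityMeasure μ] {q : ℕ → ℝ}
    (hq : ∀ i, 1 ≤ i → i ≤ (k + 1) / 2 → 0 < q i) {τ : Clock k → ℕ → Ω → ℝ}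
    {Y : ℝ≥0 → Ω → GT k} (hY : IsWallModel μ q τ Y) {u : ℕ → ℝ≥0} (hu : Monotone u)
    (h0 : u 0 = 0) (n : ℕ) (x : ℕ → GT k) (hx : x 0 = GT.zero k) :
    ∏ j ∈ Finset.range n, shortStep (totalRate k q) (flow q) (u (j + 1) - u j) (x j) (x (j + 1)) ≤
      μ {ω | ∀ j ≤ n, Y (u j) ω = x j} := by
  classical
  have hτ : Measurable fun ω c n => τ c n ω :=
    measurable_pi_iff.2 fun c => measurable_pi_iff.2 fun n => hY.waiting_measurable c n
  let ext : (Fin n → Option (Clock k)) → ℕ → Option (Clock k) :=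
    fun a j => if h : j < n then a ⟨j, h⟩ else none
  have hext : ∀ a (j : Fin n), ext a j = a j := fun a j => by simp [ext]
  let P := Fintype.piFinset fun j : Fin n =>
    Finset.univ.filter fun o => (x j).ringOption o = x (j + 1)
  have h1 : ∏ j ∈ Finset.range n,
      shortStep (totalRate k q) (flow q) (u (j + 1) - u j) (x j) (x (j + 1)) =
      ∑ a ∈ P, μ ((fun ω c n => τ c n ω) ⁻¹' ringEvent u (ext a) n) := by
    rw [Finset.prod_range]
    simp_rw [shortStep_flow _ _ _ hq]
    rw [Finset.prod_univ_sum]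
    refine Finset.sum_congr rfl fun a _ => ?_
    rw [← Measure.map_apply hτ (measurableSet_ringEvent _ _ _), hY.map_waiting hq,
      measure_ringEvent hq hu h0, Finset.prod_range]
    simp_rw [hext]
  rw [h1, ← measure_biUnion_finset]
  · refine measure_mono_ae ?_
    filter_upwards [hY.ae_nonneg, hY.follows] with ω hω hf hmem
    obtain ⟨a, haP, ha⟩ := Set.mem_iUnion₂.1 hmem
    change ∀ j ≤ n, Y (u j) ω = x j
    intro j hj
    induction j with
    | zero => rw [h0, hx]; exact hf.start
    | succ j ih =>
      have h := hf.eq_of_mem_ringEvent hω hu ha hj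
      have h' := (Finset.mem_filter.1 (Fintype.mem_piFinset.1 haP ⟨j, hj⟩)).2
      simp only at h h'
      rw [h, ih (by omega), ← h']
      congr 1
      exact hext a ⟨j, hj⟩
  · intro a _ b _ hab
    refine Set.disjoint_left.2 fun ω ha hb => hab (funext fun j => ?_)
    rw [← hext a, ← hext b]
    exact eq_of_mem_ringEvent hu ha hb j.2
  · exact fun a _ => hτ (measurableSet_ringEvent _ _ _)

/-! ### From short time steps to the semigroup -/

section PathSum

variable {E F : Type*}

theorem tendsto_tsum_shortStep_pow {r : ℝ} (hr : 0 ≤ r) (t : ℝ≥0) :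
    Tendsto (fun N : ℕ => ENNReal.ofReal
      (Real.exp (-(r * (t / N : ℝ≥0))) * (1 + r * (t / N : ℝ≥0))) ^ N) atTop (𝓝 1) := by
  have h1 := ENNReal.tendsto_ofReal
    ((Real.tendsto_one_add_div_pow_exp (r * t)).const_mul (Real.exp (-(r * t))))
  rw [← Real.exp_add, neg_add_cancel, Real.exp_zero, ENNReal.ofReal_one] at h1
  refine h1.congr' ?_
  filter_upwards [eventually_ge_atTop 1] with N hN
  have hN' : (N : ℝ) ≠ 0 := by positivity
  rw [← ENNReal.ofReal_pow (by positivity), mul_pow, ← Real.exp_nat_mul]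
  push_cast
  congr 3
  · field_simp
  · ring

/-- The powers are bounded above by the semigroup, and their total mass tends to `1`, the mass of
the semigroup. Hence the pointwise gap vanishes. -/
theorem tendsto_kerPow_shortStep {r : ℝ} {B : E → E → ℝ≥0∞} (hr : 0 ≤ r)
    (hB : ∀ x, ∑' y, B x y = ENNReal.ofReal r) (t : ℝ≥0) (x y : E) :
    Tendsto (fun N : ℕ => kerPow (shortStep r B (t / N)) N x y) atTop
      (𝓝 (semigroup r B t x y)) := by
  have hle : ∀ N : ℕ, 1 ≤ N → ∀ z, kerPow (shortStep r B (t / N)) N x z ≤ semigroup r B t x z := by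
    intro N hN z
    have hN' : (N : ℝ≥0) ≠ 0 := by positivity
    have h := kerPow_mono (fun x y => shortStep_le (r := r) (B := B) (t / N) x y) N x z
    rwa [kerPow_semigroup, mul_div_cancel₀ _ hN'] at h
  have hlim : Tendsto (fun N : ℕ => semigroup r B t x y + ENNReal.ofReal
      (Real.exp (-(r * (t / N : ℝ≥0))) * (1 + r * (t / N : ℝ≥0))) ^ N - 1) atTop
      (𝓝 (semigroup r B t x y)) := by
    have h := ENNReal.Tendsto.sub ((tendsto_tsum_shortStep_pow hr t).const_add (semigroup r B t x y))
      (tendsto_const_nhds (x := (1 : ℝ≥0∞))) (Or.inr ENNReal.one_ne_top)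
    rwa [ENNReal.add_sub_cancel_right ENNReal.one_ne_top] at h
  refine tendsto_of_tendsto_of_tendsto_of_le_of_le' hlim tendsto_const_nhds ?_ ?_
  · filter_upwards [eventually_ge_atTop 1] with N hN
    have h := add_tsum_le_add_tsum (hle N hN) y
    rw [tsum_kerPow (tsum_shortStep hr hB (t / N)), tsum_semigroup hr hB] at h
    exact tsub_le_iff_right.2 h
  · filter_upwards [eventually_ge_atTop 1] with N hN
    exact hle N hN y

/-- The sum, over the paths of length `n` that start in `x` at time `i` and are in `S j` at the
times `j > i`, of the products of their transition probabilities. -/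
noncomputable def pathSum (K : ℕ → E → E → ℝ≥0∞) (S : ℕ → Set E) : ℕ → ℕ → E → ℝ≥0∞
  | 0, _ => fun _ => 1
  | n + 1, i => fun x => ∑' y, K i x y * (S (i + 1)).indicator (pathSum K S n (i + 1)) y

/-- Lower bounds for single paths add up over disjoint events. The state at time `i + 1` is summed
over, and the prefix is extended by it. -/
theorem le_measure_of_pathSum {Ω : Type*} [MeasurableSpace Ω] {μ : Measure Ω} [MeasurableSpace E]
    [DiscreteMeasurableSpace E] {Y : ℕ → Ω → E} (hY : ∀ j, Measurable (Y j))
    {K : ℕ → E → E → ℝ≥0∞} {e : E}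
    (h : ∀ (n : ℕ) (x : ℕ → E), x 0 = e →
      ∏ j ∈ Finset.range n, K j (x j) (x (j + 1)) ≤ μ {ω | ∀ j ≤ n, Y j ω = x j})
    (S : ℕ → Set E) (n i : ℕ) (x : ℕ → E) (hx : x 0 = e) :
    (∏ j ∈ Finset.range i, K j (x j) (x (j + 1))) * pathSum K S n i (x i) ≤
      μ {ω | (∀ j ≤ i, Y j ω = x j) ∧ ∀ j, i < j → j ≤ i + n → Y j ω ∈ S j} := by
  classical
  induction n generalizing i x with
  | zero =>
    rw [pathSum, mul_one]
    exact (h i x hx).trans (measure_mono fun ω hω => ⟨hω, fun j h1 h2 => by omega⟩)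
  | succ n ih =>
    rw [pathSum, ← ENNReal.tsum_mul_left]
    set A : E → Set Ω := fun y => {ω | (∀ j ≤ i, Y j ω = x j) ∧ Y (i + 1) ω = y ∧
      ∀ j, i < j → j ≤ i + (n + 1) → Y j ω ∈ S j} with hA
    have hmA : ∀ y, MeasurableSet (A y) := by
      intro y
      have h1 : ∀ (j : ℕ) (s : Set E), MeasurableSet {ω | Y j ω ∈ s} := fun j s =>
        hY j (MeasurableSet.of_discrete (s := s))
      have h2 : A y = (⋂ (j) (_ : j ≤ i), {ω | Y j ω ∈ ({x j} : Set E)}) ∩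
          ({ω | Y (i + 1) ω ∈ ({y} : Set E)} ∩
            ⋂ (j) (_ : i < j) (_ : j ≤ i + (n + 1)), {ω | Y j ω ∈ S j}) := by
        ext ω
        simp [hA]
      rw [h2]
      exact (MeasurableSet.iInter fun j => MeasurableSet.iInter fun _ => h1 j _).inter
        ((h1 (i + 1) _).inter (MeasurableSet.iInter fun j => MeasurableSet.iInter fun _ =>
          MeasurableSet.iInter fun _ => h1 j _))
    have hdisj : Pairwise (Function.onFun Disjoint A) := fun y z hyz =>
      Set.disjoint_left.2 fun ω h1 h2 => hyz (h1.2.1.symm.trans h2.2.1)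
    have hle : ∀ y, (∏ j ∈ Finset.range i, K j (x j) (x (j + 1))) *
        (K i (x i) y * (S (i + 1)).indicator (pathSum K S n (i + 1)) y) ≤ μ (A y) := by
      intro y
      by_cases hy : y ∈ S (i + 1)
      · have h1 := ih (i + 1) (Function.update x (i + 1) y) (by simpa using hx)
        rw [Finset.prod_range_succ, Function.update_self, Function.update_of_ne (by omega),
          Finset.prod_congr rfl fun j hj => by
            rw [Function.update_of_ne (show j ≠ i + 1 by have := Finset.mem_range.1 hj; omega),
              Function.update_of_ne (show j + 1 ≠ i + 1 by have := Finset.mem_range.1 hj; omega)]]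
          at h1
        rw [Set.indicator_of_mem hy, ← mul_assoc]
        refine h1.trans (measure_mono fun ω hω => ?_)
        have hi := hω.1 (i + 1) le_rfl
        rw [Function.update_self] at hi
        refine ⟨fun j hj => ?_, hi, fun j h1 h2 => ?_⟩
        · rw [hω.1 j (by omega), Function.update_of_ne (by omega)]
        · rcases (Nat.succ_le_of_lt h1).eq_or_lt with rfl | h3
          · rw [Nat.succ_eq_add_one, hi]
            exact hy
          · exact hω.2 j h3 (by omega)
      · rw [Set.indicator_of_notMem hy]
        simp
    calc _ ≤ ∑' y, μ (A y) := ENNReal.tsum_le_tsum hle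
      _ ≤ μ (⋃ y, A y) := tsum_meas_le_meas_iUnion_of_disjoint μ hmA hdisj
      _ ≤ μ {ω | (∀ j ≤ i, Y j ω = x j) ∧ ∀ j, i < j → j ≤ i + (n + 1) → Y j ω ∈ S j} :=
        measure_mono (Set.iUnion_subset fun y ω hω => ⟨hω.1, hω.2.2⟩)

/-- Leaving `N` intermediate states free and prescribing the next one composes the kernel with
itself. -/
theorem pathSum_add {K : ℕ → E → E → ℝ≥0∞} {S : ℕ → Set E} {C : E → E → ℝ≥0∞} {y : E}
    (N n i : ℕ) (hK : ∀ l ≤ N, K (i + l) = C) (hS : ∀ l, 0 < l → l ≤ N → S (i + l) = Set.univ)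
    (hS' : S (i + N + 1) = {y}) (x : E) :
    pathSum K S (n + N + 1) i x = kerPow C (N + 1) x y * pathSum K S n (i + N + 1) y := by
  classical
  induction N generalizing i x with
  | zero =>
    rw [pathSum, kerPow_one]
    beta_reduce
    rw [tsum_eq_single y]
    · rw [show S (i + 1) = {y} from hS', Set.indicator_of_mem (Set.mem_singleton y),
        ← hK 0 le_rfl]
      rfl
    · intro z hz
      rw [show S (i + 1) = {y} from hS', Set.indicator_of_notMem (by simpa using hz), mul_zero]
  | succ N ih =>
    have h1 : ∀ z, pathSum K S (n + N + 1) (i + 1) z =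
        kerPow C (N + 1) z y * pathSum K S n (i + (N + 1) + 1) y := by
      intro z
      rw [ih (i + 1) (fun l hl => by rw [← hK (l + 1) (by omega)]; congr 1; ring)
        (fun l h1 h2 => by rw [← hS (l + 1) (by omega) (by omega)]; congr 1; ring)
        (by rw [← hS']; congr 1; ring)]
      congr 2
      ring
    rw [show n + (N + 1) + 1 = n + N + 1 + 1 by ring, pathSum, kerPow, ← ENNReal.tsum_mul_right]
    refine tsum_congr fun z => ?_
    rw [hS 1 one_pos (by omega), Set.indicator_univ, h1, ← mul_assoc, ← hK 0 (Nat.zero_le _)]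
    rfl

open Classical in
theorem pathSum_refinement (C : ℕ → E → E → ℝ≥0∞) (x : ℕ → E) (N n i : ℕ) :
    pathSum (fun j => C (j / (N + 1)))
      (fun j => if (N + 1) ∣ j then {x (j / (N + 1))} else Set.univ) (n * (N + 1)) (i * (N + 1))
      (x i) = ∏ l ∈ Finset.range n, kerPow (C (i + l)) (N + 1) (x (i + l)) (x (i + l + 1)) := by
  induction n generalizing i with
  | zero => simp [pathSum]
  | succ n ih =>
    have h1 : ∀ l ≤ N, (i * (N + 1) + l) / (N + 1) = i := by
      intro l hl
      rw [Nat.add_comm, Nat.add_mul_div_right _ _ (Nat.succ_pos N), Nat.div_eq_of_lt (by omega),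
        zero_add]
    have h2 : i * (N + 1) + N + 1 = (i + 1) * (N + 1) := by ring
    rw [show (n + 1) * (N + 1) = n * (N + 1) + N + 1 by ring,
      pathSum_add (C := C i) (y := x (i + 1)) N (n * (N + 1)) (i * (N + 1)), h2, ih,
      Finset.prod_range_succ', mul_comm]
    · congr 1
      refine Finset.prod_congr rfl fun l _ => ?_
      rw [show i + (l + 1) = i + 1 + l by ring]
    · intro l hl
      simp only [h1 l hl]
    · intro l hl hl'
      refine if_neg fun hdvd => ?_
      have := Nat.le_of_dvd hl ((Nat.dvd_add_right (Dvd.intro_left i rfl)).1 hdvd)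
      omega
    · rw [h2, if_pos (Dvd.intro_left _ rfl), Nat.mul_div_cancel _ (Nat.succ_pos N)]

/-! ### Intertwining -/

variable {π : E → F} {L : F → E → ℝ≥0∞}

/-- The intertwining moves `L` past one step at a time: after a step to the row `v (i + 1)` the
state has again the law `L (v (i + 1))`, up to the factor `Q`. -/
theorem tsum_link_mul_pathSum (hL : ∀ v, ∑' x, L v x = 1) (hπ : ∀ v x, π x ≠ v → L v x = 0)
    {K : ℕ → E → E → ℝ≥0∞} {Q : ℕ → F → F → ℝ≥0∞}
    (h : ∀ j v y, ∑' x, L v x * K j x y = Q j v (π y) * L (π y) y) (v : ℕ → F) (n i : ℕ) :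
    ∑' x, L (v i) x * pathSum K (fun j => {x | π x = v j}) n i x =
      ∏ l ∈ Finset.range n, Q (i + l) (v (i + l)) (v (i + l + 1)) := by
  induction n generalizing i with
  | zero => simp [pathSum, hL]
  | succ n ih =>
    set S : ℕ → Set E := fun j => {x | π x = v j} with hS
    have h1 : ∑' x, L (v i) x * pathSum K S (n + 1) i x =
        ∑' y, (∑' x, L (v i) x * K i x y) * (S (i + 1)).indicator (pathSum K S n (i + 1)) y := by
      simp_rw [pathSum, ← ENNReal.tsum_mul_left, ← ENNReal.tsum_mul_right]
      rw [ENNReal.tsum_comm]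
      simp_rw [mul_assoc]
    have h2 : ∀ y, (∑' x, L (v i) x * K i x y) *
        (S (i + 1)).indicator (pathSum K S n (i + 1)) y =
        Q i (v i) (v (i + 1)) * (L (v (i + 1)) y * pathSum K S n (i + 1) y) := by
      intro y
      by_cases hy : π y = v (i + 1)
      · rw [h, Set.indicator_of_mem (show y ∈ S (i + 1) from hy), hy, mul_assoc]
      · rw [Set.indicator_of_notMem (show y ∉ S (i + 1) from hy), hπ _ _ hy]
        simp
    rw [h1]
    simp_rw [h2]
    rw [ENNReal.tsum_mul_left, ih (i + 1), Finset.prod_range_succ', mul_comm]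
    congr 1
    refine Finset.prod_congr rfl fun l _ => ?_
    rw [show i + (l + 1) = i + 1 + l by ring]

variable {B : E → E → ℝ≥0∞} {C : F → F → ℝ≥0∞}

theorem tsum_link_mul_kerPow (hπ : ∀ v x, π x ≠ v → L v x = 0)
    (h : ∀ v y, ∑' x, L v x * B x y = C v (π y) * L (π y) y) (n : ℕ) (v : F) (y : E) :
    ∑' x, L v x * kerPow B n x y = kerPow C n v (π y) * L (π y) y := by
  classical
  induction n generalizing v with
  | zero =>
    rw [tsum_eq_single y fun x hx => by simp [kerPow, hx]]
    by_cases hv : π y = v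
    · simp [kerPow, hv]
    · rw [hπ v y hv]
      simp [kerPow, Ne.symm hv]
  | succ n ih =>
    have h1 : ∑' x, L v x * kerPow B (n + 1) x y =
        ∑' z, (∑' x, L v x * B x z) * kerPow B n z y := by
      simp_rw [kerPow, ← ENNReal.tsum_mul_left, ← ENNReal.tsum_mul_right]
      rw [ENNReal.tsum_comm]
      simp_rw [mul_assoc]
    have h2 : ∀ z, (∑' x, L v x * B x z) * kerPow B n z y =
        ∑' w, C v w * (L w z * kerPow B n z y) := by
      intro z
      rw [h, tsum_eq_single (π z) fun w hw => by rw [hπ w z hw.symm]; simp, mul_assoc]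
    rw [h1]
    simp_rw [h2]
    rw [ENNReal.tsum_comm]
    simp_rw [ENNReal.tsum_mul_left, ih, ← mul_assoc]
    rw [ENNReal.tsum_mul_right]
    rfl

theorem tsum_link_mul_semigroup (hπ : ∀ v x, π x ≠ v → L v x = 0)
    (h : ∀ v y, ∑' x, L v x * B x y = C v (π y) * L (π y) y) (r : ℝ) (t : ℝ≥0) (v : F) (y : E) :
    ∑' x, L v x * semigroup r B t x y = semigroup r C t v (π y) * L (π y) y := by
  simp_rw [semigroup, ← ENNReal.tsum_mul_left, ← ENNReal.tsum_mul_right]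
  rw [ENNReal.tsum_comm]
  refine tsum_congr fun n => ?_
  simp_rw [mul_left_comm (L v _)]
  rw [ENNReal.tsum_mul_left, tsum_link_mul_kerPow hπ h, mul_assoc]

/-! ### Finite-dimensional distributions from lower bounds -/

/-- Given equality up to time `n`, the lower bounds over all values at time `n + 1` already sum to
the whole probability, so each must be an equality. -/
theorem measure_eq_prod_of_le {Ω : Type*} [MeasurableSpace Ω] {μ : Measure Ω}
    [IsProbabilityMeasure μ] [MeasurableSpace F] [DiscreteMeasurableSpace F] {Z : ℕ → Ω → F}
    (hZ : ∀ j, Measurable (Z j)) {Q : ℕ → F → F → ℝ≥0∞} (hQ : ∀ j v, ∑' w, Q j v w = 1) {e : F}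
    (h : ∀ (n : ℕ) (v : ℕ → F), v 0 = e →
      ∏ j ∈ Finset.range n, Q j (v j) (v (j + 1)) ≤ μ {ω | ∀ j ≤ n, Z j ω = v j})
    (n : ℕ) (v : ℕ → F) (hv : v 0 = e) :
    μ {ω | ∀ j ≤ n, Z j ω = v j} = ∏ j ∈ Finset.range n, Q j (v j) (v (j + 1)) := by
  classical
  induction n with
  | zero => exact le_antisymm (by simpa using prob_le_one) (h 0 v hv)
  | succ n ih =>
    set f : F → ℝ≥0∞ := fun w => (∏ j ∈ Finset.range n, Q j (v j) (v (j + 1))) * Q n (v n) w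
    set A : F → Set Ω := fun w => {ω | (∀ j ≤ n, Z j ω = v j) ∧ Z (n + 1) ω = w} with hA
    have hfg : ∀ w, f w ≤ μ (A w) := by
      intro w
      have h1 := h (n + 1) (Function.update v (n + 1) w) (by simpa using hv)
      rw [Finset.prod_range_succ, Function.update_self, Function.update_of_ne (by omega),
        Finset.prod_congr rfl fun j hj => by
          rw [Function.update_of_ne (show j ≠ n + 1 by have := Finset.mem_range.1 hj; omega),
            Function.update_of_ne (show j + 1 ≠ n + 1 by have := Finset.mem_range.1 hj; omega)]]
        at h1
      refine h1.trans (measure_mono fun ω hω => ⟨fun j hj => ?_, ?_⟩)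
      · rw [hω j (by omega), Function.update_of_ne (by omega)]
      · rw [hω (n + 1) le_rfl, Function.update_self]
    have hsum : ∑' w, μ (A w) ≤ ∑' w, f w := by
      have h1 : ∑' w, f w = μ {ω | ∀ j ≤ n, Z j ω = v j} := by
        rw [ENNReal.tsum_mul_left, hQ, mul_one, ih]
      have hm : ∀ (j : ℕ) (w : F), MeasurableSet {ω | Z j ω = w} := fun j w =>
        hZ j (MeasurableSet.of_discrete (s := {w}))
      rw [h1]
      refine (tsum_meas_le_meas_iUnion_of_disjoint μ (fun w => ?_) fun w z hwz => ?_).trans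
        (measure_mono (Set.iUnion_subset fun w ω hω => hω.1))
      · have h2 : A w = (⋂ (j) (_ : j ≤ n), {ω | Z j ω = v j}) ∩ {ω | Z (n + 1) ω = w} := by
          ext ω
          simp [hA]
        rw [h2]
        exact (MeasurableSet.iInter fun j => MeasurableSet.iInter fun _ => hm j (v j)).inter
          (hm _ w)
      · exact Set.disjoint_left.2 fun ω h1 h2 => hwz (h1.2.symm.trans h2.2)
    have hfin : ∑' w, f w ≠ ⊤ := by
      rw [ENNReal.tsum_mul_left, hQ, mul_one, ← ih]
      exact measure_ne_top _ _
    have hle := (add_tsum_le_add_tsum hfg (v (n + 1))).trans (add_le_add_right hsum _)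
    have hAv : A (v (n + 1)) = {ω | ∀ j ≤ n + 1, Z j ω = v j} := by
      ext ω
      constructor
      · rintro ⟨h1, h2⟩ j hj
        rcases hj.lt_or_eq with hlt | rfl
        · exact h1 j (by omega)
        · exact h2
      · exact fun hω => ⟨fun j hj => hω j (by omega), hω (n + 1) le_rfl⟩
    rw [Finset.prod_range_succ, ← hAv]
    exact le_antisymm ((ENNReal.add_le_add_iff_right hfin).1 hle) (hfg _)

end PathSum

/-! ### The finite-dimensional distributions of the last row -/

variable {Ω : Type*} [MeasurableSpace Ω] {μ : Measure Ω} [IsProbabilityMeasure μ] {q : ℕ → ℝ}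
  {τ : Clock k → ℕ → Ω → ℝ} {Y : ℝ≥0 → Ω → GT k}

theorem IsWallModel.prod_kerPow_shortStep_le (hq : ∀ i, 1 ≤ i → i ≤ (k + 1) / 2 → 0 < q i)
    (hY : IsWallModel μ q τ Y) {T : ℕ → ℝ≥0} (hT : Monotone T) (h0 : T 0 = 0) (N n : ℕ)
    (x : ℕ → GT k) (hx : x 0 = GT.zero k) :
    ∏ j ∈ Finset.range n, kerPow (shortStep (totalRate k q) (flow q)
      ((T (j + 1) - T j) / (N + 1 : ℕ))) (N + 1) (x j) (x (j + 1)) ≤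
      μ {ω | ∀ j ≤ n, Y (T j) ω = x j} := by
  classical
  have : DiscreteMeasurableSpace (GT k) := ⟨fun _ => trivial⟩
  set h : ℕ → ℝ≥0 := fun j => (T (j + 1) - T j) / (N + 1 : ℕ)
  -- The subdivision of each interval between consecutive times `T j` into `N + 1` equal parts; `T
  -- j` is its point with index `j * (N + 1)`.
  set u : ℕ → ℝ≥0 := fun j => ∑ i ∈ Finset.range j, h (i / (N + 1)) with hu
  have hsub : ∀ j, u (j + 1) - u j = h (j / (N + 1)) := by
    intro j
    simp only [hu, Finset.sum_range_succ]
    exact add_tsub_cancel_left _ _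
  have humono : Monotone u := monotone_nat_of_le_succ fun j => by
    simp only [hu, Finset.sum_range_succ]
    exact le_self_add
  have huT : ∀ j, u (j * (N + 1)) = T j := by
    intro j
    induction j with
    | zero => simp [hu, h0]
    | succ j ih =>
      have h1 : ∀ i ∈ Finset.range (N + 1), h ((j * (N + 1) + i) / (N + 1)) = h j := by
        intro i hi
        rw [Nat.add_comm, Nat.add_mul_div_right _ _ (Nat.succ_pos N),
          Nat.div_eq_of_lt (Finset.mem_range.1 hi), zero_add]
      have h2 : u ((j + 1) * (N + 1)) = u (j * (N + 1)) + (T (j + 1) - T j) := by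
        simp only [hu]
        rw [add_mul, one_mul, Finset.sum_range_add, Finset.sum_congr rfl h1, Finset.sum_const,
          Finset.card_range, nsmul_eq_mul, mul_div_cancel₀ _ (by positivity)]
      rw [h2, ih, add_tsub_cancel_of_le (hT (Nat.le_succ j))]
  have key := le_measure_of_pathSum (μ := μ) (Y := fun j => Y (u j)) (fun j => hY.measurable _)
    (K := fun j => shortStep (totalRate k q) (flow q) (h (j / (N + 1)))) (e := GT.zero k)
    (fun n x hx => by
      have h1 := hY.prod_shortStep_le hq humono (by simp [hu]) n x hx
      simp_rw [hsub] at h1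
      exact h1)
    (fun j => if (N + 1) ∣ j then {x (j / (N + 1))} else Set.univ) (n * (N + 1)) 0 x hx
  have h2 := pathSum_refinement (fun j => shortStep (totalRate k q) (flow q) (h j)) x N n 0
  rw [zero_mul] at h2
  rw [h2, Finset.prod_range_zero, one_mul] at key
  simp only [zero_add] at key
  refine key.trans (measure_mono fun ω hω j hj => ?_)
  rcases Nat.eq_zero_or_pos j with rfl | hpos
  · have h3 := hω.1 0 le_rfl
    rwa [show u 0 = T 0 by simp [hu, h0]] at h3
  · have h3 := hω.2 (j * (N + 1)) (by positivity) (Nat.mul_le_mul_right _ hj)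
    rw [if_pos (Dvd.intro_left _ rfl), Nat.mul_div_cancel _ (Nat.succ_pos N), huT] at h3
    exact h3

theorem IsWallModel.prod_semigroup_le (hq : ∀ i, 1 ≤ i → i ≤ (k + 1) / 2 → 0 < q i)
    (hY : IsWallModel μ q τ Y) {T : ℕ → ℝ≥0} (hT : Monotone T) (h0 : T 0 = 0) (n : ℕ)
    (x : ℕ → GT k) (hx : x 0 = GT.zero k) :
    ∏ j ∈ Finset.range n, semigroup (totalRate k q) (flow q) (T (j + 1) - T j) (x j) (x (j + 1)) ≤
      μ {ω | ∀ j ≤ n, Y (T j) ω = x j} := by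
  refine le_of_tendsto' (ENNReal.tendsto_finsetProd_of_ne_top _ (fun j _ =>
    (tendsto_kerPow_shortStep (totalRate_nonneg hq) (tsum_flow hq) (T (j + 1) - T j) (x j)
      (x (j + 1))).comp (tendsto_add_atTop_nat 1)) fun j _ => ne_top_of_le_ne_top
        ENNReal.one_ne_top (semigroup_le_one (totalRate_nonneg hq) (tsum_flow hq) _ _ _))
    fun N => hY.prod_kerPow_shortStep_le hq hT h0 N n x hx

/-- Columns are nondecreasing, so every entry is bounded by one in the last row. -/
theorem GT.eq_zero_of_lastRow {x : GT k} (h : x.lastRow = (GT.zero k).lastRow) :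
    x = GT.zero k := by
  have hk : ∀ j, x.entry k j = 0 := by
    intro j
    by_cases hl : IsLabel k k j
    · have h1 := congrFun (congrArg Subtype.val h) ⟨j - 1, by have := hl.2.2; omega⟩
      have h2 : j - 1 + 1 = j := by have := hl.2.2.1; omega
      change x.entry k (j - 1 + 1) = 0 at h1
      rwa [h2] at h1
    · exact x.entry_eq_zero k j hl
  ext i j
  change x.entry i j = 0
  by_cases hl : IsLabel k i j
  · have h1 := x.entry_le_col hl hl.2.1 le_rfl
    rw [hk] at h1
    exact Nat.le_zero.1 h1
  · exact x.entry_eq_zero i j hl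

theorem link_zero (hq : ∀ i, 1 ≤ i → i ≤ (k + 1) / 2 → 0 < q i) (f : GT k → ℝ≥0∞) :
    ∑' x, link q (GT.zero k).lastRow x * f x = f (GT.zero k) := by
  have h : ∀ x, x ≠ GT.zero k → link q (GT.zero k).lastRow x = 0 := fun x hx =>
    link_of_ne fun hl => hx (GT.eq_zero_of_lastRow hl)
  have h1 := tsum_link hq (GT.zero k).lastRow
  rw [tsum_eq_single _ h] at h1
  rw [tsum_eq_single (GT.zero k) fun x hx => by rw [h x hx, zero_mul], h1, one_mul]

/-- The start in zero is the law `link` of the zero row, so the intertwining rewrites the product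
for the last row as a sum over paths of the model. The lower bound for the model then bounds the
last row, and mass one of the semigroup gives equality. -/
theorem IsWallModel.measure_lastRow (hq : ∀ i, 1 ≤ i → i ≤ (k + 1) / 2 → 0 < q i)
    (hY : IsWallModel μ q τ Y) {T : ℕ → ℝ≥0} (hT : Monotone T) (h0 : T 0 = 0) (n : ℕ)
    (v : ℕ → W k) (hv : v 0 = (GT.zero k).lastRow) :
    μ {ω | ∀ j ≤ n, (Y (T j) ω).lastRow = v j} =
      ∏ j ∈ Finset.range n,
        semigroup (totalRate k q) (rowFlow q) (T (j + 1) - T j) (v j) (v (j + 1)) := by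
  have : DiscreteMeasurableSpace (GT k) := ⟨fun _ => trivial⟩
  refine measure_eq_prod_of_le (Z := fun j ω => (Y (T j) ω).lastRow)
    (fun j => (measurable_from_top (f := GT.lastRow)).comp (hY.measurable (T j)))
    (Q := fun j => semigroup (totalRate k q) (rowFlow q) (T (j + 1) - T j))
    (fun j v => tsum_semigroup (totalRate_nonneg hq) (tsum_rowFlow hq) _ _)
    (e := (GT.zero k).lastRow) (fun n v hv => ?_) n v hv
  have h1 := tsum_link_mul_pathSum (tsum_link hq) (fun v x => link_of_ne (q := q))
    (fun j => tsum_link_mul_semigroup (fun v x => link_of_ne (q := q)) (tsum_link_mul_flow hq)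
      (totalRate k q) (T (j + 1) - T j)) v n 0
  simp only [zero_add, hv] at h1
  rw [link_zero hq] at h1
  rw [← h1]
  have h2 := le_measure_of_pathSum (μ := μ) (Y := fun j => Y (T j)) (fun j => hY.measurable _)
    (K := fun j => semigroup (totalRate k q) (flow q) (T (j + 1) - T j)) (e := GT.zero k)
    (fun n x hx => hY.prod_semigroup_le hq hT h0 n x hx) (fun j => {x | x.lastRow = v j}) n 0
    (fun _ => GT.zero k) rfl
  rw [Finset.prod_range_zero, one_mul] at h2
  refine h2.trans (measure_mono fun ω hω j hj => ?_)
  rcases Nat.eq_zero_or_pos j with rfl | hpos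
  · have h3 := hω.1 0 le_rfl
    rw [h3, hv]
  · exact hω.2 j hpos (by omega)

end WallModel

theorem mainTheorem4 {Ω : Type*} [MeasurableSpace Ω] (μ : MeasureTheory.Measure Ω)
    [MeasureTheory.IsProbabilityMeasure μ] (k : ℕ) (hk : 1 ≤ k) (q : ℕ → ℝ)
    (hq : ∀ i, 1 ≤ i → i ≤ (k + 1) / 2 → 0 < q i)
    (τ : WallModel.Clock k → ℕ → Ω → ℝ) (Y : NNReal → Ω → WallModel.GT k)
    (hY : WallModel.IsWallModel μ q τ Y) :
    WallModel.IsMarkovWithGenerator μ (fun t ω => (Y t ω).lastRow)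
      (WallModel.generator q) := by
  open WallModel in
  classical
  refine ⟨fun t => (measurable_from_top (f := GT.lastRow)).comp (hY.measurable t),
    fun t v w => (semigroup (totalRate k q) (rowFlow q) t v w).toReal,
    isTransitionFunction_semigroup (totalRate_nonneg hq) (tsum_rowFlow hq), fun v w => ?_,
    fun n t x ht => ?_⟩
  · have h := hasDerivWithinAt_semigroup (totalRate_nonneg hq) (tsum_rowFlow hq) v w
    rw [generator_eq hq]
    convert! h using 2
    by_cases hvw : v = w <;> simp [kerPow, hvw]
  · let T : ℕ → ℝ≥0 := fun j => if j = 0 then 0 else t (Fin.ofNat (n + 1) (min (j - 1) n))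
    let v : ℕ → W k := fun j =>
      if j = 0 then (GT.zero k).lastRow else x (Fin.ofNat (n + 1) (min (j - 1) n))
    have hidx : ∀ j, j ≤ n → ((Fin.ofNat (n + 1) (min j n) : Fin (n + 1)) : ℕ) = j := by
      intro j hj
      rw [Fin.val_ofNat, min_eq_left hj, Nat.mod_eq_of_lt (by omega)]
    have hT : Monotone T := by
      refine monotone_nat_of_le_succ fun j => ?_
      rcases Nat.eq_zero_or_pos j with rfl | hj
      · exact zero_le
      · simp only [T, if_neg hj.ne', if_neg (Nat.succ_ne_zero j)]
        refine ht (Fin.le_def.2 ?_)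
        rw [Fin.val_ofNat, Fin.val_ofNat, Nat.mod_eq_of_lt (by omega), Nat.mod_eq_of_lt (by omega)]
        omega
    have hTv : ∀ i : Fin (n + 1), T (i + 1) = t i ∧ v (i + 1) = x i := by
      intro i
      have h : (Fin.ofNat (n + 1) (min ((i : ℕ) + 1 - 1) n) : Fin (n + 1)) = i :=
        Fin.ext (hidx i (by omega))
      simp only [T, v, if_neg (Nat.succ_ne_zero _), h, and_self]
    have hset : ∀ m, m ≤ n → μ {ω | ∀ i : Fin (n + 1), (i : ℕ) ≤ m → (Y (t i) ω).lastRow = x i} =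
        ∏ j ∈ Finset.range (m + 1),
          semigroup (totalRate k q) (rowFlow q) (T (j + 1) - T j) (v j) (v (j + 1)) := by
      intro m hm
      rw [← hY.measure_lastRow hq hT rfl (m + 1) v rfl]
      refine measure_congr ?_
      filter_upwards [hY.follows] with ω hω
      refine propext ⟨fun h j hj => ?_, fun h i hi => ?_⟩
      · cases j with
        | zero => exact congrArg GT.lastRow hω.start
        | succ j =>
          have h1 := h ⟨j, by omega⟩ (by simp; omega)
          have h2 := hTv ⟨j, by omega⟩
          rw [← h2.1, ← h2.2] at h1
          exact h1
      · have h1 := h (i + 1) (by omega)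
        rwa [(hTv i).1, (hTv i).2] at h1
    have h1 := hset n le_rfl
    have h2 := hset 0 (Nat.zero_le n)
    have e1 : {ω | ∀ i : Fin (n + 1), (i : ℕ) ≤ n → (Y (t i) ω).lastRow = x i} =
        {ω | ∀ i, (Y (t i) ω).lastRow = x i} := by
      ext ω
      exact ⟨fun h i => h i (by omega), fun h i _ => h i⟩
    have e2 : {ω | ∀ i : Fin (n + 1), (i : ℕ) ≤ 0 → (Y (t i) ω).lastRow = x i} =
        {ω | (Y (t 0) ω).lastRow = x 0} := by
      ext ω
      refine ⟨fun h => h 0 le_rfl, fun h i hi => ?_⟩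
      obtain rfl : i = 0 := Fin.ext (by simpa using hi)
      exact h
    -- The factor of the added step from time `0` to `t 0` is, by the case of a single time, the
    -- probability of `x 0` at time `t 0`.
    rw [e1, Finset.prod_range_succ'] at h1
    rw [e2, Finset.prod_range_one] at h2
    rw [← h2, mul_comm, Finset.prod_range] at h1
    rw [measureReal_def, measureReal_def, h1, ENNReal.toReal_mul, ENNReal.toReal_prod]
    congr 1
    refine Finset.prod_congr rfl fun i _ => ?_
    have h3 := hTv i.succ
    have h4 := hTv i.castSucc
    rw [Fin.val_succ] at h3
    rw [Fin.val_castSucc] at h4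
    rw [h3.1, h3.2, h4.1, h4.2]
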